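/- **Setting.** Let $\mathbb X$ be a nonempty compact metric space, $\mathbb S=C(\mathbb X)$ the space of real continuous functions on $\mathbb X$ with the supremum norm and its Borel $\sigma$-algebra, and $\tau:\mathbb X\to[0,\infty)$ continuous. Let $\mathbb M$ be the set of Gaussian measures on $\mathbb S$, with the $\sigma$-algebra generated by the maps $\nu\mapsto\nu(A)$; $m_\nu$, $k_\nu$ denote the mean and covariance functions of $\nu\in\mathbb M$, and $\nu_n\to\nu$ means that $m_{\nu_n}\to m_\nu$ and $k_{\nu_n}\to k_\nu$ uniformly. For $x\in\mathbb X$, $z\in\mathbb R$, let $s_\nu^2(x)=k_\nu(x,x)+\tau^2(x)$ and let $\mathrm{Cond}_{x,z}(\nu)\in\mathbb M$ be the conditional distribution of $\xi\sim\nu$ given $\xi(x)+\tau(x)U=z$ ($U\sim N(0,1)$ independent of $\xi$), i.e. the Gaussian measure with mean $m_\nu+\frac{k_\nu(\cdot,x)}{s_\nu^2(x)}(z-m_\nu(x))$ and covariance $k_\nu(y,y')-\frac{k_\nu(y,x)k_\nu(x,y')}{s_\nu^2(x)}$ (both corrections being $0$ if $s^2_\nu(x)=0$). *Designs.* Let $\xi$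 be a Gaussian process on $\mathbb X$ with continuous sample paths on a probability space, let $U_1,U_2,\dots$ be i.i.d. $N(0,1)$ and independent of $\xi$, $Z_n=\xi(X_n)+\tau(X_n)U_n$ and $\mathcal F_n=\sigma(X_1,Z_1,\dots,X_n,Z_n)$, $\mathcal F_\infty=\bigvee_n\mathcal F_n$. A sequential design is a sequence $(X_n)_{n\ge1}$ with $X_n$ $\mathcal F_{n-1}$-measurable. Let $P_0^\xi$ be the law of $\xi$ and $P_{n+1}^\xi=\mathrm{Cond}_{X_{n+1},Z_{n+1}}(P_n^\xi)$. *Functionals.* For $H:\mathbb M\to[0,\infty)$ measurable put $\mathcal J_x(\nu)=\iint H(\mathrm{Cond}_{x,f(x)+u\tau(x)}(\nu))\,\nu(df)\,\varphi(u)\,du$ ($\varphi$ the $N(0,1)$ density) and $\mathcal G(\nu)=\sup_x\,(H(\nu)-\mathcal J_x(\nu))$. For positive numbers $\varepsilon_n$, a sequential design is $\varepsilon$-quasi-SUR for $H$ if, for some $n_0$, almost surely $\mathcal J_{X_{n+1}}(P_n^\xi)\le\inf_x\mathcal J_x(P_n^\xi)+\varepsilon_n$ for all $n\ge n_0$; it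 is quasi-SUR if this holds for some such sequence with $\varepsilon_n\to0$. A measurable $H:\mathbb M\to\mathbb R$ has the supermartingale property if $(H(P_n^\xi))_n$ is an $(\mathcal F_n)$-supermartingale for all such $\xi$, $(U_n)$ and all sequential designs. For a Gaussian random element $\xi$ of $\mathbb S$, let $\mathfrak P(\xi)$ be the set of all random elements of $\mathbb M$ that are conditional distributions of $\xi$ given some sub-$\sigma$-algebra. $H$ is $\mathfrak P$-uniformly integrable if $(H(\boldsymbol\nu))_{\boldsymbol\nu\in\mathfrak P(\xi)}$ is uniformly integrable for every such $\xi$, and $\mathfrak P$-continuous if, for every such $\xi$, $\boldsymbol\nu_n\to\boldsymbol\nu_\infty$ a.s. with all $\boldsymbol\nu_n,\boldsymbol\nu_\infty\in\mathfrak P(\xi)$ implies $H(\boldsymbol\nu_n)\to H(\boldsymbol\nu_\infty)$ a.s. *Regular losses.* Let $L:\mathbb S\times\mathbb D\to[0,\infty)$, $\overline L_\nu(d)=\int L(f,d)\,\nu(df)$ and $H(\nu)=\inf_d\overline L_\nu(d)$. $L$ is regular if $\mathbb D$ is separable, each $L(\cdot,d)$ is measurable, $\overline L_\nu$ is finite and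 continuous on $\mathbb D$ for each $\nu\in\mathbb M$, $(\ast)$ $H(\nu)=\int L_0\,d\nu+H_1(\nu)$ with a measurable $L_0$ that is integrable for every $\nu\in\mathbb M$ and a measurable $H_1$ that is $\mathfrak P$-uniformly integrable and $\mathfrak P$-continuous, and $\{H=0\}=\{\mathcal G=0\}$. **Theorem.** The knowledge-gradient loss $L(f,d)=\max_{u\in\mathbb X}f(u)-f(d)$, $d\in\mathbb D=\mathbb X$, is regular. Its functional is $H(\nu)=\int\max f\,\nu(df)-\max_{\mathbb X}m_\nu$. Consequently: 1. $H$ is non-negative, measurable and has the supermartingale property, and it has a decomposition $(\ast)$ in which $H_1$ moreover has the supermartingale property. 2. For every $\xi$, $(U_n)$ as above and every sequence $\varepsilon$ of positive numbers there is an $\varepsilon$-quasi-SUR sequential design for $H$ (one can even have the defining inequality for all $n\ge 0$ and at every point of the probability space). 3. For every sequential design, $P_n^\xi$ is an $\mathcal F_n$-measurable version of the conditional distribution of $\xi$ given $\mathcal F_n$, and there is an $\mathcal F_\infty$-measurable random element $P_\infty^\xi$ of $\mathbb M$ that is a conditional distribution of $\xi$ given $\mathcal F_\infty$, with $P_n^\xi\to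 P_\infty^\xi$ and $H(P_n^\xi)\to H(P_\infty^\xi)$ a.s.; if the design is quasi-SUR for $H$, then also $\mathcal G(P_\infty^\xi)=0$ and $\mathcal G(P_n^\xi)\to0$ a.s. 4. For every quasi-SUR sequential design for $H$, $H(P_n^\xi)\to0$ almost surely. -/

import Mathlib

open MeasureTheory ProbabilityTheory Filter Topology
open scoped NNReal ENNReal

universe u v w

namespace SUR

/-! ### The space of continuous functions and its Borel sets -/

instance instMeasurableSpaceContinuousMap {X : Type u} [TopologicalSpace X] :
    MeasurableSpace C(X, ℝ) := borel _

instance instBorelSpaceContinuousMap {X : Type u} [TopologicalSpace X] :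
    BorelSpace C(X, ℝ) := ⟨rfl⟩

/-! ### A continuous Gaussian process is a Gaussian random element -/

/-- Finite-rank approximation of the identity of `C(X, ℝ)` by point evaluations. -/
theorem exists_evaluation_approx (X : Type u) [MetricSpace X] [CompactSpace X] :
    ∃ (t : ℕ → Finset X) (ρ : ℕ → X → C(X, ℝ)), ∀ f : C(X, ℝ),
      Tendsto (fun n => ∑ i ∈ t n, f i • ρ n i) atTop (𝓝 f) := by
  have hcov : ∀ n : ℕ, ∃ t : Finset X, ∀ x : X, ∃ i ∈ t, dist x i < 1 / ((n : ℝ) + 1) := by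
    intro n
    have hpos : 0 < 1 / ((n : ℝ) + 1) := by positivity
    obtain ⟨s, -, hs, hs'⟩ := (isCompact_univ (X := X)).finite_cover_balls hpos
    refine ⟨hs.toFinset, fun x => ?_⟩
    have := hs' (Set.mem_univ x)
    simp only [Set.mem_iUnion, Metric.mem_ball] at this
    obtain ⟨i, hi, hxi⟩ := this
    exact ⟨i, by simpa using hi, hxi⟩
  choose t ht using hcov
  let g : ℕ → X → X → ℝ := fun n i x => max 0 (1 / ((n : ℝ) + 1) - dist x i)
  have hg0 : ∀ n i x, 0 ≤ g n i x := fun n i x => le_max_left _ _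
  have hgc : ∀ n i, Continuous (g n i) := fun n i => by fun_prop
  have hsum : ∀ n x, 0 < ∑ i ∈ t n, g n i x := by
    intro n x
    obtain ⟨i, hi, hxi⟩ := ht n x
    refine Finset.sum_pos' (fun i _ => hg0 n i x) ⟨i, hi, ?_⟩
    exact lt_max_of_lt_right (by linarith)
  refine ⟨t, fun n i => ⟨fun x => g n i x / ∑ j ∈ t n, g n j x, ?_⟩, fun f => ?_⟩
  · exact (hgc n i).div (continuous_finsetSum _ fun j _ => hgc n j) fun x => (hsum n x).ne'
  · rw [Metric.tendsto_atTop]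
    intro ε hε
    have huc := CompactSpace.uniformContinuous_of_continuous f.continuous
    obtain ⟨δ, hδ, hδf⟩ := Metric.uniformContinuous_iff.1 huc (ε / 2) (by positivity)
    obtain ⟨N, hN⟩ := exists_nat_one_div_lt hδ
    refine ⟨N, fun n hn => ?_⟩
    have hnδ : 1 / ((n : ℝ) + 1) < δ := lt_of_le_of_lt (by gcongr) hN
    refine lt_of_le_of_lt ((ContinuousMap.dist_le (by positivity : (0 : ℝ) ≤ ε / 2)).2
      fun x => ?_) (by linarith)
    have hS := hsum n x
    set S := ∑ j ∈ t n, g n j x with hSdef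
    have h1 : (∑ i ∈ t n, f i • (⟨fun x => g n i x / ∑ j ∈ t n, g n j x,
        (hgc n i).div (continuous_finsetSum _ fun j _ => hgc n j) fun x => (hsum n x).ne'⟩ :
          C(X, ℝ))) x = ∑ i ∈ t n, f i * (g n i x / S) := by
      simp [ContinuousMap.sum_apply, hSdef]
    have h2 : f x = ∑ i ∈ t n, f x * (g n i x / S) := by
      rw [← Finset.mul_sum, ← Finset.sum_div, div_self hS.ne', mul_one]
    rw [h1, Real.dist_eq]
    calc |∑ i ∈ t n, f i * (g n i x / S) - f x|
        = |∑ i ∈ t n, (f i * (g n i x / S) - f x * (g n i x / S))| := by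
          rw [Finset.sum_sub_distrib, ← h2]
      _ ≤ ∑ i ∈ t n, |f i * (g n i x / S) - f x * (g n i x / S)| :=
          Finset.abs_sum_le_sum_abs _ _
      _ ≤ ∑ i ∈ t n, ε / 2 * (g n i x / S) := by
          refine Finset.sum_le_sum fun i _ => ?_
          rw [← sub_mul, abs_mul, abs_of_nonneg (div_nonneg (hg0 n i x) hS.le)]
          rcases (hg0 n i x).eq_or_lt with h0 | h0
          · simp [← h0]
          · refine mul_le_mul_of_nonneg_right ?_ (div_nonneg (hg0 n i x) hS.le)
            have hd : dist x i < 1 / ((n : ℝ) + 1) := by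
              by_contra hcon
              have : g n i x = 0 := max_eq_left (by linarith)
              linarith
            have := hδf (a := i) (b := x) (by rw [dist_comm]; linarith)
            rw [Real.dist_eq] at this
            exact this.le
      _ = ε / 2 := by rw [← Finset.mul_sum, ← Finset.sum_div, div_self hS.ne', mul_one]

/-- A pointwise limit of real Gaussian random variables is Gaussian. -/
theorem map_eq_gaussianReal_of_tendsto {Ω : Type w} [MeasurableSpace Ω] {P : Measure Ω}
    [IsProbabilityMeasure P] {Y : ℕ → Ω → ℝ} {Z : Ω → ℝ} (hY : ∀ n, HasGaussianLaw (Y n) P)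
    (hZ : Measurable Z) (hlim : ∀ ω, Tendsto (fun n => Y n ω) atTop (𝓝 (Z ω))) :
    ∃ m v, P.map Z = gaussianReal m v := by
  have hYm : ∀ n, AEMeasurable (Y n) P := fun n => (hY n).aemeasurable
  obtain ⟨a, ha⟩ : ∃ a : ℕ → ℝ, a = fun n => P[Y n] := ⟨_, rfl⟩
  obtain ⟨b, hb⟩ : ∃ b : ℕ → ℝ≥0, b = fun n => Var[Y n; P].toNNReal := ⟨_, rfl⟩
  have hlaw : ∀ n, P.map (Y n) = gaussianReal (a n) (b n) := fun n => by
    rw [ha, hb]; exact (hY n).map_eq_gaussianReal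
  have : IsProbabilityMeasure (P.map Z) := Measure.isProbabilityMeasure_map hZ.aemeasurable
  have hφ : ∀ s : ℝ, Tendsto (fun n => charFun (gaussianReal (a n) (b n)) s) atTop
      (𝓝 (charFun (P.map Z) s)) := by
    intro s
    simp_rw [← hlaw, charFun_apply_real]
    rw [integral_map hZ.aemeasurable (by fun_prop)]
    have : ∀ n, ∫ x, Complex.exp (s * x * Complex.I) ∂(P.map (Y n))
        = ∫ ω, Complex.exp (s * (Y n ω) * Complex.I) ∂P := fun n =>
      integral_map (hYm n) (by fun_prop)
    simp_rw [this]
    refine tendsto_integral_of_dominated_convergence (fun _ => 1) (fun n => ?_)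
      (integrable_const _) (fun n => ?_) ?_
    · have := hYm n
      exact (by fun_prop : AEMeasurable (fun ω => Complex.exp (s * (Y n ω) * Complex.I)) P).aestronglyMeasurable
    · refine Eventually.of_forall fun ω => ?_
      rw [← Complex.ofReal_mul, Complex.norm_exp_ofReal_mul_I]
    · refine Eventually.of_forall fun ω => ?_
      have hc : Continuous fun y : ℝ => Complex.exp (s * y * Complex.I) := by fun_prop
      exact (hc.tendsto _).comp (hlim ω)
  simp_rw [charFun_gaussianReal] at hφ
  -- convergence of the variances
  have hcont : Continuous (charFun (P.map Z)) := by fun_prop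
  obtain ⟨s, hs0, hs⟩ : ∃ s : ℝ, s ≠ 0 ∧ charFun (P.map Z) s ≠ 0 := by
    have h1 : ∀ᶠ s in 𝓝 (0 : ℝ), charFun (P.map Z) s ≠ 0 :=
      hcont.continuousAt.eventually_ne (by simp)
    have h2 : ∀ᶠ s in 𝓝[≠] (0 : ℝ), charFun (P.map Z) s ≠ 0 := h1.filter_mono nhdsWithin_le_nhds
    obtain ⟨s, hs, hs'⟩ := (h2.and self_mem_nhdsWithin).exists
    exact ⟨s, hs', hs⟩
  have hnorm : ∀ n (r : ℝ), ‖Complex.exp (r * (a n) * Complex.I - (b n) * r ^ 2 / 2)‖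
      = Real.exp (-((b n : ℝ) * r ^ 2 / 2)) := by
    intro n r
    rw [Complex.norm_exp]
    congr 1
    have : (r * (a n) * Complex.I - (b n) * r ^ 2 / 2 : ℂ)
        = ((-((b n : ℝ) * r ^ 2 / 2) : ℝ) : ℂ) + ((r * a n : ℝ) : ℂ) * Complex.I := by
      push_cast; ring
    rw [this, Complex.add_re, Complex.ofReal_re, Complex.re_ofReal_mul, Complex.I_re]
    ring
  have hb' : Tendsto (fun n => (b n : ℝ)) atTop
      (𝓝 (-Real.log ‖charFun (P.map Z) s‖ * (2 / s ^ 2))) := by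
    have h1 := (hφ s).norm.log (by simpa using hs)
    have h2 := h1.neg.mul_const (2 / s ^ 2)
    refine h2.congr fun n => ?_
    rw [hnorm, Real.log_exp]
    field_simp
  obtain ⟨v, hv⟩ : ∃ v : ℝ≥0, Tendsto b atTop (𝓝 v) := by
    have h0 := ge_of_tendsto' hb' fun n => (b n).coe_nonneg
    lift (-Real.log ‖charFun (P.map Z) s‖ * (2 / s ^ 2)) to ℝ≥0 using h0 with v hv
    exact ⟨v, NNReal.tendsto_coe.1 hb'⟩
  have hvR : Tendsto (fun n => (b n : ℝ)) atTop (𝓝 (v : ℝ)) := NNReal.tendsto_coe.2 hv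
  have hvC : Tendsto (fun n => ((b n : ℝ) : ℂ)) atTop (𝓝 ((v : ℝ) : ℂ)) :=
    (Complex.continuous_ofReal.tendsto _).comp hvR
  -- convergence of the means along a subsequence
  have hdir : ∀ r : ℝ, Tendsto (fun n => charFun (Measure.dirac (a n)) r) atTop
      (𝓝 (charFun (P.map Z) r * Complex.exp ((v : ℝ) * r ^ 2 / 2))) := by
    intro r
    have h2 : Tendsto (fun n => Complex.exp (((b n : ℝ) : ℂ) * r ^ 2 / 2)) atTop
        (𝓝 (Complex.exp (((v : ℝ) : ℂ) * r ^ 2 / 2))) :=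
      (Complex.continuous_exp.tendsto _).comp ((hvC.mul_const _).div_const _)
    refine ((hφ r).mul h2).congr fun n => ?_
    rw [← Complex.exp_add, charFun_apply_real]
    simp
  have htight := isTightMeasureSet_of_tendsto_charFun
    (μ := fun n => Measure.dirac (a n))
    (f := fun r : ℝ => charFun (P.map Z) r * Complex.exp ((v : ℝ) * r ^ 2 / 2))
    (by fun_prop) hdir
  obtain ⟨K, hK, hKa⟩ : ∃ K : Set ℝ, IsCompact K ∧ ∀ n, a n ∈ K := by
    rw [isTightMeasureSet_iff_exists_isCompact_measure_compl_le] at htight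
    obtain ⟨K, hK, hK'⟩ := htight (1 / 2) (by simp)
    refine ⟨K, hK, fun n => ?_⟩
    by_contra hn
    have := hK' _ ⟨n, rfl⟩
    rw [Measure.dirac_apply_of_mem (by simpa using hn)] at this
    norm_num at this
  obtain ⟨m, -, ψ, hψ, hm⟩ := hK.tendsto_subseq hKa
  refine ⟨m, v, ?_⟩
  refine Measure.ext_of_charFun (funext fun r => ?_)
  refine tendsto_nhds_unique ((hφ r).comp hψ.tendsto_atTop) ?_
  rw [charFun_gaussianReal]
  have hmC : Tendsto (fun n => ((a (ψ n) : ℝ) : ℂ)) atTop (𝓝 (m : ℂ)) :=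
    (Complex.continuous_ofReal.tendsto _).comp hm
  refine (Complex.continuous_exp.tendsto _).comp ?_
  exact ((hmC.const_mul _).mul_const _).sub
    (((hvC.comp hψ.tendsto_atTop).mul_const _).div_const _)

section GaussianProcess

variable {X : Type u} [MetricSpace X] [CompactSpace X] {Ω : Type w} [MeasurableSpace Ω]

theorem measurable_of_eval {ξ : Ω → C(X, ℝ)} (hξ : ∀ x, Measurable fun ω => ξ ω x) :
    Measurable ξ := by
  obtain ⟨t, ρ, h⟩ := exists_evaluation_approx X
  refine measurable_of_tendsto_metrizable (f := fun n ω => ∑ i ∈ t n, ξ ω i • ρ n i)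
    (fun n => ?_) (tendsto_pi_nhds.2 fun ω => h (ξ ω))
  exact Finset.measurable_sum _ fun i _ => (hξ i).smul_const _

theorem isGaussian_map_of_isGaussianProcess {P : Measure Ω} {ξ : Ω → C(X, ℝ)}
    (hξ : ∀ x, Measurable fun ω => ξ ω x) (hG : IsGaussianProcess (fun x ω => ξ ω x) P) :
    IsGaussian (P.map ξ) := by
  have := hG.isProbabilityMeasure
  obtain ⟨t, ρ, h⟩ := exists_evaluation_approx X
  refine isGaussian_of_map_eq_gaussianReal fun L => ?_
  rw [Measure.map_map (by fun_prop) (measurable_of_eval hξ)]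
  refine map_eq_gaussianReal_of_tendsto
    (Y := fun n ω => ∑ i ∈ t n, L (ρ n i) * ξ ω i) (fun n => ?_)
    (L.continuous.measurable.comp (measurable_of_eval hξ)) fun ω => ?_
  · exact (hG.smul fun i => L (ρ n i)).hasGaussianLaw_fun_sum
  · have := (L.continuous.tendsto _).comp (h (ξ ω))
    refine this.congr fun n => ?_
    simp [mul_comm]

end GaussianProcess

/-! ### Gaussian measures on `C(X, ℝ)` -/

/-- The set of all Gaussian measures on `C(X, ℝ)`; as a subtype of `Measure C(X, ℝ)` it carries the
σ-algebra generated by the evaluation maps `ν ↦ ν A`. -/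
abbrev GaussianMeasures (X : Type u) [TopologicalSpace X] : Type u :=
  {ν : Measure C(X, ℝ) // IsGaussian ν}

section GaussianMeasures

variable {X : Type u} [MetricSpace X] [CompactSpace X]

/-- The mean function of `ν`. -/
noncomputable def mean (ν : GaussianMeasures X) (x : X) : ℝ := ∫ f, f x ∂ν.1

/-- The covariance function of `ν`. -/
noncomputable def cov (ν : GaussianMeasures X) (x y : X) : ℝ :=
  cov[fun f : C(X, ℝ) => f x, fun f : C(X, ℝ) => f y; ν.1]

/-- Convergence of Gaussian measures: uniform convergence of the mean functions and of the
covariance functions. -/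
def GaussianTendsto (νs : ℕ → GaussianMeasures X) (ν : GaussianMeasures X) : Prop :=
  TendstoUniformly (fun n => mean (νs n)) (mean ν) atTop ∧
    TendstoUniformly (fun n (p : X × X) => cov (νs n) p.1 p.2) (fun p => cov ν p.1 p.2) atTop

theorem memLp_two_eval (ν : GaussianMeasures X) (x : X) :
    MemLp (fun f : C(X, ℝ) => f x) 2 ν.1 :=
  have := ν.2
  IsGaussian.memLp_dual ν.1 (ContinuousMap.evalCLM ℝ x) 2 (by simp)

theorem integrable_cov_integrand (ν : GaussianMeasures X) (x : X) :
    Integrable (fun f : C(X, ℝ) => (f x - mean ν x) • (f - ∫ g, g ∂ν.1)) ν.1 := by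
  have := ν.2
  have h1 : MemLp (fun f : C(X, ℝ) => f x - mean ν x) 2 ν.1 :=
    (memLp_two_eval ν x).sub (memLp_const _)
  have h2 : MemLp (fun f : C(X, ℝ) => f - ∫ g, g ∂ν.1) 2 ν.1 :=
    (IsGaussian.memLp_two_id (μ := ν.1)).sub (memLp_const _)
  exact memLp_one_iff_integrable.1 (h2.smul h1)

theorem integral_cov_integrand_apply (ν : GaussianMeasures X) (x y : X) :
    (∫ f : C(X, ℝ), (f x - mean ν x) • (f - ∫ g, g ∂ν.1) ∂ν.1) y = cov ν x y := by
  have := ν.2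
  rw [ContinuousMap.integral_apply (integrable_cov_integrand ν x) y]
  have : (∫ g, g ∂ν.1 : C(X, ℝ)) y = ∫ g : C(X, ℝ), g y ∂ν.1 :=
    ContinuousMap.integral_apply (f := fun g : C(X, ℝ) => g) IsGaussian.integrable_id y
  simp only [ContinuousMap.smul_apply, ContinuousMap.sub_apply, this, smul_eq_mul]
  rfl

/-- The continuous function `k_ν(x, ·)`. -/
noncomputable def covSection (ν : GaussianMeasures X) (x : X) : C(X, ℝ) where
  toFun := cov ν x
  continuous_toFun := by
    rw [← funext (integral_cov_integrand_apply ν x)]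
    exact ContinuousMap.continuous _

/-- The predictive variance `s_ν²(x) = k_ν(x, x) + τ²(x)`. -/
noncomputable def predVar (τ : C(X, ℝ≥0)) (ν : GaussianMeasures X) (x : X) : ℝ :=
  cov ν x x + (τ x : ℝ) ^ 2

/-- The map whose image measure is the conditional distribution: for `f ∼ ν` and an independent
standard Gaussian `u`, the prediction residual `z - (f x + τ x u)` is propagated to `f` with the
kriging gain `k_ν(x, ·) / s_ν²(x)` (read as zero when `s_ν²(x) = 0`, as `a / 0 = 0`). -/
noncomputable def condMap (τ : C(X, ℝ≥0)) (x : X) (z : ℝ) (ν : GaussianMeasures X)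
    (p : C(X, ℝ) × ℝ) : C(X, ℝ) :=
  p.1 + ((z - (p.1 x + τ x * p.2)) / predVar τ ν x) • covSection ν x

theorem continuous_condMap (τ : C(X, ℝ≥0)) (x : X) (z : ℝ) (ν : GaussianMeasures X) :
    Continuous (condMap τ x z ν) := by
  unfold condMap
  have : Continuous fun p : C(X, ℝ) × ℝ => p.1 x :=
    (ContinuousMap.evalCLM ℝ x).continuous.comp continuous_fst
  fun_prop

theorem isGaussian_map_condMap (τ : C(X, ℝ≥0)) (x : X) (z : ℝ) (ν : GaussianMeasures X) :
    IsGaussian ((ν.1.prod (gaussianReal 0 1)).map (condMap τ x z ν)) := by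
  have := ν.2
  let B : C(X, ℝ) × ℝ →L[ℝ] ℝ := (predVar τ ν x)⁻¹ •
    ((ContinuousMap.evalCLM ℝ x).comp (ContinuousLinearMap.fst ℝ C(X, ℝ) ℝ) +
      (τ x : ℝ) • ContinuousLinearMap.snd ℝ C(X, ℝ) ℝ)
  let A : C(X, ℝ) × ℝ →L[ℝ] C(X, ℝ) :=
    ContinuousLinearMap.fst ℝ C(X, ℝ) ℝ - B.smulRight (covSection ν x)
  have hA : condMap τ x z ν = (fun g => g + (z / predVar τ ν x) • covSection ν x) ∘ A := by
    funext p
    ext y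
    simp [A, B, condMap]
    ring
  rw [hA, ← Measure.map_map (by fun_prop) (by fun_prop)]
  infer_instance

/-- The conditioning operator `Cond_{x, z}`: the conditional distribution of `ξ ∼ ν` given that
the noisy observation `ξ x + τ x U` is equal to `z`. It is the Gaussian measure with the mean and
covariance functions given in `mean_cond` and `cov_cond`. -/
noncomputable def cond (τ : C(X, ℝ≥0)) (x : X) (z : ℝ) (ν : GaussianMeasures X) :
    GaussianMeasures X :=
  ⟨(ν.1.prod (gaussianReal 0 1)).map (condMap τ x z ν), isGaussian_map_condMap τ x z ν⟩

section CondMoments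

set_option linter.unusedSectionVars false

variable (τ : C(X, ℝ≥0)) (x : X) (z : ℝ) (ν : GaussianMeasures X)

theorem memLp_two_eval_fst (y : X) :
    MemLp (fun p : C(X, ℝ) × ℝ => p.1 y) 2 (ν.1.prod (gaussianReal 0 1)) :=
  have := ν.2
  (memLp_two_eval ν y).comp_fst (gaussianReal 0 1)

theorem memLp_two_snd :
    MemLp (fun p : C(X, ℝ) × ℝ => p.2) 2 (ν.1.prod (gaussianReal 0 1)) :=
  have := ν.2
  (memLp_id_gaussianReal (μ := 0) (v := 1) 2).comp_snd ν.1

theorem condMap_apply (p : C(X, ℝ) × ℝ) (y : X) : condMap τ x z ν p y =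
    p.1 y + (z - (p.1 x + τ x * p.2)) / predVar τ ν x * cov ν x y := by
  simp [condMap, covSection]

theorem mean_cond (y : X) : mean (cond τ x z ν) y =
    mean ν y + cov ν x y / predVar τ ν x * (z - mean ν x) := by
  have := ν.2
  have hi : ∀ y, Integrable (fun p : C(X, ℝ) × ℝ => p.1 y) (ν.1.prod (gaussianReal 0 1)) :=
    fun y => (memLp_two_eval_fst ν y).integrable (by norm_num)
  have hs : Integrable (fun p : C(X, ℝ) × ℝ => p.2) (ν.1.prod (gaussianReal 0 1)) :=
    (memLp_two_snd ν).integrable (by norm_num)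
  have he : ∀ y, ∫ p : C(X, ℝ) × ℝ, p.1 y ∂(ν.1.prod (gaussianReal 0 1)) = mean ν y := fun y => by
    rw [integral_fun_fst (fun f : C(X, ℝ) => f y)]
    simp [mean]
  have hu : ∫ p : C(X, ℝ) × ℝ, p.2 ∂(ν.1.prod (gaussianReal 0 1)) = 0 := by
    rw [integral_fun_snd (fun u : ℝ => u)]
    simp [integral_id_gaussianReal]
  have hmap : mean (cond τ x z ν) y =
      ∫ p, condMap τ x z ν p y ∂(ν.1.prod (gaussianReal 0 1)) :=
    integral_map (f := fun f : C(X, ℝ) => f y) (continuous_condMap τ x z ν).aemeasurable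
      (ContinuousMap.evalCLM ℝ y).continuous.aestronglyMeasurable
  rw [hmap]
  simp only [condMap_apply]
  have hobs : Integrable (fun p : C(X, ℝ) × ℝ => p.1 x + τ x * p.2)
      (ν.1.prod (gaussianReal 0 1)) := (hi x).add (hs.const_mul _)
  have hres : Integrable (fun p : C(X, ℝ) × ℝ => z - (p.1 x + τ x * p.2))
      (ν.1.prod (gaussianReal 0 1)) := (integrable_const z).sub hobs
  rw [integral_add (hi y) ((hres.div_const _).mul_const _), integral_mul_const, integral_div,
    integral_sub (integrable_const z) hobs, integral_add (hi x) (hs.const_mul _),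
    integral_const_mul, hu, he, he]
  simp
  ring

theorem cov_cond (y y' : X) : cov (cond τ x z ν) y y' =
    cov ν y y' - cov ν x y * cov ν x y' / predVar τ ν x := by
  have := ν.2
  set M := ν.1.prod (gaussianReal 0 1) with hM
  have hev : ∀ y, MemLp (fun p : C(X, ℝ) × ℝ => p.1 y) 2 M := memLp_two_eval_fst ν
  have hs : MemLp (fun p : C(X, ℝ) × ℝ => p.2) 2 M := memLp_two_snd ν
  have hτs : MemLp (fun p : C(X, ℝ) × ℝ => (τ x : ℝ) * p.2) 2 M := hs.const_mul _
  have hobs : MemLp (fun p : C(X, ℝ) × ℝ => p.1 x + τ x * p.2) 2 M := (hev x).add hτs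
  have hal : ∀ W : C(X, ℝ) × ℝ → ℝ, MemLp W 2 M →
      cov[fun p : C(X, ℝ) × ℝ => p.1 x + τ x * p.2, W; M] =
        cov[fun p : C(X, ℝ) × ℝ => p.1 x, W; M] + cov[fun p => (τ x : ℝ) * p.2, W; M] :=
    fun W hW => covariance_add_left (hev x) hτs hW
  have hcc : ∀ y y', cov[fun p : C(X, ℝ) × ℝ => p.1 y, fun p => p.1 y'; M] = cov ν y y' := by
    intro y y'
    have h := covariance_map_fun (μ := M) (Z := Prod.fst) (X := fun f : C(X, ℝ) => f y)
      (Y := fun f : C(X, ℝ) => f y')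
      (ContinuousMap.evalCLM ℝ y).continuous.aestronglyMeasurable
      (ContinuousMap.evalCLM ℝ y').continuous.aestronglyMeasurable measurable_fst.aemeasurable
    rw [← h, hM, Measure.map_fst_prod]
    simp [cov]
  have hcs : ∀ y, cov[fun p : C(X, ℝ) × ℝ => p.1 y, fun p => p.2; M] = 0 := by
    intro y
    refine IndepFun.covariance_eq_zero ?_ (hev y) hs
    exact (indepFun_prod (μ := ν.1) (ν := gaussianReal 0 1)
      (X := fun f : C(X, ℝ) => f y) (Y := fun u : ℝ => u)
      (ContinuousMap.evalCLM ℝ y).continuous.measurable measurable_id)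
  have hss : cov[fun p : C(X, ℝ) × ℝ => p.2, fun p => p.2; M] = 1 := by
    have h := covariance_map_fun (μ := M) (Z := Prod.snd) (X := fun u : ℝ => u)
      (Y := fun u : ℝ => u) (by fun_prop) (by fun_prop) measurable_snd.aemeasurable
    rw [← h, hM, Measure.map_snd_prod, covariance_self (by fun_prop)]
    simp [variance_fun_id_gaussianReal]
  have hobsc : ∀ y, cov[fun p : C(X, ℝ) × ℝ => p.1 x + τ x * p.2, fun p => p.1 y; M]
      = cov ν x y := by
    intro y
    rw [hal _ (hev y), hcc, covariance_const_mul_left,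
      covariance_comm, hcs]
    simp
  have hobss : cov[fun p : C(X, ℝ) × ℝ => p.1 x + τ x * p.2, fun p => p.1 x + τ x * p.2; M]
      = predVar τ ν x := by
    rw [hal _ hobs, covariance_comm, hobsc, covariance_const_mul_left, covariance_comm,
      hal _ hs, hcs, covariance_const_mul_left, hss]
    simp [predVar]
    ring
  have hrepr : ∀ y, (fun p : C(X, ℝ) × ℝ => condMap τ x z ν p y) = fun p =>
      (p.1 y - cov ν x y / predVar τ ν x * (p.1 x + τ x * p.2))
        + z / predVar τ ν x * cov ν x y := by
    intro y
    funext p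
    rw [condMap_apply]
    ring
  have hres : ∀ y, MemLp (fun p : C(X, ℝ) × ℝ =>
      p.1 y - cov ν x y / predVar τ ν x * (p.1 x + τ x * p.2)) 2 M := fun y =>
    (hev y).sub (hobs.const_mul _)
  have hmap := covariance_map_fun (μ := M) (Z := condMap τ x z ν) (X := fun f : C(X, ℝ) => f y)
      (Y := fun f : C(X, ℝ) => f y')
      (ContinuousMap.evalCLM ℝ y).continuous.aestronglyMeasurable
      (ContinuousMap.evalCLM ℝ y').continuous.aestronglyMeasurable
      (continuous_condMap τ x z ν).aemeasurable
  change cov[fun f : C(X, ℝ) => f y, fun f : C(X, ℝ) => f y'; M.map (condMap τ x z ν)] = _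
  rw [hmap, hrepr y, hrepr y',
    covariance_add_const_left ((hres y).integrable (by norm_num)),
    covariance_add_const_right ((hres y').integrable (by norm_num)),
    covariance_fun_sub_left (hev y) (hobs.const_mul _) (hres y'),
    covariance_fun_sub_right (hev y) (hev y') (hobs.const_mul _),
    covariance_fun_sub_right (hobs.const_mul _) (hev y') (hobs.const_mul _),
    covariance_const_mul_right, covariance_const_mul_left, covariance_const_mul_left,
    covariance_const_mul_right, hcc, hobsc, hobss, covariance_comm, hobsc]
  by_cases h0 : predVar τ ν x = 0
  · simp [h0]
  · field_simp
    ring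

end CondMoments

end GaussianMeasures

/-! ### Gaussian conditional distributions -/

section ConditionalDistributions

variable {X : Type u} [MetricSpace X] [CompactSpace X]

/-- The random element `ν` of `GaussianMeasures X` is a version of the conditional distribution of
`ξ` given the σ-algebra `m'`. -/
def IsCondDist {Ω : Type w} [mΩ : MeasurableSpace Ω] (P : Measure Ω) (ξ : Ω → C(X, ℝ))
    (m' : MeasurableSpace Ω) (ν : Ω → GaussianMeasures X) : Prop :=
  Measurable[mΩ] ν ∧ ∀ A : Set C(X, ℝ), MeasurableSet A →
    (fun ω => (ν ω).1.real A) =ᵐ[P] P⟦ξ ⁻¹' A | m'⟧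

/-- The set of all Gaussian conditional distributions of `ξ`. -/
def gaussianCondDists {Ω : Type w} [mΩ : MeasurableSpace Ω] (P : Measure Ω) (ξ : Ω → C(X, ℝ)) :
    Set (Ω → GaussianMeasures X) :=
  {ν | ∃ m' ≤ mΩ, IsCondDist P ξ m' ν}

/-- For every Gaussian random element `ξ`, the family of the `H(ν)`, with `ν` ranging over all
Gaussian conditional distributions of `ξ`, is uniformly integrable. -/
def IsPUniformlyIntegrable (H : GaussianMeasures X → ℝ) : Prop :=
  ∀ (Ω : Type w) [MeasurableSpace Ω] (P : Measure Ω) [IsProbabilityMeasure P] (ξ : Ω → C(X, ℝ)),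
    Measurable ξ → HasGaussianLaw ξ P →
      UniformIntegrable (fun (ν : gaussianCondDists P ξ) (ω : Ω) => H (ν.1 ω)) 1 P

/-- For every Gaussian random element `ξ`, almost sure convergence of Gaussian conditional
distributions of `ξ` to one of them implies almost sure convergence of the values of `H`. -/
def IsPContinuous (H : GaussianMeasures X → ℝ) : Prop :=
  ∀ (Ω : Type w) [MeasurableSpace Ω] (P : Measure Ω) [IsProbabilityMeasure P] (ξ : Ω → C(X, ℝ)),
    Measurable ξ → HasGaussianLaw ξ P →
      ∀ (νs : ℕ → Ω → GaussianMeasures X) (ν : Ω → GaussianMeasures X),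
        (∀ n, νs n ∈ gaussianCondDists P ξ) → ν ∈ gaussianCondDists P ξ →
        (∀ᵐ ω ∂P, GaussianTendsto (fun n => νs n ω) (ν ω)) →
          ∀ᵐ ω ∂P, Tendsto (fun n => H (νs n ω)) atTop (𝓝 (H (ν ω)))

end ConditionalDistributions

/-! ### The observation model and sequential designs

Indices are shifted by one: `D n` and `U n` (`n = 0, 1, …`) are the design point `X_{n+1}` and the
noise variable `U_{n+1}`, while `info n` is the σ-algebra generated by the first `n` design points
and observations. -/

section Model

variable {X : Type u} [MetricSpace X] [CompactSpace X] {Ω : Type w} [mΩ : MeasurableSpace Ω]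

/-- `ξ` is a Gaussian process with continuous sample paths, and `U` is a sequence of independent
standard Gaussian variables, independent of `ξ`. -/
structure IsGPModel (P : Measure Ω) (ξ : Ω → C(X, ℝ)) (U : ℕ → Ω → ℝ) : Prop where
  measurable_eval : ∀ x, Measurable fun ω => ξ ω x
  isGaussianProcess : IsGaussianProcess (fun x ω => ξ ω x) P
  measurable_noise : ∀ n, Measurable (U n)
  hasLaw_noise : ∀ n, HasLaw (U n) (gaussianReal 0 1) P
  iIndepFun_noise : iIndepFun U P
  indepFun : IndepFun ξ (fun ω n => U n ω) P

/-- The prior: the law of `ξ`. -/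
noncomputable def IsGPModel.prior {P : Measure Ω} {ξ : Ω → C(X, ℝ)} {U : ℕ → Ω → ℝ}
    (hM : IsGPModel P ξ U) : GaussianMeasures X :=
  ⟨P.map ξ, isGaussian_map_of_isGaussianProcess hM.measurable_eval hM.isGaussianProcess⟩

/-- The observation `ξ(D n) + τ(D n) U n` made at the design point `D n`. -/
def observation (τ : C(X, ℝ≥0)) (ξ : Ω → C(X, ℝ)) (U : ℕ → Ω → ℝ) (D : ℕ → Ω → X) (n : ℕ)
    (ω : Ω) : ℝ :=
  ξ ω (D n ω) + τ (D n ω) * U n ω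

variable [mX : MeasurableSpace X]

/-- The σ-algebra generated by the first `n` design points and observations. -/
abbrev info (τ : C(X, ℝ≥0)) (ξ : Ω → C(X, ℝ)) (U : ℕ → Ω → ℝ) (D : ℕ → Ω → X) (n : ℕ) :
    MeasurableSpace Ω :=
  ⨆ (i : ℕ) (_ : i < n), (mX.comap (D i) ⊔
    (inferInstance : MeasurableSpace ℝ).comap (observation τ ξ U D i))

/-- `D` is a (non-randomized) sequential design. -/
def IsSequentialDesign (τ : C(X, ℝ≥0)) (ξ : Ω → C(X, ℝ)) (U : ℕ → Ω → ℝ) (D : ℕ → Ω → X) : Prop :=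
  ∀ n, Measurable[info τ ξ U D n] (D n)

/-- `P_n^ξ = Cond_{X_1, Z_1, …, X_n, Z_n}(P^ξ)`, obtained by conditioning successively with respect
to each observation. -/
noncomputable def posterior {P : Measure Ω} {ξ : Ω → C(X, ℝ)} {U : ℕ → Ω → ℝ} (τ : C(X, ℝ≥0))
    (hM : IsGPModel P ξ U) (D : ℕ → Ω → X) : ℕ → Ω → GaussianMeasures X
  | 0, _ => hM.prior
  | n + 1, ω => cond τ (D n ω) (observation τ ξ U D n ω) (posterior τ hM D n ω)

theorem info_le [BorelSpace X] {P : Measure Ω} {τ : C(X, ℝ≥0)} {ξ : Ω → C(X, ℝ)}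
    {U : ℕ → Ω → ℝ} {D : ℕ → Ω → X} (hM : IsGPModel P ξ U) (hD : IsSequentialDesign τ ξ U D)
    (n : ℕ) : info τ ξ U D n ≤ mΩ := by
  induction n using Nat.strong_induction_on with
  | _ n ih =>
    refine iSup₂_le fun i hi => ?_
    have hDi : Measurable (D i) := (hD i).mono (ih i hi) le_rfl
    have hξ : Measurable ξ := measurable_of_eval hM.measurable_eval
    have hev : Continuous fun p : C(X, ℝ) × X => p.1 p.2 := by fun_prop
    have h1 : Measurable fun ω => ξ ω (D i ω) := hev.measurable.comp (hξ.prodMk hDi)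
    have h2 : Measurable fun ω => (τ (D i ω) : ℝ) :=
      (NNReal.continuous_coe.comp τ.continuous).measurable.comp hDi
    exact sup_le hDi.comap_le (h1.add (h2.mul (hM.measurable_noise i))).comap_le

/-- The filtration generated by the observations made along a sequential design. -/
def designFiltration [BorelSpace X] {P : Measure Ω} {τ : C(X, ℝ≥0)} {ξ : Ω → C(X, ℝ)}
    {U : ℕ → Ω → ℝ} {D : ℕ → Ω → X} (hM : IsGPModel P ξ U) (hD : IsSequentialDesign τ ξ U D) :
    Filtration ℕ mΩ where
  seq := info τ ξ U D
  mono' := fun _ _ hnm => iSup₂_le fun i hi => le_iSup₂_of_le i (lt_of_lt_of_le hi hnm) le_rfl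
  le' := info_le hM hD

end Model

/-! ### Uncertainty functionals and SUR strategies -/

section Functionals

variable {X : Type u} [MetricSpace X] [CompactSpace X]

/-- For every Gaussian prior and every sequential design, `H(P_n^ξ)` is a supermartingale. -/
def HasSupermartingaleProperty [MeasurableSpace X] [BorelSpace X] (τ : C(X, ℝ≥0))
    (H : GaussianMeasures X → ℝ) : Prop :=
  ∀ (Ω : Type w) [MeasurableSpace Ω] (P : Measure Ω) (ξ : Ω → C(X, ℝ)) (U : ℕ → Ω → ℝ)
    (hM : IsGPModel P ξ U) (D : ℕ → Ω → X) (hD : IsSequentialDesign τ ξ U D),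
    Supermartingale (fun n ω => H (posterior τ hM D n ω)) (designFiltration hM hD) P

/-- The functional `J_x(ν) = ∬ H(Cond_{x, f(x) + u τ(x)}(ν)) ν(df) φ(u) du`, for `H ≥ 0`. The
sampling criterion is `J_n(x) = J_x(P_n^ξ)`. -/
noncomputable def samplingCriterion (τ : C(X, ℝ≥0)) (H : GaussianMeasures X → ℝ) (x : X)
    (ν : GaussianMeasures X) : ℝ≥0∞ :=
  ∫⁻ p : C(X, ℝ) × ℝ, ENNReal.ofReal (H (cond τ x (p.1 x + p.2 * τ x) ν))
    ∂(ν.1.prod (gaussianReal 0 1))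

/-- The maximal expected gain `G(ν) = sup_x (H(ν) - J_x(ν))`. -/
noncomputable def maxGain (τ : C(X, ℝ≥0)) (H : GaussianMeasures X → ℝ)
    (ν : GaussianMeasures X) : EReal :=
  ⨆ x : X, ((H ν : EReal) - (samplingCriterion τ H x ν : EReal))

/-- The point `x` minimizes the sampling criterion for `ν` up to `ε`. -/
def IsNearMinimizer (τ : C(X, ℝ≥0)) (H : GaussianMeasures X → ℝ) (ν : GaussianMeasures X) (ε : ℝ)
    (x : X) : Prop :=
  samplingCriterion τ H x ν ≤ (⨅ y : X, samplingCriterion τ H y ν) + ENNReal.ofReal ε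

/-- `D` is an `ε`-quasi-SUR sequential design associated with `H`. -/
def IsEpsQuasiSUR [MeasurableSpace X] {Ω : Type w} [MeasurableSpace Ω] {P : Measure Ω}
    {ξ : Ω → C(X, ℝ)} {U : ℕ → Ω → ℝ} (τ : C(X, ℝ≥0)) (H : GaussianMeasures X → ℝ)
    (hM : IsGPModel P ξ U) (ε : ℕ → ℝ) (D : ℕ → Ω → X) : Prop :=
  IsSequentialDesign τ ξ U D ∧
    ∃ n₀ : ℕ, ∀ n ≥ n₀, ∀ᵐ ω ∂P, IsNearMinimizer τ H (posterior τ hM D n ω) (ε n) (D n ω)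

/-- `D` is a quasi-SUR sequential design associated with `H`: it is an `ε`-quasi-SUR design for
some sequence `ε` of positive numbers that tends to zero. -/
def IsQuasiSUR [MeasurableSpace X] {Ω : Type w} [MeasurableSpace Ω] {P : Measure Ω}
    {ξ : Ω → C(X, ℝ)} {U : ℕ → Ω → ℝ} (τ : C(X, ℝ≥0)) (H : GaussianMeasures X → ℝ)
    (hM : IsGPModel P ξ U) (D : ℕ → Ω → X) : Prop :=
  ∃ ε : ℕ → ℝ, (∀ n, 0 < ε n) ∧ Tendsto ε atTop (𝓝 0) ∧ IsEpsQuasiSUR τ H hM ε D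

/-- `H = H₀ + H₁`, where `H₀(ν) = ∫ L₀ dν` with `L₀` integrable for all Gaussian measures, and `H₁`
is measurable, 𝔓-uniformly integrable and 𝔓-continuous. -/
structure IsRegularDecomposition (H : GaussianMeasures X → ℝ) (L₀ : C(X, ℝ) → ℝ)
    (H₁ : GaussianMeasures X → ℝ) : Prop where
  eq_add : ∀ ν, H ν = ∫ f, L₀ f ∂ν.1 + H₁ ν
  measurable_left : Measurable L₀
  integrable_left : ∀ ν : GaussianMeasures X, Integrable L₀ ν.1
  measurable_right : Measurable H₁
  uniformlyIntegrable : IsPUniformlyIntegrable.{u, w} H₁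
  continuous : IsPContinuous.{u, w} H₁

/-! ### Uncertainty functionals based on a loss function -/

/-- The expected loss of the decision `d` under `ν`. -/
noncomputable def expectedLoss {E : Type v} (L : C(X, ℝ) → E → ℝ) (ν : GaussianMeasures X)
    (d : E) : ℝ :=
  ∫ f, L f d ∂ν.1

/-- The uncertainty functional `H(ν) = inf_d ∫ L(f, d) ν(df)`. -/
noncomputable def lossFunctional {E : Type v} (L : C(X, ℝ) → E → ℝ)
    (ν : GaussianMeasures X) : ℝ :=
  ⨅ d : E, expectedLoss L ν d

/-- Regular non-negative loss functions. -/
structure IsRegularLoss {E : Type v} [TopologicalSpace E] (τ : C(X, ℝ≥0))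
    (L : C(X, ℝ) → E → ℝ) : Prop where
  nonneg : ∀ f d, 0 ≤ L f d
  separable : TopologicalSpace.SeparableSpace E
  measurable : ∀ d, Measurable fun f => L f d
  integrable : ∀ (ν : GaussianMeasures X) (d : E), Integrable (fun f => L f d) ν.1
  continuous : ∀ ν : GaussianMeasures X, Continuous (expectedLoss L ν)
  decomposition : ∃ L₀ H₁, IsRegularDecomposition.{u, w} (lossFunctional L) L₀ H₁
  zeros : {ν | lossFunctional L ν = 0} = {ν | maxGain τ (lossFunctional L) ν = 0}

/-- The knowledge-gradient loss `L(f, d) = max f - f(d)`. -/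
noncomputable def knowledgeGradientLoss (f : C(X, ℝ)) (d : X) : ℝ := (⨆ u : X, f u) - f d

/-- The uncertainty functional associated with the knowledge-gradient loss. -/
noncomputable def knowledgeGradientFunctional : GaussianMeasures X → ℝ :=
  lossFunctional (knowledgeGradientLoss : C(X, ℝ) → X → ℝ)

end Functionals

end SUR

/-!
# Convergence of quasi-SUR designs for the knowledge gradient

Write `m_ν`, `k_ν` for the mean and covariance of a Gaussian measure `ν` on `C(X, ℝ)`, and `P_n`
for the posterior after `n` observations. The knowledge-gradient functional is
`H(ν) = ∫ max f ν(df) - max m_ν` (`knowledgeGradientFunctional_eq`). Its first term is linear in `ν`, so that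
conditioning preserves it on average, and everything depends on the second one, the maximum of
the mean.

*Posteriors.* For a Gaussian pair, the residual of the regression of the path on an observation
is independent of the observation. Hence `Cond_{x, z}(ν)` disintegrates `ν` with respect to the
noisy observation at `x` (`lintegral_noisyObs_eq_lintegral_cond`). Since the next noise variable
is independent of the path and of the past, an induction shows that `P_n` is the conditional
distribution of the path given the past (`isCondDist_posterior`).

*Limit.* For a real function `g` with `g(ξ)` integrable, `∫ g dP_n = E[g(ξ) | F_n]` converges
almost surely by Lévy's upward theorem. Countably many `g` suffice to control the Bochner
integrals of `f` and of `f ⊗ f`, that is, the mean and covariance functions in the supremum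
norm, by means of finite-rank operators converging strongly to the identity
(`tendsto_integral_of_approximation`), and to recognize that the conditional distribution given
`F_∞` is almost surely Gaussian (`isGaussian_iff_ratDual`). The result is
`exists_gaussianTendsto`.

*Gain.* Under `ν`, the mean after an observation at `x` is distributed as
`m_ν + u k_ν(x, ·) / s_ν(x)` with `u` standard Gaussian, so that `H(ν) - J_x(ν) = gain τ x ν`, the expected increase
of the maximum of the mean (`samplingCriterion_eq`). If all gains vanish, then `k_ν(x, ·)` is
constant for each `x`: the paths are translates of the mean, and `H(ν) = 0`
(`knowledgeGradientFunctional_eq_zero_iff`). The gain is lower semicontinuous in `x` and in `ν`;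
this is what is left of continuity at the points where `s_ν` vanishes
(`eventually_lt_expMax_sub`). In `x`, it yields a measurable selection of near-minimizers in a
dense sequence, hence the existence of quasi-SUR designs (`exists_isEpsQuasiSUR`).

*Convergence.* Along any sequential design, the expected gains at the design points telescope to
the expected increase of `max m_{P_n}`, which is at most `E[max ξ] - max m_{P_0}`; so these gains
tend to zero almost surely (`ae_tendsto_gain_posterior`). For a quasi-SUR design they dominate all the
gains up to `ε_n`. Therefore the maximal gain of `P_n` tends to zero, it is zero at the limit by
lower semicontinuity in `ν`, and `H(P_n)` converges to `H(P_∞) = 0`.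
-/

namespace SUR

set_option linter.unusedSectionVars false

/-! ### The maximum of a continuous function -/

section MaxValue

variable {X : Type u} [TopologicalSpace X] [CompactSpace X]

/-- The maximum of a continuous function on a compact space. -/
noncomputable def maxValue (f : C(X, ℝ)) : ℝ := ⨆ u : X, f u

theorem bddAbove_range_coe (f : C(X, ℝ)) : BddAbove (Set.range f) :=
  (isCompact_range f.continuous).bddAbove

theorem le_maxValue (f : C(X, ℝ)) (x : X) : f x ≤ maxValue f :=
  le_ciSup (bddAbove_range_coe f) x

theorem maxValue_le [Nonempty X] {f : C(X, ℝ)} {c : ℝ} (h : ∀ x, f x ≤ c) : maxValue f ≤ c :=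
  ciSup_le h

theorem exists_eq_maxValue [Nonempty X] (f : C(X, ℝ)) : ∃ x, f x = maxValue f := by
  obtain ⟨x, -, hx⟩ := isCompact_univ.exists_isMaxOn Set.univ_nonempty f.continuous.continuousOn
  exact ⟨x, le_antisymm (le_maxValue f x) (maxValue_le fun y => hx (Set.mem_univ y))⟩

theorem maxValue_sub_le [Nonempty X] (f g : C(X, ℝ)) : maxValue f - maxValue g ≤ ‖f - g‖ := by
  obtain ⟨x, hx⟩ := exists_eq_maxValue f
  have h1 := le_maxValue g x
  have h2 : f x - g x ≤ ‖f - g‖ := (le_abs_self _).trans ((f - g).norm_coe_le_norm x)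
  linarith

theorem abs_maxValue_sub_le [Nonempty X] (f g : C(X, ℝ)) :
    |maxValue f - maxValue g| ≤ ‖f - g‖ :=
  abs_sub_le_iff.2 ⟨maxValue_sub_le f g, norm_sub_rev f g ▸ maxValue_sub_le g f⟩

theorem continuous_maxValue [Nonempty X] : Continuous (maxValue : C(X, ℝ) → ℝ) :=
  (LipschitzWith.of_dist_le_mul (K := 1) fun f g => by
    simpa [Real.dist_eq, dist_eq_norm] using abs_maxValue_sub_le f g).continuous

theorem abs_maxValue_le [Nonempty X] (f : C(X, ℝ)) : |maxValue f| ≤ ‖f‖ := by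
  have h0 : maxValue (0 : C(X, ℝ)) = 0 := by simp [maxValue]
  simpa [h0] using abs_maxValue_sub_le f 0

end MaxValue

/-! ### Mean and covariance of a Gaussian measure on `C(X, ℝ)` -/

section Mean

variable {X : Type u} [MetricSpace X] [CompactSpace X]

theorem integrable_id_gaussian (ν : GaussianMeasures X) :
    Integrable (fun f : C(X, ℝ) => f) ν.1 :=
  have := ν.2
  IsGaussian.integrable_id

theorem memLp_two_gaussian (ν : GaussianMeasures X) :
    MemLp (fun f : C(X, ℝ) => f) 2 ν.1 :=
  have := ν.2
  IsGaussian.memLp_two_id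

theorem integrable_eval (ν : GaussianMeasures X) (x : X) :
    Integrable (fun f : C(X, ℝ) => f x) ν.1 :=
  have := ν.2
  (memLp_two_eval ν x).integrable (by norm_num)

/-- The mean function of `ν` as an element of `C(X, ℝ)`: it is the Bochner integral of the
identity. -/
noncomputable def meanMap (ν : GaussianMeasures X) : C(X, ℝ) := ∫ f, f ∂ν.1

theorem meanMap_apply (ν : GaussianMeasures X) (x : X) : meanMap ν x = mean ν x :=
  ContinuousMap.integral_apply (f := fun g : C(X, ℝ) => g) (integrable_id_gaussian ν) x

theorem norm_meanMap_le (ν : GaussianMeasures X) : ‖meanMap ν‖ ≤ ∫ f, ‖f‖ ∂ν.1 :=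
  norm_integral_le_integral_norm _

theorem covSection_apply (ν : GaussianMeasures X) (x y : X) : covSection ν x y = cov ν x y := rfl

theorem covSection_eq_integral (ν : GaussianMeasures X) (x : X) :
    covSection ν x = ∫ f : C(X, ℝ), (f x - mean ν x) • (f - meanMap ν) ∂ν.1 := by
  ext y
  exact (integral_cov_integrand_apply ν x y).symm

theorem cov_symm (ν : GaussianMeasures X) (x y : X) : cov ν x y = cov ν y x :=
  covariance_comm _ _

theorem variance_eval (ν : GaussianMeasures X) (x : X) :
    Var[fun f : C(X, ℝ) => f x; ν.1] = cov ν x x :=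
  (covariance_self (μ := ν.1) (X := fun f : C(X, ℝ) => f x)
    (ContinuousMap.evalCLM ℝ x).continuous.measurable.aemeasurable).symm

theorem cov_self_nonneg (ν : GaussianMeasures X) (x : X) : 0 ≤ cov ν x x := by
  rw [← variance_eval]
  exact variance_nonneg _ _

theorem cov_eq_integral_sub (ν : GaussianMeasures X) (x y : X) :
    cov ν x y = ∫ f : C(X, ℝ), f x * f y ∂ν.1 - mean ν x * mean ν y := by
  have := ν.2
  exact covariance_eq_sub (memLp_two_eval ν x) (memLp_two_eval ν y)

theorem predVar_nonneg (τ : C(X, ℝ≥0)) (ν : GaussianMeasures X) (x : X) : 0 ≤ predVar τ ν x :=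
  add_nonneg (cov_self_nonneg ν x) (sq_nonneg _)

/-- A component of zero variance is almost surely constant, hence uncorrelated with all the
others. -/
theorem cov_eq_zero_of_cov_self_eq_zero (ν : GaussianMeasures X) {x : X} (h : cov ν x x = 0)
    (y : X) : cov ν x y = 0 := by
  have := ν.2
  have hae := ae_eq_integral_of_variance_eq_zero (memLp_two_eval ν x) ((variance_eval ν x).trans h)
  have : (fun f : C(X, ℝ) => (f x - mean ν x) * (f y - mean ν y)) =ᵐ[ν.1] 0 := by
    filter_upwards [hae] with f hf
    simp [mean, hf]
  exact (integral_congr_ae this).trans (by simp)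

theorem cov_eq_zero_of_predVar_eq_zero {τ : C(X, ℝ≥0)} {ν : GaussianMeasures X} {x : X}
    (h : predVar τ ν x = 0) (y : X) : cov ν x y = 0 := by
  refine cov_eq_zero_of_cov_self_eq_zero ν ?_ y
  have := cov_self_nonneg ν x
  have := sq_nonneg (τ x : ℝ)
  unfold predVar at h
  linarith

/-- Where the predictive variance vanishes, so does the numerator of the kriging gain. The value
given to the quotient by the convention `a / 0 = 0` is therefore irrelevant. -/
theorem covSection_eq_zero_of_predVar_eq_zero {τ : C(X, ℝ≥0)} {ν : GaussianMeasures X} {x : X}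
    (h : predVar τ ν x = 0) : covSection ν x = 0 :=
  ContinuousMap.ext fun y => cov_eq_zero_of_predVar_eq_zero h y

variable [Nonempty X]

theorem integrable_maxValue (ν : GaussianMeasures X) : Integrable maxValue ν.1 :=
  (integrable_id_gaussian ν).norm.mono' continuous_maxValue.aestronglyMeasurable
    (Eventually.of_forall abs_maxValue_le)

/-- The functional `H` is non-negative because the maximum is convex. -/
theorem maxValue_meanMap_le (ν : GaussianMeasures X) :
    maxValue (meanMap ν) ≤ ∫ f, maxValue f ∂ν.1 := by
  refine maxValue_le fun x => ?_
  rw [meanMap_apply]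
  exact integral_mono (integrable_eval ν x) (integrable_maxValue ν) fun f => le_maxValue f x

theorem integrable_knowledgeGradientLoss (ν : GaussianMeasures X) (d : X) :
    Integrable (fun f => knowledgeGradientLoss f d) ν.1 :=
  (integrable_maxValue ν).sub (integrable_eval ν d)

theorem expectedLoss_knowledgeGradientLoss (ν : GaussianMeasures X) (d : X) :
    expectedLoss knowledgeGradientLoss ν d = ∫ f, maxValue f ∂ν.1 - meanMap ν d := by
  rw [meanMap_apply]
  exact integral_sub (integrable_maxValue ν) (integrable_eval ν d)

/-- The infimum over decisions is attained at a maximizer of the mean function. -/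
theorem knowledgeGradientFunctional_eq (ν : GaussianMeasures X) :
    knowledgeGradientFunctional ν = ∫ f, maxValue f ∂ν.1 - maxValue (meanMap ν) := by
  obtain ⟨x, hx⟩ := exists_eq_maxValue (meanMap ν)
  unfold knowledgeGradientFunctional lossFunctional
  simp_rw [expectedLoss_knowledgeGradientLoss]
  refine le_antisymm (ciInf_le_of_le ⟨∫ f, maxValue f ∂ν.1 - maxValue (meanMap ν), ?_⟩ x
    (by rw [hx])) (le_ciInf fun d => by linarith [le_maxValue (meanMap ν) d])
  rintro _ ⟨d, rfl⟩
  linarith [le_maxValue (meanMap ν) d]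

theorem knowledgeGradientFunctional_nonneg (ν : GaussianMeasures X) :
    0 ≤ knowledgeGradientFunctional ν := by
  rw [knowledgeGradientFunctional_eq]
  linarith [maxValue_meanMap_le ν]

end Mean

section GaussianTendsto

variable {X : Type u} [MetricSpace X] [CompactSpace X] {νs : ℕ → GaussianMeasures X}
  {ν : GaussianMeasures X}

theorem GaussianTendsto.meanMap (h : GaussianTendsto νs ν) :
    Tendsto (fun n => meanMap (νs n)) atTop (𝓝 (meanMap ν)) := by
  rw [ContinuousMap.tendsto_iff_tendstoUniformly]
  have h1 : ∀ ν : GaussianMeasures X, ⇑(SUR.meanMap ν) = mean ν := fun ν =>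
    funext (meanMap_apply ν)
  simpa only [h1] using h.1

theorem GaussianTendsto.covSection (h : GaussianTendsto νs ν) (x : X) :
    Tendsto (fun n => covSection (νs n) x) atTop (𝓝 (covSection ν x)) := by
  rw [ContinuousMap.tendsto_iff_tendstoUniformly]
  exact h.2.comp fun y => (x, y)

end GaussianTendsto

/-! ### Measurability of the moments and of the conditioning operator -/

section Measurability

variable {X : Type u} [MetricSpace X] [CompactSpace X]

/-- The tautological Markov kernel `ν ↦ ν`. -/
def gaussianKernel (X : Type u) [MetricSpace X] [CompactSpace X] :
    Kernel (GaussianMeasures X) C(X, ℝ) :=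
  ⟨Subtype.val, measurable_subtype_coe⟩

theorem gaussianKernel_apply (ν : GaussianMeasures X) : gaussianKernel X ν = ν.1 := rfl

instance : IsMarkovKernel (gaussianKernel X) :=
  ⟨fun ν => by rw [gaussianKernel_apply]; have := ν.2; infer_instance⟩

/-- The law of a pair `(f, u)`, where `f ∼ ν` and `u` is an independent standard Gaussian variable,
as a kernel. -/
noncomputable def noisyKernel (X : Type u) [MetricSpace X] [CompactSpace X] :
    Kernel (GaussianMeasures X) (C(X, ℝ) × ℝ) :=
  (gaussianKernel X).prod (Kernel.const _ (gaussianReal 0 1))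

theorem noisyKernel_apply (ν : GaussianMeasures X) :
    noisyKernel X ν = ν.1.prod (gaussianReal 0 1) := by
  rw [noisyKernel, Kernel.prod_apply, gaussianKernel_apply, Kernel.const_apply]

instance : IsMarkovKernel (noisyKernel X) := by
  unfold noisyKernel
  infer_instance

theorem measurable_eval_prod [MeasurableSpace X] [BorelSpace X] :
    Measurable fun q : X × C(X, ℝ) => q.2 q.1 := by
  have : Continuous fun q : X × C(X, ℝ) => q.2 q.1 := by fun_prop
  exact this.measurable

theorem measurable_eval (x : X) : Measurable fun f : C(X, ℝ) => f x :=
  (ContinuousMap.evalCLM ℝ x).continuous.measurable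

theorem measurable_integral_gaussian {g : C(X, ℝ) → ℝ} (hg : Measurable g) :
    Measurable fun ν : GaussianMeasures X => ∫ f, g f ∂ν.1 :=
  (StronglyMeasurable.integral_kernel_prod_right' (κ := gaussianKernel X)
    (f := fun p => g p.2) (hg.comp measurable_snd).stronglyMeasurable).measurable

theorem measurable_meanMap : Measurable (meanMap : GaussianMeasures X → C(X, ℝ)) := by
  refine measurable_of_eval fun x => ?_
  simp_rw [meanMap_apply]
  exact measurable_integral_gaussian (measurable_eval x)

variable [MeasurableSpace X] [BorelSpace X]

theorem measurable_cov :
    Measurable fun q : (X × X) × GaussianMeasures X => cov q.2 q.1.1 q.1.2 := by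
  simp_rw [cov_eq_integral_sub, ← meanMap_apply]
  have h1 : Measurable fun q : (X × X) × GaussianMeasures X => meanMap q.2 q.1.1 :=
    measurable_eval_prod.comp (measurable_fst.fst.prodMk (measurable_meanMap.comp measurable_snd))
  have h2 : Measurable fun q : (X × X) × GaussianMeasures X => meanMap q.2 q.1.2 :=
    measurable_eval_prod.comp (measurable_fst.snd.prodMk (measurable_meanMap.comp measurable_snd))
  refine Measurable.sub ?_ (h1.mul h2)
  refine (StronglyMeasurable.integral_kernel_prod_right'
    (κ := (gaussianKernel X).comap (fun q : (X × X) × GaussianMeasures X => q.2) measurable_snd)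
    (f := fun p => p.2 p.1.1.1 * p.2 p.1.1.2) ?_).measurable
  refine Measurable.stronglyMeasurable (Measurable.mul ?_ ?_)
  · exact measurable_eval_prod.comp (measurable_fst.fst.fst.prodMk measurable_snd)
  · exact measurable_eval_prod.comp (measurable_fst.fst.snd.prodMk measurable_snd)

theorem measurable_covSection :
    Measurable fun q : X × GaussianMeasures X => covSection q.2 q.1 :=
  measurable_of_eval fun _ => measurable_cov.comp
    ((measurable_fst.prodMk measurable_const).prodMk measurable_snd)

variable (τ : C(X, ℝ≥0))

theorem measurable_noiseLevel : Measurable fun x : X => (τ x : ℝ) :=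
  (NNReal.continuous_coe.comp τ.continuous).measurable

theorem measurable_predVar : Measurable fun q : X × GaussianMeasures X => predVar τ q.2 q.1 :=
  (measurable_cov.comp ((measurable_fst.prodMk measurable_fst).prodMk measurable_snd)).add
    (((measurable_noiseLevel τ).comp measurable_fst).pow_const 2)

theorem measurable_condMap :
    Measurable fun q : (X × ℝ × GaussianMeasures X) × (C(X, ℝ) × ℝ) =>
      condMap τ q.1.1 q.1.2.1 q.1.2.2 q.2 := by
  unfold condMap
  have h1 : Measurable fun q : (X × ℝ × GaussianMeasures X) × (C(X, ℝ) × ℝ) => q.2.1 q.1.1 :=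
    measurable_eval_prod.comp (measurable_fst.fst.prodMk measurable_snd.fst)
  have h2 : Measurable fun q : (X × ℝ × GaussianMeasures X) × (C(X, ℝ) × ℝ) => (τ q.1.1 : ℝ) :=
    (measurable_noiseLevel τ).comp measurable_fst.fst
  have h3 : Measurable fun q : (X × ℝ × GaussianMeasures X) × (C(X, ℝ) × ℝ) =>
      predVar τ q.1.2.2 q.1.1 :=
    (measurable_predVar τ).comp (measurable_fst.fst.prodMk measurable_fst.snd.snd)
  have h4 : Measurable fun q : (X × ℝ × GaussianMeasures X) × (C(X, ℝ) × ℝ) =>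
      covSection q.1.2.2 q.1.1 :=
    measurable_covSection.comp (measurable_fst.fst.prodMk measurable_fst.snd.snd)
  exact measurable_snd.fst.add (((measurable_fst.snd.fst.sub
    (h1.add (h2.mul measurable_snd.snd))).div h3).smul h4)

/-- The conditioning operator is measurable jointly in the design point, the observed value and the
prior. -/
theorem measurable_cond :
    Measurable fun q : X × ℝ × GaussianMeasures X => cond τ q.1 q.2.1 q.2.2 := by
  refine Measurable.subtype_mk ?_
  refine Measure.measurable_of_measurable_coe _ fun s hs => ?_
  have hm : Measurable fun q : X × ℝ × GaussianMeasures X => q.2.2 := measurable_snd.snd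
  have h : ∀ q : X × ℝ × GaussianMeasures X,
      ((q.2.2.1.prod (gaussianReal 0 1)).map (condMap τ q.1 q.2.1 q.2.2)) s =
        ((noisyKernel X).comap _ hm) q (Prod.mk q ⁻¹' ((fun q : (X × ℝ × GaussianMeasures X) ×
            (C(X, ℝ) × ℝ) => condMap τ q.1.1 q.1.2.1 q.1.2.2 q.2) ⁻¹' s)) := by
    intro q
    rw [Measure.map_apply (continuous_condMap τ _ _ _).measurable hs, Kernel.comap_apply,
      noisyKernel_apply]
    rfl
  simp_rw [h]
  exact Kernel.measurable_kernel_prodMk_left (measurable_condMap τ hs)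

variable {τ} in
theorem measurable_cond_apply {α : Type*} [MeasurableSpace α] {d : α → X} {z : α → ℝ}
    {ν : α → GaussianMeasures X} (hd : Measurable d) (hz : Measurable z) (hν : Measurable ν) :
    Measurable fun a => cond τ (d a) (z a) (ν a) :=
  (measurable_cond τ).comp (hd.prodMk (hz.prodMk hν))

end Measurability

/-! ### Conditional distributions and disintegrations -/

section CondDist

/-- Two random probability measures on a standard Borel space which agree almost surely on each
measurable set are almost surely equal. -/
theorem ae_eq_of_forall_measureReal_ae_eq {Ω S : Type*} [MeasurableSpace Ω] [MeasurableSpace S]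
    [StandardBorelSpace S] {P : Measure Ω} {μ κ : Ω → Measure S}
    [∀ ω, IsProbabilityMeasure (μ ω)] [∀ ω, IsProbabilityMeasure (κ ω)]
    (h : ∀ s, MeasurableSet s → (fun ω => (μ ω).real s) =ᵐ[P] fun ω => (κ ω).real s) :
    ∀ᵐ ω ∂P, μ ω = κ ω := by
  have hf := measurableEmbedding_embeddingReal S
  have h' : ∀ s, MeasurableSet s → ∀ᵐ ω ∂P, μ ω s = κ ω s := fun s hs => by
    filter_upwards [h s hs] with ω hω
    simpa [measureReal_def, ENNReal.toReal_eq_toReal_iff'] using hω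
  -- through an embedding into `ℝ`, countably many half-lines are enough
  suffices ∀ᵐ ω ∂P, ∀ ⦃t : Set ℝ⦄, MeasurableSet t →
      μ ω (embeddingReal S ⁻¹' t) = κ ω (embeddingReal S ⁻¹' t) by
    filter_upwards [this] with ω hω
    ext t ht
    have := hω (hf.measurableSet_image.2 ht)
    rwa [hf.injective.preimage_image] at this
  apply MeasurableSpace.ae_induction_on_inter Real.borel_eq_generateFrom_Iic_rat
    Real.isPiSystem_Iic_rat
  · simp
  · simp only [Set.iUnion_singleton_eq_range, Set.mem_range, forall_exists_index,
      forall_apply_eq_imp_iff]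
    exact ae_all_iff.2 fun q => h' _ (hf.measurable measurableSet_Iic)
  · refine ae_of_all _ fun ω t ht heq => ?_
    rw [Set.preimage_compl, prob_compl_eq_one_sub (hf.measurable ht),
      prob_compl_eq_one_sub (hf.measurable ht), heq]
  · refine ae_of_all _ fun ω f hdisj hfm heq => ?_
    rw [Set.preimage_iUnion, measure_iUnion (fun i j hij => (hdisj hij).preimage _)
      fun i => hf.measurable (hfm i), measure_iUnion (fun i j hij => (hdisj hij).preimage _)
      fun i => hf.measurable (hfm i)]
    exact tsum_congr heq

variable {X : Type u} [MetricSpace X] [CompactSpace X] {Ω : Type w}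
  {m' : MeasurableSpace Ω} [mΩ : MeasurableSpace Ω] {P : Measure Ω} [IsProbabilityMeasure P]
  {ξ : Ω → C(X, ℝ)} {ν : Ω → GaussianMeasures X}

/-- A Gaussian conditional distribution given `σ(V)` is almost surely equal to the regular
conditional distribution given `V`. -/
theorem IsCondDist.ae_eq_condDistrib {β : Type*} {mβ : MeasurableSpace β} {V : Ω → β}
    (hV : Measurable V) (hξ : Measurable ξ) (h : IsCondDist P ξ (mβ.comap V) ν) :
    ∀ᵐ ω ∂P, (ν ω).1 = condDistrib ξ V P (V ω) := by
  have (ω : Ω) : IsProbabilityMeasure (ν ω).1 := have := (ν ω).2; inferInstance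
  exact ae_eq_of_forall_measureReal_ae_eq fun s hs =>
    (h.2 s hs).trans (condDistrib_ae_eq_condExp hV hξ hs).symm

theorem isCondDist_of_ae_eq_condDistrib {β : Type*} {mβ : MeasurableSpace β} {V : Ω → β}
    (hV : Measurable V) (hξ : Measurable ξ) (hν : Measurable ν)
    (h : ∀ᵐ ω ∂P, (ν ω).1 = condDistrib ξ V P (V ω)) : IsCondDist P ξ (mβ.comap V) ν := by
  refine ⟨hν, fun A hA => EventuallyEq.trans ?_ (condDistrib_ae_eq_condExp hV hξ hA)⟩
  filter_upwards [h] with ω hω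
  rw [hω]

/-- The random Gaussian measure `ν ∘ V` is a conditional distribution of `ξ` given `V` as soon as
`ν` disintegrates the joint law of `(V, ξ)`. -/
theorem isCondDist_of_map_eq_compProd {β : Type*} {mβ : MeasurableSpace β} {V : Ω → β}
    (hV : Measurable V) (hξ : Measurable ξ) {ν : β → GaussianMeasures X} (hν : Measurable ν)
    (h : P.map (fun ω => (V ω, ξ ω)) = P.map V ⊗ₘ (gaussianKernel X).comap ν hν) :
    IsCondDist P ξ (mβ.comap V) (ν ∘ V) := by
  refine isCondDist_of_ae_eq_condDistrib hV hξ (hν.comp hV) ?_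
  have h1 := condDistrib_ae_eq_of_measure_eq_compProd V hξ.aemeasurable h
  filter_upwards [ae_of_ae_map hV.aemeasurable h1] with ω hω
  rw [hω]
  rfl

/-- Converse of `isCondDist_of_map_eq_compProd`. -/
theorem IsCondDist.map_eq_compProd {β : Type*} {mβ : MeasurableSpace β} {V : Ω → β}
    (hV : Measurable V) (hξ : Measurable ξ) {ν : β → GaussianMeasures X} (hν : Measurable ν)
    (h : IsCondDist P ξ (mβ.comap V) (ν ∘ V)) :
    P.map (fun ω => (V ω, ξ ω)) = P.map V ⊗ₘ (gaussianKernel X).comap ν hν := by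
  rw [← compProd_map_condDistrib hξ.aemeasurable]
  ext s hs
  rw [Measure.compProd_apply hs, Measure.compProd_apply hs,
    lintegral_map (Kernel.measurable_kernel_prodMk_left hs) hV,
    lintegral_map (Kernel.measurable_kernel_prodMk_left hs) hV]
  refine lintegral_congr_ae ?_
  filter_upwards [h.ae_eq_condDistrib hV hξ] with ω hω
  rw [← hω]
  rfl

/-- Conditional expectations given `m'` are integrals against a conditional distribution given
`m'`. The result for random variables is applied to the identity of `Ω`, viewed as a map
into `(Ω, m')`. -/
theorem IsCondDist.condExp_ae_eq (hm : m' ≤ mΩ) (hξ : Measurable ξ)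
    (h : IsCondDist P ξ m' ν) {g : C(X, ℝ) → ℝ} (hg : Measurable g)
    (hgξ : Integrable (fun ω => g (ξ ω)) P) :
    P[fun ω => g (ξ ω) | m'] =ᵐ[P] fun ω => ∫ f, g f ∂(ν ω).1 := by
  have h1 := h
  rw [← MeasurableSpace.comap_id (m := m')] at h1
  have h2 := h1.ae_eq_condDistrib (mβ := m') (V := id) (measurable_id'' hm) hξ
  have h3 := condExp_ae_eq_integral_condDistrib (mβ := m') (X := id) (Y := ξ) (μ := P)
    (measurable_id'' hm) hξ.aemeasurable hg.stronglyMeasurable hgξ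
  rw [MeasurableSpace.comap_id] at h3
  filter_upwards [h2, h3] with ω hω hω'
  rw [hω', hω]

end CondDist

/-! ### Conditioning on one noisy observation -/

section Disintegration

variable {X : Type u} [MetricSpace X] [CompactSpace X] (τ : C(X, ℝ≥0)) (x : X)
  (ν : GaussianMeasures X)

/-- The noisy observation `f x + τ x u`, as a continuous linear functional of the pair `(f, u)`. -/
noncomputable def noisyObs : C(X, ℝ) × ℝ →L[ℝ] ℝ :=
  (ContinuousMap.evalCLM ℝ x).comp (ContinuousLinearMap.fst ℝ C(X, ℝ) ℝ) +
    (τ x : ℝ) • ContinuousLinearMap.snd ℝ C(X, ℝ) ℝ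

theorem noisyObs_apply (p : C(X, ℝ) × ℝ) : noisyObs τ x p = p.1 x + τ x * p.2 := rfl

/-- The part of `f` that is left after subtracting its regression on the noisy observation. -/
noncomputable def krigingResidual : C(X, ℝ) × ℝ →L[ℝ] C(X, ℝ) :=
  ContinuousLinearMap.fst ℝ C(X, ℝ) ℝ -
    ((predVar τ ν x)⁻¹ • noisyObs τ x).smulRight (covSection ν x)

theorem krigingResidual_apply (p : C(X, ℝ) × ℝ) : krigingResidual τ x ν p =
    p.1 - (noisyObs τ x p / predVar τ ν x) • covSection ν x := by
  simp [krigingResidual, div_eq_inv_mul]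

/-- The map defining `Cond_{x, z}(ν)` depends on `f` and `u` through the kriging residual only. -/
theorem condMap_eq_residual_add (z : ℝ) (p : C(X, ℝ) × ℝ) : condMap τ x z ν p =
    krigingResidual τ x ν p + (z / predVar τ ν x) • covSection ν x := by
  rw [krigingResidual_apply, noisyObs_apply, condMap, sub_div, sub_smul]
  abel

theorem memLp_two_dual (L : StrongDual ℝ C(X, ℝ)) : MemLp L 2 ν.1 :=
  have := ν.2
  IsGaussian.memLp_dual ν.1 L 2 (by simp)

theorem covariance_eval_dual (L : StrongDual ℝ C(X, ℝ)) :
    cov[fun f : C(X, ℝ) => f x, L; ν.1] = L (covSection ν x) := by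
  have := ν.2
  have hm : ∫ f, L f ∂ν.1 = L (meanMap ν) := IsGaussian.integral_dual L
  rw [covSection_eq_integral, covariance, hm, ← ContinuousLinearMap.integral_comp_comm]
  · simp [mean]
  · exact integrable_cov_integrand ν x

theorem covariance_noisyObs_dual (L : StrongDual ℝ C(X, ℝ)) :
    cov[noisyObs τ x, fun p : C(X, ℝ) × ℝ => L p.1; ν.1.prod (gaussianReal 0 1)] =
      L (covSection ν x) := by
  have := ν.2
  have hL := (memLp_two_dual ν L).comp_fst (gaussianReal 0 1)
  have h1 : (noisyObs τ x : C(X, ℝ) × ℝ → ℝ) = (fun p => p.1 x) + fun p => (τ x : ℝ) * p.2 := rfl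
  have h2 := covariance_map_fun (μ := ν.1.prod (gaussianReal 0 1)) (Z := Prod.fst)
    (X := fun f : C(X, ℝ) => f x) (Y := L)
    (ContinuousMap.evalCLM ℝ x).continuous.aestronglyMeasurable
    L.continuous.aestronglyMeasurable measurable_fst.aemeasurable
  rw [Measure.map_fst_prod, measure_univ, one_smul, covariance_eval_dual] at h2
  rw [h1, covariance_add_left (memLp_two_eval_fst ν x) ((memLp_two_snd ν).const_mul _) hL, ← h2,
    covariance_const_mul_left, covariance_comm (fun p : C(X, ℝ) × ℝ => p.2),
    covariance_fst_snd_prod (X := L) (Y := fun u : ℝ => u) (memLp_two_dual ν L)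
      (memLp_id_gaussianReal 2)]
  simp

theorem variance_noisyObs :
    cov[noisyObs τ x, noisyObs τ x; ν.1.prod (gaussianReal 0 1)] = predVar τ ν x := by
  have := ν.2
  have hobs : MemLp (noisyObs τ x) 2 (ν.1.prod (gaussianReal 0 1)) :=
    (memLp_two_eval_fst ν x).add ((memLp_two_snd ν).const_mul _)
  have h1 : (noisyObs τ x : C(X, ℝ) × ℝ → ℝ) = (fun p => p.1 x) + fun p => (τ x : ℝ) * p.2 := rfl
  have hss : cov[fun p : C(X, ℝ) × ℝ => p.2, fun p => p.2; ν.1.prod (gaussianReal 0 1)] = 1 := by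
    have h := covariance_map_fun (μ := ν.1.prod (gaussianReal 0 1)) (Z := Prod.snd)
      (X := fun u : ℝ => u) (Y := fun u : ℝ => u) (by fun_prop) (by fun_prop)
      measurable_snd.aemeasurable
    rw [← h, Measure.map_snd_prod, covariance_self (by fun_prop)]
    simp [variance_fun_id_gaussianReal]
  have h2 : cov[noisyObs τ x, fun p : C(X, ℝ) × ℝ => p.1 x; ν.1.prod (gaussianReal 0 1)] =
      cov ν x x := covariance_noisyObs_dual τ x ν (ContinuousMap.evalCLM ℝ x)
  have h3 : cov[noisyObs τ x, fun p : C(X, ℝ) × ℝ => (τ x : ℝ) * p.2;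
      ν.1.prod (gaussianReal 0 1)] = (τ x : ℝ) ^ 2 := by
    rw [h1, covariance_add_left (memLp_two_eval_fst ν x) ((memLp_two_snd ν).const_mul _)
      ((memLp_two_snd ν).const_mul _), covariance_const_mul_right, covariance_const_mul_right,
      covariance_const_mul_left, hss, covariance_fst_snd_prod (X := fun f : C(X, ℝ) => f x)
        (Y := fun u : ℝ => u) (memLp_two_eval ν x) (memLp_id_gaussianReal 2)]
    ring
  nth_rewrite 2 [h1]
  rw [covariance_add_right hobs (memLp_two_eval_fst ν x) ((memLp_two_snd ν).const_mul _), h2, h3]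
  rfl

/-- The kriging residual is independent of the observation: both are Gaussian and they are
uncorrelated. -/
theorem indepFun_noisyObs_krigingResidual :
    IndepFun (noisyObs τ x) (krigingResidual τ x ν) (ν.1.prod (gaussianReal 0 1)) := by
  have := ν.2
  refine HasGaussianLaw.indepFun_of_covariance_strongDual ?_ fun L₁ L₂ => ?_
  · have : IsGaussian ((ν.1.prod (gaussianReal 0 1)).map
      ((noisyObs τ x).prod (krigingResidual τ x ν))) := inferInstance
    exact this.hasGaussianLaw
  · have hobs : MemLp (noisyObs τ x) 2 (ν.1.prod (gaussianReal 0 1)) :=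
      (memLp_two_eval_fst ν x).add ((memLp_two_snd ν).const_mul _)
    have hL := (memLp_two_dual ν L₂).comp_fst (gaussianReal 0 1)
    have h1 : L₁ ∘ noisyObs τ x = fun p => L₁ 1 * noisyObs τ x p := by
      funext p
      simpa [mul_comm] using L₁.map_smul (noisyObs τ x p) 1
    have h2 : L₂ ∘ krigingResidual τ x ν = (fun p : C(X, ℝ) × ℝ => L₂ p.1) -
        fun p => (L₂ (covSection ν x) / predVar τ ν x) * noisyObs τ x p := by
      funext p
      simp only [Function.comp_apply, krigingResidual_apply, map_sub, map_smul, smul_eq_mul,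
        Pi.sub_apply]
      ring
    rw [h1, h2, covariance_const_mul_left, covariance_sub_right hobs hL (hobs.const_mul _),
      covariance_const_mul_right, covariance_noisyObs_dual]
    have h3 : cov[noisyObs τ x, fun p => noisyObs τ x p; ν.1.prod (gaussianReal 0 1)] =
      predVar τ ν x := variance_noisyObs τ x ν
    rw [h3]
    by_cases h0 : predVar τ ν x = 0
    · simp [covSection_eq_zero_of_predVar_eq_zero h0]
    · field_simp
      simp

/-- `Cond_{x, z}(ν)` disintegrates `ν` with respect to the noisy observation at `x`. -/
theorem lintegral_noisyObs_eq_lintegral_cond {g : ℝ × C(X, ℝ) → ℝ≥0∞} (hg : Measurable g) :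
    ∫⁻ p, g (noisyObs τ x p, p.1) ∂(ν.1.prod (gaussianReal 0 1)) =
      ∫⁻ p, ∫⁻ f, g (noisyObs τ x p, f) ∂(cond τ x (noisyObs τ x p) ν).1
        ∂(ν.1.prod (gaussianReal 0 1)) := by
  have := ν.2
  set M := ν.1.prod (gaussianReal 0 1) with hM
  -- `Φ` recovers the pair (observation, path) from the pair (observation, residual)
  let Φ : ℝ × C(X, ℝ) → ℝ × C(X, ℝ) := fun q =>
    (q.1, q.2 + (q.1 / predVar τ ν x) • covSection ν x)
  have hΦ : Measurable Φ := by fun_prop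
  have hZ : Measurable (noisyObs τ x) := (noisyObs τ x).continuous.measurable
  have hR : Measurable (krigingResidual τ x ν) := (krigingResidual τ x ν).continuous.measurable
  have hind := (indepFun_iff_map_prod_eq_prod_map_map hZ.aemeasurable hR.aemeasurable).1
    (indepFun_noisyObs_krigingResidual τ x ν)
  have hgΦ : Measurable fun q => g (Φ q) := hg.comp hΦ
  calc ∫⁻ p, g (noisyObs τ x p, p.1) ∂M
      = ∫⁻ p, g (Φ (noisyObs τ x p, krigingResidual τ x ν p)) ∂M := by
        simp only [Φ, krigingResidual_apply, sub_add_cancel]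
    _ = ∫⁻ q, g (Φ q) ∂(M.map fun p => (noisyObs τ x p, krigingResidual τ x ν p)) :=
        (lintegral_map hgΦ (hZ.prodMk hR)).symm
    _ = ∫⁻ z, ∫⁻ r, g (Φ (z, r)) ∂(M.map (krigingResidual τ x ν)) ∂(M.map (noisyObs τ x)) := by
        rw [hind, lintegral_prod _ hgΦ.aemeasurable]
    _ = ∫⁻ p, ∫⁻ r, g (Φ (noisyObs τ x p, r)) ∂(M.map (krigingResidual τ x ν)) ∂M :=
        lintegral_map hgΦ.lintegral_prod_right' hZ
    _ = ∫⁻ p, ∫⁻ f, g (noisyObs τ x p, f) ∂(cond τ x (noisyObs τ x p) ν).1 ∂M := by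
        refine lintegral_congr fun p => ?_
        have e1 := lintegral_map (μ := M)
          (hgΦ.comp (measurable_prodMk_left (x := noisyObs τ x p))) hR
        have e2 := lintegral_map (μ := M) (hg.comp (measurable_prodMk_left (x := noisyObs τ x p)))
          (continuous_condMap τ x (noisyObs τ x p) ν).measurable
        refine e1.trans (Eq.trans ?_ e2.symm)
        simp only [Φ, condMap_eq_residual_add, Function.comp_apply]

end Disintegration

/-! ### One step of the conditioning recursion -/

section Step

variable {X : Type u} [MetricSpace X] [CompactSpace X] {Ω : Type w} [mΩ : MeasurableSpace Ω]
  {P : Measure Ω} [IsProbabilityMeasure P] {ξ : Ω → C(X, ℝ)} {u : Ω → ℝ}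
  {β : Type*} {mβ : MeasurableSpace β} {V : Ω → β} {ν : β → GaussianMeasures X}

/-- If `ν ∘ V` is the conditional distribution of `ξ` given `V`, and `u` is a standard Gaussian
variable independent of `(V, ξ)`, then the conditional law of `(ξ, u)` given `V` is the product of
`ν ∘ V` and the standard Gaussian law. -/
theorem map_noise_eq_compProd (hV : Measurable V) (hξ : Measurable ξ) (hν : Measurable ν)
    (hu : HasLaw u (gaussianReal 0 1) P) (hum : Measurable u)
    (hind : IndepFun (fun ω => (V ω, ξ ω)) u P)
    (h : P.map (fun ω => (V ω, ξ ω)) = P.map V ⊗ₘ (gaussianKernel X).comap ν hν) :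
    P.map (fun ω => (V ω, (ξ ω, u ω))) = P.map V ⊗ₘ (noisyKernel X).comap ν hν := by
  refine Measure.ext_of_lintegral _ fun g hg => ?_
  have hlaw := (indepFun_iff_map_prod_eq_prod_map_map (hV.prodMk hξ).aemeasurable
    hum.aemeasurable).1 hind
  rw [hu.map_eq, h] at hlaw
  have hg' : Measurable fun q : (β × C(X, ℝ)) × ℝ => g (q.1.1, (q.1.2, q.2)) :=
    hg.comp (measurable_fst.fst.prodMk (measurable_fst.snd.prodMk measurable_snd))
  have : IsProbabilityMeasure (P.map V) := Measure.isProbabilityMeasure_map hV.aemeasurable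
  calc ∫⁻ q, g q ∂(P.map fun ω => (V ω, (ξ ω, u ω)))
      = ∫⁻ ω, g (V ω, (ξ ω, u ω)) ∂P := lintegral_map hg (hV.prodMk (hξ.prodMk hum))
    _ = ∫⁻ q, g (q.1.1, (q.1.2, q.2)) ∂(P.map fun ω => ((V ω, ξ ω), u ω)) :=
        (lintegral_map hg' ((hV.prodMk hξ).prodMk hum)).symm
    _ = ∫⁻ b, ∫⁻ f, ∫⁻ v, g (b, (f, v)) ∂(gaussianReal 0 1) ∂(ν b).1 ∂(P.map V) := by
        rw [hlaw, lintegral_prod _ hg'.aemeasurable,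
          Measure.lintegral_compProd hg'.lintegral_prod_right']
        rfl
    _ = ∫⁻ q, g q ∂(P.map V ⊗ₘ (noisyKernel X).comap ν hν) := by
        rw [Measure.lintegral_compProd hg]
        refine lintegral_congr fun b => ?_
        have := (ν b).2
        rw [Kernel.comap_apply, noisyKernel_apply]
        exact (lintegral_prod (fun p => g (b, p))
          (hg.comp measurable_prodMk_left).aemeasurable).symm

variable [MeasurableSpace X] [BorelSpace X] (τ : C(X, ℝ≥0)) {d : β → X}

theorem measurable_noisyObs {α : Type*} [MeasurableSpace α] {x : α → X} {p : α → C(X, ℝ) × ℝ}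
    (hx : Measurable x) (hp : Measurable p) : Measurable fun a => noisyObs τ (x a) (p a) := by
  simp_rw [noisyObs_apply]
  have h1 : Measurable fun a => (p a).1 (x a) := measurable_eval_prod.comp (hx.prodMk hp.fst)
  have h2 : Measurable fun a => (τ (x a) : ℝ) := (measurable_noiseLevel τ).comp hx
  exact h1.add (h2.mul hp.snd)

omit [IsProbabilityMeasure P] [MeasurableSpace X] [BorelSpace X] in
/-- If `η` is the conditional law of `W` given `V`, and if `K` disintegrates, under each `η b`, the
law of a function `π` of `W` with respect to a function `Z b` of `W`, then `K` is the conditional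
law of `π ∘ W` given `V` and `Z V W`. -/
theorem map_prodMk_eq_compProd_of_disintegration [SFinite P] {E S T : Type*} [MeasurableSpace E]
    [MeasurableSpace S] [MeasurableSpace T] {W : Ω → E} (hV : Measurable V) (hW : Measurable W)
    {η : Kernel β E} [IsMarkovKernel η] (h : P.map (fun ω => (V ω, W ω)) = P.map V ⊗ₘ η)
    {Z : β → E → T} (hZ : Measurable fun q : β × E => Z q.1 q.2) {π : E → S} (hπ : Measurable π)
    {K : Kernel (β × T) S} [IsMarkovKernel K]
    (hK : ∀ b (g : T × S → ℝ≥0∞), Measurable g →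
      ∫⁻ p, g (Z b p, π p) ∂(η b) = ∫⁻ p, ∫⁻ f, g (Z b p, f) ∂(K (b, Z b p)) ∂(η b)) :
    P.map (fun ω => ((V ω, Z (V ω) (W ω)), π (W ω))) =
      P.map (fun ω => (V ω, Z (V ω) (W ω))) ⊗ₘ K := by
  refine Measure.ext_of_lintegral _ fun g hg => ?_
  have hVW : Measurable fun ω => (V ω, W ω) := hV.prodMk hW
  have hVZ : Measurable fun ω => (V ω, Z (V ω) (W ω)) := hV.prodMk (hZ.comp hVW)
  have hg1 : Measurable fun q : β × E => g ((q.1, Z q.1 q.2), π q.2) :=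
    hg.comp ((measurable_fst.prodMk hZ).prodMk (hπ.comp measurable_snd))
  have hg2 : Measurable fun q : β × T => ∫⁻ f, g (q, f) ∂(K q) := hg.lintegral_kernel_prod_right'
  have hg3 : Measurable fun q : β × E =>
      ∫⁻ f, g ((q.1, Z q.1 q.2), f) ∂(K (q.1, Z q.1 q.2)) :=
    hg2.comp (measurable_fst.prodMk hZ)
  calc ∫⁻ q, g q ∂(P.map fun ω => ((V ω, Z (V ω) (W ω)), π (W ω)))
      = ∫⁻ ω, g ((V ω, Z (V ω) (W ω)), π (W ω)) ∂P :=
        lintegral_map hg (hVZ.prodMk (hπ.comp hW))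
    _ = ∫⁻ q, g ((q.1, Z q.1 q.2), π q.2) ∂(P.map fun ω => (V ω, W ω)) :=
        (lintegral_map hg1 hVW).symm
    _ = ∫⁻ b, ∫⁻ p, g ((b, Z b p), π p) ∂(η b) ∂(P.map V) := by
        rw [h, Measure.lintegral_compProd hg1]
    _ = ∫⁻ b, ∫⁻ p, ∫⁻ f, g ((b, Z b p), f) ∂(K (b, Z b p)) ∂(η b) ∂(P.map V) :=
        lintegral_congr fun b => hK b (fun q => g ((b, q.1), q.2))
          (hg.comp ((measurable_const.prodMk measurable_fst).prodMk measurable_snd))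
    _ = ∫⁻ q, ∫⁻ f, g ((q.1, Z q.1 q.2), f) ∂(K (q.1, Z q.1 q.2))
          ∂(P.map fun ω => (V ω, W ω)) := by
        rw [h, Measure.lintegral_compProd hg3]
    _ = ∫⁻ ω, ∫⁻ f, g ((V ω, Z (V ω) (W ω)), f) ∂(K (V ω, Z (V ω) (W ω))) ∂P :=
        lintegral_map hg3 hVW
    _ = _ := by
        rw [Measure.lintegral_compProd hg, lintegral_map hg2 hVZ]

/-- One step of the conditioning recursion: if `ν ∘ V` is the conditional distribution of `ξ` given
`V`, then the conditioning operator yields the conditional distribution given `V` and a noisy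
observation at the point `d ∘ V`. -/
theorem map_obs_eq_compProd_cond (hV : Measurable V) (hξ : Measurable ξ) (hν : Measurable ν)
    (hum : Measurable u) (hd : Measurable d)
    (hc : Measurable fun q : β × ℝ => cond τ (d q.1) q.2 (ν q.1))
    (h : P.map (fun ω => (V ω, (ξ ω, u ω))) = P.map V ⊗ₘ (noisyKernel X).comap ν hν) :
    P.map (fun ω => ((V ω, noisyObs τ (d (V ω)) (ξ ω, u ω)), ξ ω)) =
      P.map (fun ω => (V ω, noisyObs τ (d (V ω)) (ξ ω, u ω))) ⊗ₘ
        (gaussianKernel X).comap (fun q : β × ℝ => cond τ (d q.1) q.2 (ν q.1)) hc := by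
  have hZ : Measurable fun q : β × (C(X, ℝ) × ℝ) => noisyObs τ (d q.1) q.2 :=
    measurable_noisyObs τ (hd.comp measurable_fst) measurable_snd
  refine map_prodMk_eq_compProd_of_disintegration (W := fun ω => (ξ ω, u ω)) (π := Prod.fst)
    (Z := fun b p => noisyObs τ (d b) p) hV (hξ.prodMk hum) h hZ measurable_fst fun b g hg => ?_
  simp only [Kernel.comap_apply, noisyKernel_apply, gaussianKernel_apply]
  exact lintegral_noisyObs_eq_lintegral_cond τ (d b) (ν b) hg

end Step

section Independence

/-- If `Y` and `Z` are independent, and jointly independent of `X`, then `Z` is independent of the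
pair `(X, Y)`. -/
theorem indepFun_prodMk_left_of_indepFun {Ω α β γ : Type*} [MeasurableSpace Ω] [MeasurableSpace α]
    [MeasurableSpace β] [MeasurableSpace γ] {P : Measure Ω} [IsProbabilityMeasure P]
    {X : Ω → α} {Y : Ω → β} {Z : Ω → γ} (hX : Measurable X) (hY : Measurable Y)
    (hZ : Measurable Z) (h : IndepFun X (fun ω => (Y ω, Z ω)) P) (h' : IndepFun Y Z P) :
    IndepFun (fun ω => (X ω, Y ω)) Z P := by
  have hXY : IndepFun X Y P := h.comp measurable_id measurable_fst
  rw [indepFun_iff_map_prod_eq_prod_map_map (by fun_prop) (by fun_prop)] at h h' hXY ⊢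
  have : IsProbabilityMeasure (P.map X) := Measure.isProbabilityMeasure_map hX.aemeasurable
  have : IsProbabilityMeasure (P.map Y) := Measure.isProbabilityMeasure_map hY.aemeasurable
  have : IsProbabilityMeasure (P.map Z) := Measure.isProbabilityMeasure_map hZ.aemeasurable
  have h1 : P.map (fun ω => ((X ω, Y ω), Z ω)) =
      (P.map fun ω => (X ω, (Y ω, Z ω))).map MeasurableEquiv.prodAssoc.symm := by
    rw [Measure.map_map (MeasurableEquiv.measurable _) (hX.prodMk (hY.prodMk hZ))]
    rfl
  rw [h1, h, h', hXY, ← Measure.prodAssoc_prod,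
    Measure.map_map (MeasurableEquiv.measurable _) (MeasurableEquiv.measurable _)]
  simp

end Independence

/-! ### The posteriors are conditional distributions -/

section Posterior

variable {X : Type u} [MetricSpace X] [CompactSpace X] [mX : MeasurableSpace X] [BorelSpace X]
  {Ω : Type w} [mΩ : MeasurableSpace Ω] {P : Measure Ω} {ξ : Ω → C(X, ℝ)} {U : ℕ → Ω → ℝ}
  {τ : C(X, ℝ≥0)} {D : ℕ → Ω → X}

theorem info_succ (n : ℕ) : info τ ξ U D (n + 1) = info τ ξ U D n ⊔ (mX.comap (D n) ⊔
    (inferInstance : MeasurableSpace ℝ).comap (observation τ ξ U D n)) :=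
  Nat.iSup_lt_succ _ n

theorem measurable_info_succ_design (n : ℕ) : Measurable[info τ ξ U D (n + 1)] (D n) :=
  Measurable.of_comap_le (info_succ (τ := τ) (D := D) n ▸ le_sup_of_le_right le_sup_left)

theorem measurable_info_succ_observation (n : ℕ) :
    Measurable[info τ ξ U D (n + 1)] (observation τ ξ U D n) :=
  Measurable.of_comap_le (info_succ (τ := τ) (D := D) n ▸ le_sup_of_le_right le_sup_right)

/-- The posterior after `n` observations is a function of these observations. -/
theorem measurable_info_posterior (hM : IsGPModel P ξ U) (n : ℕ) :
    Measurable[info τ ξ U D n] (posterior τ hM D n) := by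
  induction n with
  | zero => exact @measurable_const _ _ _ (info τ ξ U D 0) _
  | succ n ih =>
    have h1 := ih.mono (info_succ (τ := τ) (ξ := ξ) (U := U) (D := D) n ▸ le_sup_left :
      info τ ξ U D n ≤ info τ ξ U D (n + 1)) le_rfl
    exact (measurable_cond τ).comp ((measurable_info_succ_design n).prodMk
      ((measurable_info_succ_observation n).prodMk h1))

/-- Along a sequential design, the first `n` observations are functions of the path `ξ` and of
the first `n` noise variables. -/
theorem info_le_comap (hD : IsSequentialDesign τ ξ U D) (n : ℕ) :
    info τ ξ U D n ≤ MeasurableSpace.comap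
      (fun ω => (ξ ω, fun i : Finset.range n => U i ω)) inferInstance := by
  induction n with
  | zero => simp [info]
  | succ n ih =>
    have hle : MeasurableSpace.comap
        (fun ω => (ξ ω, fun i : Finset.range n => U i ω)) inferInstance ≤
        MeasurableSpace.comap
        (fun ω => (ξ ω, fun i : Finset.range (n + 1) => U i ω)) inferInstance := by
      have hm : Measurable fun q : C(X, ℝ) × (Finset.range (n + 1) → ℝ) =>
          (q.1, fun i : Finset.range n => q.2 ⟨i, Finset.mem_range.2
            ((Finset.mem_range.1 i.2).trans n.lt_succ_self)⟩) :=
        measurable_fst.prodMk (measurable_pi_lambda _ fun i =>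
          (measurable_pi_apply _).comp measurable_snd)
      rw [show (fun ω => (ξ ω, fun i : Finset.range n => U i ω)) =
        (fun q : C(X, ℝ) × (Finset.range (n + 1) → ℝ) =>
          (q.1, fun i : Finset.range n => q.2 ⟨i, Finset.mem_range.2
            ((Finset.mem_range.1 i.2).trans n.lt_succ_self)⟩)) ∘
          (fun ω => (ξ ω, fun i : Finset.range (n + 1) => U i ω)) from rfl,
        ← MeasurableSpace.comap_comp]
      exact MeasurableSpace.comap_mono hm.comap_le
    rw [info_succ]
    let G : MeasurableSpace Ω := MeasurableSpace.comap
        (fun ω => (ξ ω, fun i : Finset.range (n + 1) => U i ω)) inferInstance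
    have hG : Measurable[G] (fun ω => (ξ ω, fun i : Finset.range (n + 1) => U i ω)) :=
      comap_measurable _
    have hDn : Measurable[G] (D n) := (hD n).mono (ih.trans hle) le_rfl
    have hξ : Measurable[G] ξ := measurable_fst.comp hG
    have hU : Measurable[G] (U n) := ((measurable_pi_apply
      (⟨n, Finset.self_mem_range_succ n⟩ : Finset.range (n + 1))).comp measurable_snd).comp hG
    exact sup_le (ih.trans hle) (sup_le hDn.comap_le
      (measurable_noisyObs τ hDn (hξ.prodMk hU)).comap_le)

/-- The noise variable of the next observation is independent of the path and of the past. -/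
theorem indepFun_info (hM : IsGPModel P ξ U) (hD : IsSequentialDesign τ ξ U D) (n : ℕ) :
    Indep (info τ ξ U D n ⊔ MeasurableSpace.comap ξ inferInstance)
      (MeasurableSpace.comap (U n) inferInstance) P := by
  have := hM.isGaussianProcess.isProbabilityMeasure
  have hξ : Measurable ξ := measurable_of_eval hM.measurable_eval
  have hW : Measurable fun ω => fun i : Finset.range n => U i ω :=
    measurable_pi_lambda _ fun i => hM.measurable_noise i
  have h1 : IndepFun (fun ω => fun i : Finset.range n => U i ω) (U n) P := by
    have := hM.iIndepFun_noise.indepFun_finset (Finset.range n) {n} (by simp) hM.measurable_noise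
    exact this.comp measurable_id
      (measurable_pi_apply (⟨n, Finset.mem_singleton_self n⟩ : ({n} : Finset ℕ)))
  have h2 : IndepFun ξ (fun ω => (fun i : Finset.range n => U i ω, U n ω)) P :=
    hM.indepFun.comp (φ := id) (ψ := fun v : ℕ → ℝ => (fun i : Finset.range n => v i, v n))
      measurable_id ((measurable_pi_lambda _ fun i => measurable_pi_apply _).prodMk
        (measurable_pi_apply _))
  have h3 := indepFun_prodMk_left_of_indepFun hξ hW (hM.measurable_noise n) h2 h1
  refine indep_of_indep_of_le_left ((IndepFun_iff_Indep _ _ _).1 h3)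
    (sup_le (info_le_comap hD n) ?_)
  exact (measurable_fst.comp (comap_measurable
    (fun ω => (ξ ω, fun i : Finset.range n => U i ω)))).comap_le

/-- The unconditional law is the conditional distribution given the trivial σ-algebra. -/
theorem isCondDist_bot [IsProbabilityMeasure P] (hξ : Measurable ξ) {ν : GaussianMeasures X}
    (h : ν.1 = P.map ξ) : IsCondDist P ξ ⊥ fun _ => ν := by
  refine ⟨measurable_const, fun A hA => ?_⟩
  rw [condExp_bot, integral_indicator_const _ (hξ hA)]
  simp [h, map_measureReal_apply hξ hA]

theorem measurable_cond_comp {β : Type*} {mβ : MeasurableSpace β} {d : β → X}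
    {ν : β → GaussianMeasures X} (hd : Measurable d) (hν : Measurable ν) :
    Measurable fun q : β × ℝ => cond τ (d q.1) q.2 (ν q.1) :=
  (measurable_cond τ).comp ((hd.comp measurable_fst).prodMk
    (measurable_snd.prodMk (hν.comp measurable_fst)))

/-- Given the first `n` observations, `ξ` and the next noise variable are conditionally independent,
with laws `P_n^ξ` and the standard Gaussian law. -/
theorem map_info_eq_compProd [IsProbabilityMeasure P] (hM : IsGPModel P ξ U)
    (hD : IsSequentialDesign τ ξ U D) (n : ℕ)
    (h : IsCondDist P ξ (info τ ξ U D n) (posterior τ hM D n)) :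
    @Measure.map Ω (Ω × (C(X, ℝ) × ℝ)) mΩ (@Prod.instMeasurableSpace _ _ (info τ ξ U D n) _)
        (fun ω => (ω, (ξ ω, U n ω))) P =
      @Measure.compProd _ _ (info τ ξ U D n) _ (@Measure.map Ω Ω mΩ (info τ ξ U D n) id P)
        (@Kernel.comap _ _ _ _ _ (info τ ξ U D n) (noisyKernel X) (posterior τ hM D n)
          (measurable_info_posterior hM n)) := by
  have hξ : Measurable ξ := measurable_of_eval hM.measurable_eval
  have hle := info_le hM hD n
  rw [← MeasurableSpace.comap_id (m := info τ ξ U D n)] at h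
  refine map_noise_eq_compProd (mβ := info τ ξ U D n) (V := id) (measurable_id'' hle) hξ
    (measurable_info_posterior hM n) (hM.hasLaw_noise n) (hM.measurable_noise n) ?_
    (IsCondDist.map_eq_compProd (mβ := info τ ξ U D n) (V := id) (measurable_id'' hle) hξ
      (measurable_info_posterior hM n) h)
  -- independence of the noise and of `(id, ξ)`, with `id` valued in `Ω` with its past σ-algebra
  refine (@IndepFun_iff_Indep _ _ _ mΩ (@Prod.instMeasurableSpace _ _ (info τ ξ U D n) _) _ _ _
    _).2 ?_
  have h1 := indepFun_info hM hD n
  rw [← MeasurableSpace.comap_id (m := info τ ξ U D n),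
    ← MeasurableSpace.comap_prodMk (mβ := info τ ξ U D n)] at h1
  exact h1

/-- The posteriors computed recursively are the conditional distributions of `ξ` given the past:
the σ-algebra of the first `n + 1` observations is generated by that of the first `n` ones,
for which the design point `D n` is measurable, and by the observation made at `D n`. -/
theorem isCondDist_posterior [IsProbabilityMeasure P] (hM : IsGPModel P ξ U)
    (hD : IsSequentialDesign τ ξ U D) (n : ℕ) :
    IsCondDist P ξ (info τ ξ U D n) (posterior τ hM D n) := by
  have hξ : Measurable ξ := measurable_of_eval hM.measurable_eval
  induction n with
  | zero =>
    have h0 : info τ ξ U D 0 = ⊥ := by simp [info]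
    rw [h0]
    exact isCondDist_bot hξ rfl
  | succ n ih =>
    have hle := info_le hM hD n
    have h1 := map_info_eq_compProd hM hD n ih
    have hp := measurable_info_posterior (τ := τ) (D := D) hM n
    have h2 := map_obs_eq_compProd_cond (mβ := info τ ξ U D n) (V := id) τ
      (measurable_id'' hle) hξ hp (hM.measurable_noise n) (hD n)
      (measurable_cond_comp (mβ := info τ ξ U D n) (hD n) hp) h1
    have hZ : Measurable (observation τ ξ U D n) :=
      (measurable_info_succ_observation n).mono (info_le hM hD (n + 1)) le_rfl
    have h3 := isCondDist_of_map_eq_compProd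
      (mβ := @Prod.instMeasurableSpace _ _ (info τ ξ U D n) _)
      (V := fun ω => (ω, observation τ ξ U D n ω))
      (@Measurable.prodMk _ mΩ _ _ (info τ ξ U D n) _ _ _ (measurable_id'' hle) hZ) hξ
      (measurable_cond_comp (mβ := info τ ξ U D n) (hD n) hp) h2
    have h4 : info τ ξ U D (n + 1) = (@Prod.instMeasurableSpace _ _ (info τ ξ U D n) _).comap
        (fun ω => (ω, observation τ ξ U D n ω)) := by
      refine Eq.trans ?_ (MeasurableSpace.comap_prodMk (mβ := info τ ξ U D n) (fun ω : Ω => ω)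
        (observation τ ξ U D n)).symm
      rw [info_succ]
      have h5 : MeasurableSpace.comap (fun ω : Ω => ω) (info τ ξ U D n) = info τ ξ U D n :=
        MeasurableSpace.comap_id
      rw [h5, ← sup_assoc, sup_eq_left.2 (hD n).comap_le]
    rw [h4]
    exact h3

end Posterior

/-! ### The expected maximum along a Gaussian direction -/

section ExpMax

variable {X : Type u} [TopologicalSpace X] [CompactSpace X] [Nonempty X]

/-- The expected maximum of the random function `m + u b`, where `u` is a standard Gaussian
variable. -/
noncomputable def expMax (m b : C(X, ℝ)) : ℝ := ∫ u, maxValue (m + u • b) ∂(gaussianReal 0 1)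

theorem integrable_id_gaussianReal : Integrable (fun u : ℝ => u) (gaussianReal 0 1) :=
  (memLp_id_gaussianReal 1).integrable le_rfl

theorem integrable_maxValue_add_smul (m b : C(X, ℝ)) :
    Integrable (fun u : ℝ => maxValue (m + u • b)) (gaussianReal 0 1) := by
  refine ((integrable_const ‖m‖).add (integrable_id_gaussianReal.norm.mul_const ‖b‖)).mono'
    (continuous_maxValue.comp (by fun_prop)).aestronglyMeasurable
    (Eventually.of_forall fun u => ?_)
  refine (abs_maxValue_le _).trans ((norm_add_le _ _).trans ?_)
  simp [norm_smul]

theorem abs_expMax_sub_le (m b m' b' : C(X, ℝ)) : |expMax m b - expMax m' b'| ≤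
    ‖m - m'‖ + (∫ u, ‖u‖ ∂(gaussianReal 0 1)) * ‖b - b'‖ := by
  have h1 : Integrable (fun u : ℝ => ‖m - m'‖ + ‖u‖ * ‖b - b'‖) (gaussianReal 0 1) :=
    (integrable_const _).add (integrable_id_gaussianReal.norm.mul_const _)
  rw [expMax, expMax, ← integral_sub (integrable_maxValue_add_smul m b)
    (integrable_maxValue_add_smul m' b')]
  have h2 := norm_integral_le_of_norm_le
    (f := fun u : ℝ => maxValue (m + u • b) - maxValue (m' + u • b')) h1
    (Eventually.of_forall fun u => ?_)
  · refine h2.trans_eq ?_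
    rw [integral_add (integrable_const _) (integrable_id_gaussianReal.norm.mul_const _),
      integral_mul_const]
    simp
  · refine (abs_maxValue_sub_le _ _).trans ?_
    rw [show m + u • b - (m' + u • b') = (m - m') + u • (b - b') by rw [smul_sub]; abel]
    exact (norm_add_le _ _).trans_eq (by rw [norm_smul])

theorem tendsto_expMax {ι : Type*} {l : Filter ι} {ms bs : ι → C(X, ℝ)} {m b : C(X, ℝ)}
    (hm : Tendsto ms l (𝓝 m)) (hb : Tendsto bs l (𝓝 b)) :
    Tendsto (fun i => expMax (ms i) (bs i)) l (𝓝 (expMax m b)) := by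
  rw [tendsto_iff_dist_tendsto_zero]
  refine squeeze_zero (fun _ => dist_nonneg) (fun i => abs_expMax_sub_le (ms i) (bs i) m b) ?_
  have h1 := tendsto_iff_norm_sub_tendsto_zero.1 hm
  have h2 := (tendsto_iff_norm_sub_tendsto_zero.1 hb).const_mul
    (∫ u, ‖u‖ ∂(gaussianReal 0 1))
  simpa using h1.add h2

theorem integral_eval_add_smul (m b : C(X, ℝ)) (y : X) :
    ∫ u, (m + u • b) y ∂(gaussianReal 0 1) = m y := by
  simp only [ContinuousMap.add_apply, ContinuousMap.smul_apply, smul_eq_mul]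
  rw [integral_add (integrable_const _) (integrable_id_gaussianReal.mul_const _),
    integral_mul_const, integral_id_gaussianReal]
  simp

theorem integrable_eval_add_smul (m b : C(X, ℝ)) (y : X) :
    Integrable (fun u : ℝ => (m + u • b) y) (gaussianReal 0 1) := by
  simp only [ContinuousMap.add_apply, ContinuousMap.smul_apply, smul_eq_mul]
  exact (integrable_const _).add (integrable_id_gaussianReal.mul_const _)

/-- Jensen's inequality for the maximum. -/
theorem maxValue_le_expMax (m b : C(X, ℝ)) : maxValue m ≤ expMax m b := by
  refine maxValue_le fun y => ?_
  rw [← integral_eval_add_smul m b y]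
  exact integral_mono (integrable_eval_add_smul m b y) (integrable_maxValue_add_smul m b)
    fun u => le_maxValue _ y

theorem expMax_zero (m : C(X, ℝ)) : expMax m 0 = maxValue m := by
  simp [expMax]

/-- If a Gaussian perturbation in the direction `b` does not increase the expected maximum of `m`,
then `b` is constant: otherwise some affine function `u ↦ (m + u b) y` exceeds the one given by a
maximizer of `m` on a half-line. -/
theorem eq_of_expMax_le_maxValue {m b : C(X, ℝ)} (h : expMax m b ≤ maxValue m) {y₀ : X}
    (hy₀ : m y₀ = maxValue m) (y : X) : b y = b y₀ := by
  have h0 : ∀ u : ℝ, 0 ≤ maxValue (m + u • b) - (m + u • b) y₀ := fun u =>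
    sub_nonneg.2 (le_maxValue _ _)
  have hi := (integrable_maxValue_add_smul m b).sub (integrable_eval_add_smul m b y₀)
  have hint : ∫ u, (maxValue (m + u • b) - (m + u • b) y₀) ∂(gaussianReal 0 1) = 0 := by
    rw [integral_sub (integrable_maxValue_add_smul m b) (integrable_eval_add_smul m b y₀),
      integral_eval_add_smul, hy₀]
    exact sub_eq_zero.2 (le_antisymm h (maxValue_le_expMax m b))
  have hae := (integral_eq_zero_iff_of_nonneg h0 hi).1 hint
  -- the standard Gaussian law charges every open set: the inequality holds for every `u`
  have hae' : ∀ᵐ u : ℝ, (m + u • b) y - (m + u • b) y₀ ≤ 0 := by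
    filter_upwards [gaussianReal_absolutelyContinuous' 0 one_ne_zero hae] with u hu
    have hu' : maxValue (m + u • b) - (m + u • b) y₀ = 0 := hu
    linarith [le_maxValue (m + u • b) y]
  have hall : ∀ u : ℝ, (m + u • b) y - (m + u • b) y₀ ≤ 0 := by
    intro u
    by_contra hu
    have hopen : IsOpen {u : ℝ | ¬ (m + u • b) y - (m + u • b) y₀ ≤ 0} := by
      simp only [not_le, ContinuousMap.add_apply, ContinuousMap.smul_apply, smul_eq_mul]
      exact isOpen_lt (by fun_prop) (by fun_prop)
    exact (hopen.measure_pos volume ⟨u, hu⟩).ne' hae'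
  simp only [ContinuousMap.add_apply, ContinuousMap.smul_apply, smul_eq_mul] at hall
  by_contra hne
  have hne' : b y - b y₀ ≠ 0 := sub_ne_zero.2 hne
  -- the value of `u` at which the affine function at `y` exceeds the one at `y₀` by `1`
  have := hall ((m y₀ - m y + 1) / (b y - b y₀))
  have h1 : (m y₀ - m y + 1) / (b y - b y₀) * (b y - b y₀) = m y₀ - m y + 1 :=
    div_mul_cancel₀ _ hne'
  linarith [mul_sub ((m y₀ - m y + 1) / (b y - b y₀)) (b y) (b y₀)]

/-- Lower semicontinuity of the gain along normalized directions: where the normalization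
degenerates, the direction vanishes and the gain is `0`, its least possible value. -/
theorem eventually_lt_expMax_sub {ι : Type*} {l : Filter ι} {ms ks : ι → C(X, ℝ)} {vs : ι → ℝ}
    {m k : C(X, ℝ)} {v c : ℝ} (hm : Tendsto ms l (𝓝 m)) (hk : Tendsto ks l (𝓝 k))
    (hv : Tendsto vs l (𝓝 v)) (h0 : v ≤ 0 → k = 0)
    (hc : c < expMax m ((√v)⁻¹ • k) - maxValue m) :
    ∀ᶠ i in l, c < expMax (ms i) ((√(vs i))⁻¹ • ks i) - maxValue (ms i) := by
  rcases le_or_gt v 0 with hv0 | hv0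
  · rw [h0 hv0, smul_zero, expMax_zero, sub_self] at hc
    exact Eventually.of_forall fun i => hc.trans_le (sub_nonneg.2 (maxValue_le_expMax _ _))
  · have h1 : Tendsto (fun i => (√(vs i))⁻¹) l (𝓝 (√v)⁻¹) :=
      ((Real.continuous_sqrt.tendsto v).comp hv).inv₀ (Real.sqrt_pos.2 hv0).ne'
    exact ((tendsto_expMax hm (h1.smul hk)).sub
      ((continuous_maxValue.tendsto m).comp hm)).eventually_const_lt hc

end ExpMax

theorem integrable_integral_compProd {α β : Type*} [MeasurableSpace α] [MeasurableSpace β]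
    {μ : Measure α} [SFinite μ] {κ : Kernel α β} [IsSFiniteKernel κ] {f : α × β → ℝ}
    (hf : Integrable f (μ ⊗ₘ κ)) : Integrable (fun a => ∫ b, f (a, b) ∂(κ a)) μ :=
  Integrable.integral_compProd (κ := Kernel.const Unit μ) (η := Kernel.prodMkLeft Unit κ) (a := ())
    hf

/-! ### The expected gain of an observation -/

section Gain

variable {X : Type u} [MetricSpace X] [CompactSpace X] [Nonempty X] (τ : C(X, ℝ≥0))

/-- The expected increase of the maximum of the mean when an observation is made at `x`. It is
defined through the law of the mean after conditioning, which is that of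
`m_ν + u k_ν(x, ·) / s_ν(x)` with a standard Gaussian variable `u`; where `s_ν(x) = 0`, the
direction `k_ν(x, ·)` is `0`. -/
noncomputable def gain (x : X) (ν : GaussianMeasures X) : ℝ :=
  expMax (meanMap ν) ((√(predVar τ ν x))⁻¹ • covSection ν x) - maxValue (meanMap ν)

theorem gain_nonneg (x : X) (ν : GaussianMeasures X) : 0 ≤ gain τ x ν :=
  sub_nonneg.2 (maxValue_le_expMax _ _)

theorem meanMap_cond (x : X) (z : ℝ) (ν : GaussianMeasures X) : meanMap (cond τ x z ν) =
    meanMap ν + ((z - mean ν x) / predVar τ ν x) • covSection ν x := by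
  ext y
  rw [meanMap_apply, mean_cond]
  simp only [ContinuousMap.add_apply, ContinuousMap.smul_apply, meanMap_apply, covSection_apply,
    smul_eq_mul]
  ring

/-- Under `ν`, the noisy observation at `x` is Gaussian with mean `m_ν(x)` and variance
`s_ν²(x)`. -/
theorem map_noisyObs (x : X) (ν : GaussianMeasures X) :
    (ν.1.prod (gaussianReal 0 1)).map (noisyObs τ x) =
      (gaussianReal 0 1).map fun u => mean ν x + √(predVar τ ν x) * u := by
  have := ν.2
  have h1 : HasGaussianLaw (noisyObs τ x) (ν.1.prod (gaussianReal 0 1)) := by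
    have : IsGaussian ((ν.1.prod (gaussianReal 0 1)).map (noisyObs τ x)) := inferInstance
    exact this.hasGaussianLaw
  have hs : Integrable (fun p : C(X, ℝ) × ℝ => p.2) (ν.1.prod (gaussianReal 0 1)) :=
    (memLp_two_snd ν).integrable (by norm_num)
  have hx : Integrable (fun p : C(X, ℝ) × ℝ => p.1 x) (ν.1.prod (gaussianReal 0 1)) :=
    (memLp_two_eval_fst ν x).integrable (by norm_num)
  have h2 : ∫ p, noisyObs τ x p ∂(ν.1.prod (gaussianReal 0 1)) = mean ν x := by
    simp only [noisyObs_apply]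
    rw [integral_add hx (hs.const_mul _), integral_const_mul,
      integral_fun_fst (fun f : C(X, ℝ) => f x), integral_fun_snd (fun u : ℝ => u)]
    simp [integral_id_gaussianReal, mean]
  have h3 : Var[noisyObs τ x; ν.1.prod (gaussianReal 0 1)] = predVar τ ν x := by
    rw [← variance_noisyObs, covariance_self (noisyObs τ x).continuous.measurable.aemeasurable]
  rw [h1.map_eq_gaussianReal, h2, h3]
  have h4 : (fun u => mean ν x + √(predVar τ ν x) * u) =
      (fun u => mean ν x + u) ∘ fun u => √(predVar τ ν x) * u := rfl
  rw [h4, ← Measure.map_map (by fun_prop) (by fun_prop), gaussianReal_map_const_mul,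
    gaussianReal_map_const_add]
  congr 1
  · simp
  · ext
    simp [Real.sq_sqrt (predVar_nonneg τ ν x), predVar_nonneg τ ν x]

/-- The standardized residual; both sides are `0` where the predictive variance vanishes. -/
theorem div_predVar_eq (x : X) (ν : GaussianMeasures X) (u : ℝ) :
    (mean ν x + √(predVar τ ν x) * u - mean ν x) / predVar τ ν x = u * (√(predVar τ ν x))⁻¹ := by
  rw [add_sub_cancel_left]
  nth_rewrite 2 [← Real.mul_self_sqrt (predVar_nonneg τ ν x)]
  rcases eq_or_ne (√(predVar τ ν x)) 0 with h | h
  · simp [h]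
  · field_simp

theorem integrable_maxValue_meanMap_cond (x : X) (ν : GaussianMeasures X) :
    Integrable (fun z => maxValue (meanMap (cond τ x z ν)))
      ((ν.1.prod (gaussianReal 0 1)).map (noisyObs τ x)) := by
  have hc : Continuous fun z => maxValue (meanMap (cond τ x z ν)) := by
    simp_rw [meanMap_cond]
    exact continuous_maxValue.comp (by fun_prop)
  rw [map_noisyObs, integrable_map_measure hc.aestronglyMeasurable (by fun_prop)]
  simp only [Function.comp_def, meanMap_cond, div_predVar_eq, mul_smul]
  exact integrable_maxValue_add_smul _ _

/-- The probabilistic meaning of `gain`: it is the expected increase of the maximum of the mean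
under conditioning on an observation at `x`. -/
theorem integral_maxValue_meanMap_cond (x : X) (ν : GaussianMeasures X) :
    ∫ p, maxValue (meanMap (cond τ x (noisyObs τ x p) ν)) ∂(ν.1.prod (gaussianReal 0 1)) =
      maxValue (meanMap ν) + gain τ x ν := by
  have hi := integrable_maxValue_meanMap_cond τ x ν
  rw [← integral_map (φ := noisyObs τ x) (f := fun z => maxValue (meanMap (cond τ x z ν)))
    (noisyObs τ x).continuous.measurable.aemeasurable hi.aestronglyMeasurable, map_noisyObs,
    integral_map (by fun_prop) (map_noisyObs τ x ν ▸ hi.aestronglyMeasurable)]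
  simp only [meanMap_cond, div_predVar_eq, mul_smul, gain, expMax]
  ring

variable [MeasurableSpace X] [BorelSpace X]

omit [Nonempty X] in
theorem measurable_cond_observation (x : X) (ν : GaussianMeasures X) :
    Measurable fun z => cond τ x z ν :=
  (measurable_cond τ).comp (measurable_const.prodMk (measurable_id.prodMk measurable_const))

omit [Nonempty X] in
theorem map_noisyObs_eq_compProd (x : X) (ν : GaussianMeasures X) :
    (ν.1.prod (gaussianReal 0 1)).map (fun p => (noisyObs τ x p, p.1)) =
      (ν.1.prod (gaussianReal 0 1)).map (noisyObs τ x) ⊗ₘ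
        (gaussianKernel X).comap _ (measurable_cond_observation τ x ν) := by
  have := ν.2
  have hZ : Measurable (noisyObs τ x) := (noisyObs τ x).continuous.measurable
  have : IsProbabilityMeasure ((ν.1.prod (gaussianReal 0 1)).map (noisyObs τ x)) :=
    Measure.isProbabilityMeasure_map hZ.aemeasurable
  refine Measure.ext_of_lintegral _ fun g hg => ?_
  rw [lintegral_map hg (hZ.prodMk measurable_fst), lintegral_noisyObs_eq_lintegral_cond τ x ν hg,
    Measure.lintegral_compProd hg, lintegral_map hg.lintegral_kernel_prod_right' hZ]
  rfl

/-- The first term of `H` is preserved on average by conditioning. -/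
theorem integral_maxValue_cond (x : X) (ν : GaussianMeasures X) :
    Integrable (fun z => ∫ f, maxValue f ∂(cond τ x z ν).1)
        ((ν.1.prod (gaussianReal 0 1)).map (noisyObs τ x)) ∧
      ∫ z, ∫ f, maxValue f ∂(cond τ x z ν).1 ∂((ν.1.prod (gaussianReal 0 1)).map (noisyObs τ x)) =
        ∫ f, maxValue f ∂ν.1 := by
  have := ν.2
  have hZ : Measurable (noisyObs τ x) := (noisyObs τ x).continuous.measurable
  have : IsProbabilityMeasure ((ν.1.prod (gaussianReal 0 1)).map (noisyObs τ x)) :=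
    Measure.isProbabilityMeasure_map hZ.aemeasurable
  have hm : Measurable fun q : ℝ × C(X, ℝ) => maxValue q.2 :=
    continuous_maxValue.measurable.comp measurable_snd
  have hi0 : Integrable (fun p : C(X, ℝ) × ℝ => maxValue p.1) (ν.1.prod (gaussianReal 0 1)) :=
    (integrable_maxValue ν).comp_fst _
  have hi : Integrable (fun q : ℝ × C(X, ℝ) => maxValue q.2)
      ((ν.1.prod (gaussianReal 0 1)).map (noisyObs τ x) ⊗ₘ
        (gaussianKernel X).comap _ (measurable_cond_observation τ x ν)) := by
    rw [← map_noisyObs_eq_compProd, integrable_map_measure hm.aestronglyMeasurable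
      (hZ.prodMk measurable_fst).aemeasurable]
    exact hi0
  refine ⟨integrable_integral_compProd hi, (Measure.integral_compProd hi).symm.trans ?_⟩
  rw [← map_noisyObs_eq_compProd, integral_map (hZ.prodMk measurable_fst).aemeasurable
    hm.aestronglyMeasurable, integral_fun_fst (fun f : C(X, ℝ) => maxValue f)]
  simp

/-- For the knowledge-gradient functional `H`, observing at `x` reduces `H` by `gain τ x ν` on
average. -/
theorem samplingCriterion_eq (x : X) (ν : GaussianMeasures X) :
    samplingCriterion τ knowledgeGradientFunctional x ν =
      ENNReal.ofReal (knowledgeGradientFunctional ν - gain τ x ν) ∧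
    0 ≤ knowledgeGradientFunctional ν - gain τ x ν := by
  have hZ : Measurable (noisyObs τ x) := (noisyObs τ x).continuous.measurable
  obtain ⟨hi1, he1⟩ := integral_maxValue_cond τ x ν
  have hi2 := integrable_maxValue_meanMap_cond τ x ν
  have hi : Integrable (fun z => knowledgeGradientFunctional (cond τ x z ν))
      ((ν.1.prod (gaussianReal 0 1)).map (noisyObs τ x)) := by
    simp_rw [knowledgeGradientFunctional_eq]
    exact hi1.sub hi2
  have he : ∫ z, knowledgeGradientFunctional (cond τ x z ν)
      ∂((ν.1.prod (gaussianReal 0 1)).map (noisyObs τ x)) =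
        knowledgeGradientFunctional ν - gain τ x ν := by
    simp_rw [knowledgeGradientFunctional_eq]
    rw [integral_sub hi1 hi2, he1, integral_map hZ.aemeasurable hi2.aestronglyMeasurable,
      integral_maxValue_meanMap_cond]
    ring
  rw [← he]
  refine ⟨?_, integral_nonneg fun z => knowledgeGradientFunctional_nonneg _⟩
  rw [ofReal_integral_eq_lintegral_ofReal hi
    (Eventually.of_forall fun z => knowledgeGradientFunctional_nonneg _)]
  have hi' : AEMeasurable (fun z => ENNReal.ofReal (knowledgeGradientFunctional (cond τ x z ν)))
      ((ν.1.prod (gaussianReal 0 1)).map (noisyObs τ x)) :=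
    hi.aestronglyMeasurable.aemeasurable.ennreal_ofReal
  rw [lintegral_map' hi' hZ.aemeasurable, samplingCriterion]
  simp only [noisyObs_apply, mul_comm]

theorem sub_samplingCriterion_eq (x : X) (ν : GaussianMeasures X) :
    (knowledgeGradientFunctional ν : EReal) -
      (samplingCriterion τ knowledgeGradientFunctional x ν : EReal) = (gain τ x ν : EReal) := by
  obtain ⟨h1, h2⟩ := samplingCriterion_eq τ x ν
  rw [h1, EReal.coe_ennreal_ofReal, max_eq_left h2, ← EReal.coe_sub, sub_sub_cancel]

theorem maxGain_eq (ν : GaussianMeasures X) :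
    maxGain τ knowledgeGradientFunctional ν = ⨆ x : X, (gain τ x ν : EReal) :=
  iSup_congr fun x => sub_samplingCriterion_eq τ x ν

theorem maxGain_nonneg (ν : GaussianMeasures X) :
    0 ≤ maxGain τ knowledgeGradientFunctional ν := by
  rw [maxGain_eq]
  exact le_iSup_of_le (Classical.arbitrary X) (by exact_mod_cast gain_nonneg τ _ ν)

theorem maxGain_eq_zero_iff (ν : GaussianMeasures X) :
    maxGain τ knowledgeGradientFunctional ν = 0 ↔ ∀ x, gain τ x ν ≤ 0 := by
  rw [← (maxGain_nonneg τ ν).ge_iff_eq', maxGain_eq, iSup_le_iff]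
  exact forall_congr' fun x => by exact_mod_cast Iff.rfl

omit [MeasurableSpace X] [BorelSpace X] in
/-- If no observation yields a positive gain, the covariance `k_ν(x, ·)` is constant for every
`x`, so that `ξ - ξ(y₀)` is deterministic and a maximizer `y₀` of the mean maximizes `ξ`. -/
theorem knowledgeGradientFunctional_eq_zero_of_gain_le {ν : GaussianMeasures X}
    (h : ∀ x, gain τ x ν ≤ 0) : knowledgeGradientFunctional ν = 0 := by
  have := ν.2
  obtain ⟨y₀, hy₀⟩ := exists_eq_maxValue (meanMap ν)
  -- `k_ν` is constant in its second argument, so that the increments have zero variance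
  have hk : ∀ x y, cov ν x y = cov ν x y₀ := by
    intro x y
    rcases (predVar_nonneg τ ν x).eq_or_lt with h0 | h0
    · rw [cov_eq_zero_of_predVar_eq_zero h0.symm, cov_eq_zero_of_predVar_eq_zero h0.symm]
    · have h1 := eq_of_expMax_le_maxValue (sub_nonpos.1 (h x)) hy₀ y
      simp only [ContinuousMap.smul_apply, smul_eq_mul, covSection_apply] at h1
      exact mul_left_cancel₀ (inv_ne_zero (Real.sqrt_pos.2 h0).ne') h1
  have hae : ∀ y, ∀ᵐ f ∂ν.1, f y - f y₀ = mean ν y - mean ν y₀ := by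
    intro y
    have hL : MemLp (fun f : C(X, ℝ) => f y - f y₀) 2 ν.1 :=
      (memLp_two_eval ν y).sub (memLp_two_eval ν y₀)
    have hvar : Var[fun f : C(X, ℝ) => f y - f y₀; ν.1] = 0 := by
      have h1 := variance_sub (memLp_two_eval ν y) (memLp_two_eval ν y₀)
      rw [variance_eval, variance_eval] at h1
      refine Eq.trans h1 ?_
      change cov ν y y - 2 * cov ν y y₀ + cov ν y₀ y₀ = 0
      rw [hk y y, ← hk y₀ y, cov_symm ν y₀ y]
      ring
    have h1 := ae_eq_integral_of_variance_eq_zero hL hvar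
    rw [integral_sub (integrable_eval ν y) (integrable_eval ν y₀)] at h1
    exact h1
  -- the paths are almost surely translates of the mean, and have the same maximizer
  have hall : ∀ᵐ f ∂ν.1, maxValue f = f y₀ := by
    have h1 : ∀ᵐ f ∂ν.1, ∀ n : ℕ, f (TopologicalSpace.denseSeq X n) - f y₀ =
        mean ν (TopologicalSpace.denseSeq X n) - mean ν y₀ := ae_all_iff.2 fun n => hae _
    filter_upwards [h1] with f hf
    refine le_antisymm (maxValue_le fun y => ?_) (le_maxValue f y₀)
    have h2 : (fun y => f y - f y₀) = fun y => meanMap ν y - meanMap ν y₀ := by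
      refine (TopologicalSpace.denseRange_denseSeq X).equalizer (by fun_prop) (by fun_prop) ?_
      funext n
      simpa [meanMap_apply] using hf n
    have h3 := congrFun h2 y
    have h4 := le_maxValue (meanMap ν) y
    beta_reduce at h3
    linarith
  rw [knowledgeGradientFunctional_eq, integral_congr_ae hall, ← hy₀, meanMap_apply]
  exact sub_self _

/-- The functional and its maximal expected gain have the same zeros. -/
theorem knowledgeGradientFunctional_eq_zero_iff (ν : GaussianMeasures X) :
    knowledgeGradientFunctional ν = 0 ↔ maxGain τ knowledgeGradientFunctional ν = 0 := by
  rw [maxGain_eq_zero_iff]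
  refine ⟨fun h x => ?_, knowledgeGradientFunctional_eq_zero_of_gain_le τ⟩
  have := (samplingCriterion_eq τ x ν).2
  linarith

end Gain

/-! ### Semicontinuity of the gain -/

section Semicontinuity

variable {X : Type u} [MetricSpace X] [CompactSpace X] [Nonempty X] (τ : C(X, ℝ≥0))

omit [Nonempty X] in
/-- Continuity of `x ↦ k_ν(x, ·)` for the supremum norm. -/
theorem continuous_covSection (ν : GaussianMeasures X) : Continuous (covSection ν) := by
  have hν := ν.2
  have h0 : covSection ν = fun x => ∫ f : C(X, ℝ), (f x - meanMap ν x) • (f - meanMap ν) ∂ν.1 := by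
    funext x
    rw [covSection_eq_integral, meanMap_apply]
  rw [h0]
  have h2 : MemLp (fun f : C(X, ℝ) => f - meanMap ν) 2 ν.1 :=
    (memLp_two_gaussian ν).sub (memLp_const _)
  refine continuous_of_dominated (bound := fun f => ‖f - meanMap ν‖ * ‖f - meanMap ν‖)
    (fun x => ?_) (fun x => Eventually.of_forall fun f => ?_) ?_ ?_
  · have := (integrable_cov_integrand ν x).aestronglyMeasurable
    simp only [← meanMap_apply] at this
    exact this
  · rw [norm_smul]
    exact mul_le_mul_of_nonneg_right ((f - meanMap ν).norm_coe_le_norm x) (norm_nonneg _)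
  · exact memLp_one_iff_integrable.1 (h2.norm.mul h2.norm)
  · exact Eventually.of_forall fun f => by fun_prop

theorem lowerSemicontinuous_gain (ν : GaussianMeasures X) :
    LowerSemicontinuous fun x => gain τ x ν := by
  intro x c hc
  have hk := (continuous_covSection ν).tendsto x
  have hv : Tendsto (predVar τ ν) (𝓝 x) (𝓝 (predVar τ ν x)) := by
    have h1 : Continuous fun x => covSection ν x x + (τ x : ℝ) ^ 2 := by
      have := continuous_covSection ν
      fun_prop
    exact h1.tendsto x
  exact eventually_lt_expMax_sub tendsto_const_nhds hk hv (fun h =>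
    covSection_eq_zero_of_predVar_eq_zero (le_antisymm h (predVar_nonneg τ ν x))) hc

/-- Sequential lower semicontinuity of the gain with respect to the measure. -/
theorem GaussianTendsto.gain_le {νs : ℕ → GaussianMeasures X} {ν : GaussianMeasures X}
    (h : GaussianTendsto νs ν) (x : X) {c : ℕ → ℝ} {c₀ : ℝ} (hc : Tendsto c atTop (𝓝 c₀))
    (hle : ∀ᶠ n in atTop, gain τ x (νs n) ≤ c n) : gain τ x ν ≤ c₀ := by
  by_contra! hlt
  obtain ⟨b, hb1, hb2⟩ := exists_between hlt
  have hv : Tendsto (fun n => predVar τ (νs n) x) atTop (𝓝 (predVar τ ν x)) :=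
    (((ContinuousMap.evalCLM ℝ x).continuous.tendsto _).comp (h.covSection x)).add_const _
  have h1 := eventually_lt_expMax_sub h.meanMap (h.covSection x) hv (fun h =>
    covSection_eq_zero_of_predVar_eq_zero (le_antisymm h (predVar_nonneg τ ν x))) hb2
  obtain ⟨n, hn1, hn2, hn3⟩ := (h1.and (hle.and (hc.eventually_lt_const hb1))).exists
  have hn1' : b < gain τ x (νs n) := hn1
  linarith

end Semicontinuity

/-! ### Convergence of Bochner integrals -/

section Approximation

/-- Bochner integrals converge in norm along a sequence of measures as soon as their images under an
approximation `T` of the identity converge, and the integrated approximation errors converge. -/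
theorem tendsto_integral_of_approximation {S E : Type*} [MeasurableSpace S] [NormedAddCommGroup E]
    [NormedSpace ℝ E] [CompleteSpace E] {T : ℕ → E →L[ℝ] E}
    (hT : ∀ f, Tendsto (fun k => T k f) atTop (𝓝 f)) {κs : ℕ → Measure S} {κ : Measure S}
    {Φ : S → E} (hΦs : ∀ n, Integrable Φ (κs n)) (hΦ : Integrable Φ κ)
    (h1 : ∀ k, Tendsto (fun n => T k (∫ f, Φ f ∂(κs n))) atTop (𝓝 (T k (∫ f, Φ f ∂κ))))
    (h2 : ∀ k, Tendsto (fun n => ∫ f, ‖T k (Φ f) - Φ f‖ ∂(κs n)) atTop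
      (𝓝 (∫ f, ‖T k (Φ f) - Φ f‖ ∂κ))) :
    Tendsto (fun n => ∫ f, Φ f ∂(κs n)) atTop (𝓝 (∫ f, Φ f ∂κ)) := by
  obtain ⟨C, hC⟩ : ∃ C, ∀ k, ‖T k‖ ≤ C := banach_steinhaus fun f => by
    obtain ⟨C, hC⟩ := (hT f).norm.bddAbove_range
    exact ⟨C, fun k => hC ⟨k, rfl⟩⟩
  have hlim : Tendsto (fun k => ∫ f, ‖T k (Φ f) - Φ f‖ ∂κ) atTop (𝓝 0) := by
    rw [← integral_zero S ℝ (μ := κ)]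
    refine tendsto_integral_of_dominated_convergence (fun f => (C + 1) * ‖Φ f‖) (fun k => ?_)
      (hΦ.norm.const_mul _) (fun k => Eventually.of_forall fun f => ?_)
      (Eventually.of_forall fun f => ?_)
    · exact (((T k).integrable_comp hΦ).sub hΦ).norm.aestronglyMeasurable
    · rw [norm_norm, add_mul, one_mul]
      exact (norm_sub_le _ _).trans (add_le_add_left ((T k).le_of_opNorm_le (hC k) _) _)
    · exact tendsto_iff_norm_sub_tendsto_zero.1 (hT (Φ f))
  have hbound : ∀ (μ : Measure S) (k : ℕ), Integrable Φ μ →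
      ‖T k (∫ f, Φ f ∂μ) - ∫ f, Φ f ∂μ‖ ≤ ∫ f, ‖T k (Φ f) - Φ f‖ ∂μ := fun μ k hμ => by
    rw [← (T k).integral_comp_comm hμ, ← integral_sub ((T k).integrable_comp hμ) hμ]
    exact norm_integral_le_integral_norm _
  rw [Metric.tendsto_nhds]
  intro ε hε
  obtain ⟨k, hk⟩ := (hlim.eventually_lt_const (show 0 < ε / 3 by positivity)).exists
  filter_upwards [(h2 k).eventually_lt_const hk,
    Metric.tendsto_nhds.1 (h1 k) (ε / 3) (by positivity)] with n hn1 hn2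
  have h3 := hbound (κs n) k (hΦs n)
  have h4 := hbound κ k hΦ
  rw [dist_eq_norm] at hn2 ⊢
  have h5 : ∫ f, Φ f ∂(κs n) - ∫ f, Φ f ∂κ =
      -(T k (∫ f, Φ f ∂(κs n)) - ∫ f, Φ f ∂(κs n)) +
      (T k (∫ f, Φ f ∂(κs n)) - T k (∫ f, Φ f ∂κ)) + (T k (∫ f, Φ f ∂κ) - ∫ f, Φ f ∂κ) := by abel
  rw [h5]
  refine (norm_add₃_le).trans_lt ?_
  rw [norm_neg]
  linarith

variable (Y : Type u) [MetricSpace Y] [CompactSpace Y]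

/-- The points used at the `k`-th stage of an approximation of the identity of `C(Y, ℝ)` by point
evaluations. -/
noncomputable def approxNodes (k : ℕ) : Finset Y := (exists_evaluation_approx Y).choose k

/-- The functions used at the `k`-th stage of that approximation. -/
noncomputable def approxFun (k : ℕ) (y : Y) : C(Y, ℝ) :=
  (exists_evaluation_approx Y).choose_spec.choose k y

/-- The resulting finite-rank operators, which converge strongly to the identity. -/
noncomputable def approxCLM (k : ℕ) : C(Y, ℝ) →L[ℝ] C(Y, ℝ) :=
  ∑ i ∈ approxNodes Y k, (ContinuousMap.evalCLM ℝ i).smulRight (approxFun Y k i)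

variable {Y}

theorem approxCLM_apply (k : ℕ) (f : C(Y, ℝ)) :
    approxCLM Y k f = ∑ i ∈ approxNodes Y k, f i • approxFun Y k i := by
  simp [approxCLM]

theorem tendsto_approxCLM (f : C(Y, ℝ)) : Tendsto (fun k => approxCLM Y k f) atTop (𝓝 f) := by
  simp_rw [approxCLM_apply]
  exact (exists_evaluation_approx Y).choose_spec.choose_spec f

end Approximation

/-! ### A countable criterion for Gaussian measures -/

section GaussianCriterion

variable {X : Type u} [MetricSpace X] [CompactSpace X]

/-- The characteristic function of `μ` at the functional `L` is that of a Gaussian law with the mean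
and the variance of `L`. -/
def HasGaussianCharFun (μ : Measure C(X, ℝ)) (L : StrongDual ℝ C(X, ℝ)) : Prop :=
  ∫ f, Complex.exp (L f * Complex.I) ∂μ =
    Complex.exp ((∫ f, L f ∂μ : ℝ) * Complex.I -
      ((∫ f, L f ^ 2 ∂μ - (∫ f, L f ∂μ) ^ 2 : ℝ) : ℂ) / 2)

/-- The characteristic functional determines whether a square-integrable law is Gaussian. -/
theorem isGaussian_iff_hasGaussianCharFun {μ : Measure C(X, ℝ)} [IsProbabilityMeasure μ]
    (hμ : MemLp id 2 μ) : IsGaussian μ ↔ ∀ L, HasGaussianCharFun μ L := by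
  rw [isGaussian_iff_charFunDual_eq]
  refine forall_congr' fun L => ?_
  have hL : MemLp L 2 μ := L.comp_memLp' hμ
  rw [variance_eq_sub hL, charFunDual_apply, HasGaussianCharFun, integral_complex_ofReal]
  rfl

/-- The Gaussian form of the characteristic function is stable under pointwise limits of
functionals; the Banach–Steinhaus theorem provides the domination. -/
theorem HasGaussianCharFun.of_tendsto {μ : Measure C(X, ℝ)} [IsProbabilityMeasure μ]
    (hμ : MemLp id 2 μ) {Ls : ℕ → StrongDual ℝ C(X, ℝ)} {L : StrongDual ℝ C(X, ℝ)}
    (hL : ∀ f, Tendsto (fun n => Ls n f) atTop (𝓝 (L f)))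
    (h : ∀ n, HasGaussianCharFun μ (Ls n)) : HasGaussianCharFun μ L := by
  obtain ⟨C, hC⟩ : ∃ C, ∀ k, ‖Ls k‖ ≤ C := banach_steinhaus fun f => by
    obtain ⟨C, hC⟩ := (hL f).norm.bddAbove_range
    exact ⟨C, fun k => hC ⟨k, rfl⟩⟩
  have hbd : ∀ n f, |Ls n f| ≤ C * ‖f‖ := fun n f => (Ls n).le_of_opNorm_le (hC n) f
  have hi1 : Integrable (fun f : C(X, ℝ) => ‖f‖) μ := (hμ.integrable (by norm_num)).norm
  have hi2 : Integrable (fun f : C(X, ℝ) => ‖f‖ ^ 2) μ := hμ.integrable_norm_pow (by norm_num)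
  have h1 : Tendsto (fun n => ∫ f, Ls n f ∂μ) atTop (𝓝 (∫ f, L f ∂μ)) :=
    tendsto_integral_of_dominated_convergence (fun f => C * ‖f‖)
      (fun n => (Ls n).continuous.aestronglyMeasurable) (hi1.const_mul C)
      (fun n => Eventually.of_forall (hbd n)) (Eventually.of_forall hL)
  have h2 : Tendsto (fun n => ∫ f, Ls n f ^ 2 ∂μ) atTop (𝓝 (∫ f, L f ^ 2 ∂μ)) := by
    refine tendsto_integral_of_dominated_convergence (fun f => C ^ 2 * ‖f‖ ^ 2)
      (fun n => ((Ls n).continuous.pow 2).aestronglyMeasurable) (hi2.const_mul _)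
      (fun n => Eventually.of_forall fun f => ?_) (Eventually.of_forall fun f => (hL f).pow 2)
    rw [norm_pow, ← mul_pow]
    exact pow_le_pow_left₀ (norm_nonneg _) (hbd n f) 2
  have h3 : Tendsto (fun n => ∫ f, Complex.exp (Ls n f * Complex.I) ∂μ) atTop
      (𝓝 (∫ f, Complex.exp (L f * Complex.I) ∂μ)) := by
    refine tendsto_integral_of_dominated_convergence (fun _ => 1) (fun n => ?_)
      (integrable_const _) (fun n => Eventually.of_forall fun f => ?_)
      (Eventually.of_forall fun f => ?_)
    · have : Continuous fun f => Complex.exp (Ls n f * Complex.I) := by fun_prop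
      exact this.aestronglyMeasurable
    · rw [Complex.norm_exp_ofReal_mul_I]
    · have : Continuous fun y : ℝ => Complex.exp (y * Complex.I) := by fun_prop
      exact (this.tendsto _).comp (hL f)
  refine tendsto_nhds_unique h3 ?_
  have h4 : Continuous fun p : ℝ × ℝ =>
      Complex.exp (p.1 * Complex.I - ((p.2 - p.1 ^ 2 : ℝ) : ℂ) / 2) := by fun_prop
  exact ((h4.tendsto (∫ f, L f ∂μ, ∫ f, L f ^ 2 ∂μ)).comp (h1.prodMk_nhds h2)).congr
    fun n => (h n).symm

variable (X) in
/-- Index set of the rational combinations of evaluations at the approximation nodes. -/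
abbrev RatIndex : Type u := Σ k : ℕ, (approxNodes X k → ℚ)

/-- A rational combination of evaluations. -/
noncomputable def ratDual (q : RatIndex X) : StrongDual ℝ C(X, ℝ) :=
  ∑ i, (q.2 i : ℝ) • ContinuousMap.evalCLM ℝ (i : X)

/-- Every functional is the pointwise limit of a sequence of rational combinations of
evaluations. -/
theorem exists_ratDual_tendsto (L : StrongDual ℝ C(X, ℝ)) :
    ∃ q : ℕ → RatIndex X, ∀ f, Tendsto (fun n => ratDual (q n) f) atTop (𝓝 (L f)) := by
  have h1 : ∀ (k : ℕ) (i : approxNodes X k), ∃ r : ℚ, |(r : ℝ) - L (approxFun X k i)| <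
      1 / (((k : ℝ) + 1) * ((approxNodes X k).card + 1)) := fun k i => by
    obtain ⟨r, hr⟩ := exists_rat_near (L (approxFun X k i))
      (show 0 < 1 / (((k : ℝ) + 1) * ((approxNodes X k).card + 1)) by positivity)
    exact ⟨r, by rwa [abs_sub_comm]⟩
  choose r hr using h1
  refine ⟨fun k => ⟨k, r k⟩, fun f => ?_⟩
  have h2 : Tendsto (fun k => L (approxCLM X k f)) atTop (𝓝 (L f)) :=
    (L.continuous.tendsto _).comp (tendsto_approxCLM f)
  have h3 : ∀ k, |ratDual ⟨k, r k⟩ f - L (approxCLM X k f)| ≤ ‖f‖ * (1 / ((k : ℝ) + 1)) := by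
    intro k
    have h4 : ratDual ⟨k, r k⟩ f - L (approxCLM X k f) =
        ∑ i : approxNodes X k, ((r k i : ℝ) - L (approxFun X k i)) * f i := by
      rw [approxCLM_apply, ← Finset.sum_coe_sort]
      simp only [ratDual, sum_apply, smul_apply,
        ContinuousMap.evalCLM_apply, map_sum, map_smul, smul_eq_mul, ← Finset.sum_sub_distrib]
      exact Finset.sum_congr rfl fun i _ => by ring
    rw [h4]
    refine (Finset.abs_sum_le_sum_abs _ _).trans ?_
    have hpos : (0 : ℝ) < (approxNodes X k).card + 1 := by positivity
    calc ∑ i : approxNodes X k, |((r k i : ℝ) - L (approxFun X k i)) * f i|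
        ≤ ∑ _i : approxNodes X k, 1 / (((k : ℝ) + 1) * ((approxNodes X k).card + 1)) * ‖f‖ := by
          refine Finset.sum_le_sum fun i _ => ?_
          rw [abs_mul]
          exact mul_le_mul (hr k i).le (f.norm_coe_le_norm i) (abs_nonneg _) (by positivity)
      _ = ‖f‖ * (1 / ((k : ℝ) + 1)) * ((approxNodes X k).card / ((approxNodes X k).card + 1)) := by
          simp only [Finset.sum_const, Finset.card_univ, Fintype.card_coe, nsmul_eq_mul]
          field_simp
      _ ≤ ‖f‖ * (1 / ((k : ℝ) + 1)) := by
          refine mul_le_of_le_one_right (by positivity) ?_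
          rw [div_le_one hpos]
          linarith
  have h5 : Tendsto (fun k => ratDual ⟨k, r k⟩ f - L (approxCLM X k f)) atTop (𝓝 0) := by
    refine squeeze_zero_norm h3 ?_
    simpa using tendsto_one_div_add_atTop_nhds_zero_nat.const_mul ‖f‖
  simpa using h5.add h2

/-- Gaussian measures on `C(X, ℝ)` are characterized by countably many conditions. -/
theorem isGaussian_iff_ratDual {μ : Measure C(X, ℝ)} [IsProbabilityMeasure μ] :
    IsGaussian μ ↔ ∫⁻ f, ‖f‖ₑ ^ 2 ∂μ < ∞ ∧ ∀ q : RatIndex X, HasGaussianCharFun μ (ratDual q) := by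
  have hmem : MemLp id 2 μ ↔ ∫⁻ f : C(X, ℝ), ‖f‖ₑ ^ 2 ∂μ < ∞ := by
    rw [MemLp, eLpNorm_lt_top_iff_lintegral_rpow_enorm_lt_top (by norm_num) (by norm_num)]
    simp [aestronglyMeasurable_id]
  refine ⟨fun h => ?_, fun h => ?_⟩
  · have h2 : MemLp id 2 μ := IsGaussian.memLp_two_id
    exact ⟨hmem.1 h2, fun q => (isGaussian_iff_hasGaussianCharFun h2).1 h _⟩
  · have h2 := hmem.2 h.1
    refine (isGaussian_iff_hasGaussianCharFun h2).2 fun L => ?_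
    obtain ⟨q, hq⟩ := exists_ratDual_tendsto L
    exact HasGaussianCharFun.of_tendsto h2 hq fun n => h.2 _

/-- Measurability of the set of parameters for which a kernel is Gaussian. It allows one to modify
a conditional distribution on the null set where it is not Gaussian, without losing its
measurability. -/
theorem measurableSet_isGaussian {β : Type*} {mβ : MeasurableSpace β} (κ : Kernel β C(X, ℝ))
    [IsMarkovKernel κ] : MeasurableSet {b | IsGaussian (κ b)} := by
  rw [show {b | IsGaussian (κ b)} = {b | ∫⁻ f, ‖f‖ₑ ^ 2 ∂(κ b) < ∞} ∩
    ⋂ q : RatIndex X, {b | HasGaussianCharFun (κ b) (ratDual q)} by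
      ext; simp [isGaussian_iff_ratDual]]
  refine MeasurableSet.inter ?_ (MeasurableSet.iInter fun q => ?_)
  · exact measurableSet_lt (Measurable.lintegral_kernel (by fun_prop)) measurable_const
  · have hr : ∀ g : C(X, ℝ) → ℝ, Continuous g → Measurable fun b => ∫ f, g f ∂(κ b) := fun g hg =>
      (StronglyMeasurable.integral_kernel_prod_right' (κ := κ)
        (f := fun p => g p.2) (hg.measurable.comp measurable_snd).stronglyMeasurable).measurable
    have hc : Measurable fun b => ∫ f, Complex.exp (ratDual q f * Complex.I) ∂(κ b) := by
      have : Continuous fun f => Complex.exp (ratDual q f * Complex.I) := by fun_prop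
      exact (StronglyMeasurable.integral_kernel_prod_right' (κ := κ)
        (f := fun p => Complex.exp (ratDual q p.2 * Complex.I))
        (this.measurable.comp measurable_snd).stronglyMeasurable).measurable
    have h1 := hr _ (ratDual q).continuous
    have h2 := hr _ ((ratDual q).continuous.pow 2)
    refine measurableSet_eq_fun hc ?_
    exact Complex.measurable_exp.comp (((Complex.measurable_ofReal.comp h1).mul_const _).sub
      ((Complex.measurable_ofReal.comp (h2.sub (h1.pow_const 2))).div_const _))

end GaussianCriterion

/-! ### Moments as Bochner integrals -/

section Tensor

variable {X : Type u} [MetricSpace X] [CompactSpace X]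

/-- The function `(x, y) ↦ f x * f y`. -/
def tensorSq (f : C(X, ℝ)) : C(X × X, ℝ) := f.comp ContinuousMap.fst * f.comp ContinuousMap.snd

theorem tensorSq_apply (f : C(X, ℝ)) (p : X × X) : tensorSq f p = f p.1 * f p.2 := rfl

theorem continuous_tensorSq : Continuous (tensorSq : C(X, ℝ) → C(X × X, ℝ)) :=
  (ContinuousMap.continuous_precomp _).mul (ContinuousMap.continuous_precomp _)

theorem norm_tensorSq_le (f : C(X, ℝ)) : ‖tensorSq f‖ ≤ ‖f‖ ^ 2 := by
  refine (ContinuousMap.norm_le _ (by positivity)).2 fun p => ?_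
  rw [tensorSq_apply, norm_mul, sq]
  exact mul_le_mul (f.norm_coe_le_norm _) (f.norm_coe_le_norm _) (norm_nonneg _) (norm_nonneg _)

theorem integrable_of_quadratic_bound {E : Type*} [NormedAddCommGroup E]
    [SecondCountableTopology E] [MeasurableSpace E] [BorelSpace E] {μ : Measure C(X, ℝ)}
    [IsProbabilityMeasure μ] (hμ : MemLp id 2 μ) {g : C(X, ℝ) → E} (hg : Continuous g) {C : ℝ}
    (hC : ∀ f, ‖g f‖ ≤ C * (1 + ‖f‖ ^ 2)) : Integrable g μ := by
  have h2 : Integrable (fun f : C(X, ℝ) => ‖f‖ ^ 2) μ := hμ.integrable_norm_pow (by norm_num)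
  exact (((integrable_const 1).add h2).const_mul C).mono' hg.measurable.aestronglyMeasurable
    (Eventually.of_forall hC)

theorem norm_le_one_add_sq (a : ℝ) : a ≤ 1 * (1 + a ^ 2) := by nlinarith [sq_nonneg (a - 1)]

theorem integrable_tensorSq {μ : Measure C(X, ℝ)} [IsProbabilityMeasure μ]
    (hμ : MemLp id 2 μ) : Integrable (tensorSq : C(X, ℝ) → C(X × X, ℝ)) μ :=
  integrable_of_quadratic_bound hμ continuous_tensorSq (C := 1) fun f =>
    (norm_tensorSq_le f).trans (by linarith)

/-- The covariance function, in terms of the second moment and of the mean. -/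
theorem integral_tensorSq_sub_apply (ν : GaussianMeasures X) (p : X × X) :
    (∫ f, tensorSq f ∂ν.1 - tensorSq (meanMap ν)) p = cov ν p.1 p.2 := by
  have := ν.2
  rw [ContinuousMap.sub_apply,
    ContinuousMap.integral_apply (integrable_tensorSq (memLp_two_gaussian ν)),
    cov_eq_integral_sub, tensorSq_apply, meanMap_apply, meanMap_apply]
  rfl

/-- Convergence of the Bochner integrals of the first two moments is the convergence of Gaussian
measures. -/
theorem gaussianTendsto_of_tendsto_integral {νs : ℕ → GaussianMeasures X} {ν : GaussianMeasures X}
    (h1 : Tendsto (fun n => ∫ f, f ∂(νs n).1) atTop (𝓝 (∫ f, f ∂ν.1)))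
    (h2 : Tendsto (fun n => ∫ f, tensorSq f ∂(νs n).1) atTop (𝓝 (∫ f, tensorSq f ∂ν.1))) :
    GaussianTendsto νs ν := by
  constructor
  · have h3 := ContinuousMap.tendsto_iff_tendstoUniformly.1 h1
    have h4 : ∀ ν : GaussianMeasures X, ⇑(∫ f, f ∂ν.1) = mean ν := fun ν =>
      funext (meanMap_apply ν)
    simpa only [h4] using h3
  · have h3 := ContinuousMap.tendsto_iff_tendstoUniformly.1
      (h2.sub ((continuous_tensorSq.tendsto _).comp h1))
    have h4 : ∀ ν : GaussianMeasures X,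
        ⇑(∫ f, tensorSq f ∂ν.1 - tensorSq (meanMap ν)) = fun p => cov ν p.1 p.2 := fun ν =>
      funext (integral_tensorSq_sub_apply ν)
    have h5 := h4 ν
    simp only [meanMap] at h4 h5
    simpa only [Function.comp_apply, h4, h5] using h3

end Tensor

/-! ### The limit of Gaussian conditional distributions -/

section Limit

variable {X : Type u} [MetricSpace X] [CompactSpace X] {Ω : Type w} [mΩ : MeasurableSpace Ω]
  {P : Measure Ω} [IsProbabilityMeasure P] {ξ : Ω → C(X, ℝ)} {ℱ : Filtration ℕ mΩ}
  {νs : ℕ → Ω → GaussianMeasures X}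

/-- Lévy's upward theorem for the integrals of a function against conditional distributions. -/
theorem ae_tendsto_integral (hξ : Measurable ξ) (h : ∀ n, IsCondDist P ξ (ℱ n) (νs n))
    {g : C(X, ℝ) → ℝ} (hg : Measurable g) (hgi : Integrable g (P.map ξ)) {κ : Ω → Measure C(X, ℝ)}
    (hκ : P[fun ω => g (ξ ω) | ⨆ n, ℱ n] =ᵐ[P] fun ω => ∫ f, g f ∂(κ ω)) :
    ∀ᵐ ω ∂P, Tendsto (fun n => ∫ f, g f ∂(νs n ω).1) atTop (𝓝 (∫ f, g f ∂(κ ω))) := by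
  have hgξ : Integrable (fun ω => g (ξ ω)) P := hgi.comp_measurable hξ
  have h1 := ae_all_iff.2 fun n => (h n).condExp_ae_eq (ℱ.le n) hξ hg hgξ
  filter_upwards [h1, hκ, tendsto_ae_condExp (μ := P) (ℱ := ℱ) fun ω => g (ξ ω)] with ω h1 h2 h3
  rw [← h2]
  exact h3.congr h1

/-- Convergence of the integrals of countably many real functions entails convergence of the Bochner
integral of a continuous map of at most quadratic growth into a space of continuous functions. -/
theorem ae_tendsto_integral_continuousMap {Y : Type u} [MetricSpace Y] [CompactSpace Y]
    {κ : Ω → Measure C(X, ℝ)} [∀ ω, IsProbabilityMeasure (κ ω)]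
    (hlim : ∀ g : C(X, ℝ) → ℝ, Continuous g → (∃ C, ∀ f, ‖g f‖ ≤ C * (1 + ‖f‖ ^ 2)) →
      ∀ᵐ ω ∂P, Tendsto (fun n => ∫ f, g f ∂(νs n ω).1) atTop (𝓝 (∫ f, g f ∂(κ ω))))
    (hκ : ∀ᵐ ω ∂P, MemLp id 2 (κ ω)) {Φ : C(X, ℝ) → C(Y, ℝ)} (hΦ : Continuous Φ)
    (hΦb : ∀ f, ‖Φ f‖ ≤ 1 * (1 + ‖f‖ ^ 2)) :
    ∀ᵐ ω ∂P, Tendsto (fun n => ∫ f, Φ f ∂(νs n ω).1) atTop (𝓝 (∫ f, Φ f ∂(κ ω))) := by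
  have h1 : ∀ k, ∀ i : approxNodes Y k, ∀ᵐ ω ∂P, Tendsto (fun n => ∫ f, Φ f i ∂(νs n ω).1) atTop
      (𝓝 (∫ f, Φ f i ∂(κ ω))) := fun k i =>
    hlim (fun f => Φ f i) ((ContinuousMap.evalCLM ℝ (i : Y)).continuous.comp hΦ)
      ⟨1, fun f => ((Φ f).norm_coe_le_norm _).trans (hΦb f)⟩
  have h2 : ∀ k, ∀ᵐ ω ∂P, Tendsto (fun n => ∫ f, ‖approxCLM Y k (Φ f) - Φ f‖ ∂(νs n ω).1) atTop
      (𝓝 (∫ f, ‖approxCLM Y k (Φ f) - Φ f‖ ∂(κ ω))) := fun k => by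
    refine hlim _ (by fun_prop) ⟨‖approxCLM Y k‖ + 1, fun f => ?_⟩
    rw [norm_norm]
    calc ‖approxCLM Y k (Φ f) - Φ f‖ ≤ ‖approxCLM Y k‖ * ‖Φ f‖ + ‖Φ f‖ :=
          (norm_sub_le _ _).trans (add_le_add_left ((approxCLM Y k).le_opNorm _) _)
      _ = (‖approxCLM Y k‖ + 1) * ‖Φ f‖ := by ring
      _ ≤ (‖approxCLM Y k‖ + 1) * (1 + ‖f‖ ^ 2) := by
          have := hΦb f
          rw [one_mul] at this
          gcongr
  filter_upwards [ae_all_iff.2 fun k => ae_all_iff.2 (h1 k), ae_all_iff.2 h2, hκ] with ω h1 h2 h3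
  have hi : ∀ n, Integrable Φ (νs n ω).1 := fun n =>
    have := (νs n ω).2
    integrable_of_quadratic_bound (memLp_two_gaussian _) hΦ hΦb
  have hi' : Integrable Φ (κ ω) := integrable_of_quadratic_bound h3 hΦ hΦb
  refine tendsto_integral_of_approximation tendsto_approxCLM hi hi' (fun k => ?_) h2
  simp_rw [approxCLM_apply]
  refine tendsto_finsetSum _ fun i hik => Tendsto.smul_const ?_ _
  simp_rw [fun n => ContinuousMap.integral_apply (hi n) i, ContinuousMap.integral_apply hi' i]
  exact h1 k ⟨i, hik⟩

/-- A limit of Gaussian measures, in the sense of the integrals entering the Gaussian form of the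
characteristic functions, is Gaussian. -/
theorem ae_isGaussian_of_tendsto
    {κ : Ω → Measure C(X, ℝ)} [∀ ω, IsProbabilityMeasure (κ ω)]
    (hlim : ∀ g : C(X, ℝ) → ℝ, Continuous g → (∃ C, ∀ f, ‖g f‖ ≤ C * (1 + ‖f‖ ^ 2)) →
      ∀ᵐ ω ∂P, Tendsto (fun n => ∫ f, g f ∂(νs n ω).1) atTop (𝓝 (∫ f, g f ∂(κ ω))))
    (hκ : ∀ᵐ ω ∂P, MemLp id 2 (κ ω)) : ∀ᵐ ω ∂P, IsGaussian (κ ω) := by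
  have hlin : ∀ q : RatIndex X, ∀ᵐ ω ∂P, Tendsto (fun n => ∫ f, ratDual q f ∂(νs n ω).1) atTop
      (𝓝 (∫ f, ratDual q f ∂(κ ω))) := fun q =>
    hlim (fun f => ratDual q f) (ratDual q).continuous ⟨‖ratDual q‖, fun f =>
      ((ratDual q).le_opNorm f).trans
      (mul_le_mul_of_nonneg_left (by simpa using norm_le_one_add_sq ‖f‖) (norm_nonneg _))⟩
  have hsq : ∀ q : RatIndex X, ∀ᵐ ω ∂P, Tendsto (fun n => ∫ f, ratDual q f ^ 2 ∂(νs n ω).1) atTop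
      (𝓝 (∫ f, ratDual q f ^ 2 ∂(κ ω))) := fun q =>
    hlim (fun f => ratDual q f ^ 2) ((ratDual q).continuous.pow 2) ⟨‖ratDual q‖ ^ 2, fun f => by
      rw [norm_pow]
      refine (pow_le_pow_left₀ (norm_nonneg _) ((ratDual q).le_opNorm f) 2).trans ?_
      rw [mul_pow]
      exact mul_le_mul_of_nonneg_left (by linarith) (sq_nonneg _)⟩
  have hcos : ∀ q : RatIndex X, ∀ᵐ ω ∂P, Tendsto (fun n => ∫ f, Real.cos (ratDual q f) ∂(νs n ω).1)
      atTop (𝓝 (∫ f, Real.cos (ratDual q f) ∂(κ ω))) := fun q =>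
    hlim (fun f => Real.cos (ratDual q f)) (Real.continuous_cos.comp (ratDual q).continuous)
      ⟨1, fun f =>
      (Real.abs_cos_le_one _).trans (by nlinarith [sq_nonneg ‖f‖])⟩
  have hsin : ∀ q : RatIndex X, ∀ᵐ ω ∂P, Tendsto (fun n => ∫ f, Real.sin (ratDual q f) ∂(νs n ω).1)
      atTop (𝓝 (∫ f, Real.sin (ratDual q f) ∂(κ ω))) := fun q =>
    hlim (fun f => Real.sin (ratDual q f)) (Real.continuous_sin.comp (ratDual q).continuous)
      ⟨1, fun f =>
      (Real.abs_sin_le_one _).trans (by nlinarith [sq_nonneg ‖f‖])⟩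
  have hexp : ∀ (μ : Measure C(X, ℝ)) [IsProbabilityMeasure μ] (L : StrongDual ℝ C(X, ℝ)),
      ∫ f, Complex.exp (L f * Complex.I) ∂μ =
        (∫ f, Real.cos (L f) ∂μ : ℝ) + (∫ f, Real.sin (L f) ∂μ : ℝ) * Complex.I := by
    intro μ _ L
    have hc : Integrable (fun f => ((Real.cos (L f) : ℝ) : ℂ)) μ :=
      (Integrable.of_bound (Real.continuous_cos.comp L.continuous).aestronglyMeasurable 1
        (Eventually.of_forall fun f => Real.abs_cos_le_one _)).ofReal
    have hs : Integrable (fun f => ((Real.sin (L f) : ℝ) : ℂ)) μ :=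
      (Integrable.of_bound (Real.continuous_sin.comp L.continuous).aestronglyMeasurable 1
        (Eventually.of_forall fun f => Real.abs_sin_le_one _)).ofReal
    rw [← integral_complex_ofReal, ← integral_complex_ofReal, ← integral_mul_const,
      ← integral_add hc (hs.mul_const _)]
    refine integral_congr_ae (Eventually.of_forall fun f => ?_)
    simp only [Complex.exp_mul_I, Complex.ofReal_cos, Complex.ofReal_sin]
  filter_upwards [ae_all_iff.2 hlin, ae_all_iff.2 hsq, ae_all_iff.2 hcos, ae_all_iff.2 hsin, hκ]
    with ω h1 h2 h3 h4 h5
  refine (isGaussian_iff_hasGaussianCharFun h5).2 fun L => ?_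
  obtain ⟨q, hq⟩ := exists_ratDual_tendsto L
  refine HasGaussianCharFun.of_tendsto h5 hq fun j => ?_
  have hn : ∀ n, HasGaussianCharFun (νs n ω).1 (ratDual (q j)) := fun n =>
    have := (νs n ω).2
    (isGaussian_iff_hasGaussianCharFun (memLp_two_gaussian _)).1 this _
  have h6 : Tendsto (fun n => ∫ f, Complex.exp (ratDual (q j) f * Complex.I) ∂(νs n ω).1) atTop
      (𝓝 (∫ f, Complex.exp (ratDual (q j) f * Complex.I) ∂(κ ω))) := by
    have : ∀ n, IsProbabilityMeasure (νs n ω).1 := fun n => have := (νs n ω).2; inferInstance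
    simp_rw [hexp]
    have hc : Continuous fun p : ℝ × ℝ => (p.1 : ℂ) + p.2 * Complex.I := by fun_prop
    exact (hc.tendsto (_, _)).comp ((h3 (q j)).prodMk_nhds (h4 (q j)))
  refine tendsto_nhds_unique h6 ?_
  have h7 : Continuous fun p : ℝ × ℝ =>
      Complex.exp (p.1 * Complex.I - ((p.2 - p.1 ^ 2 : ℝ) : ℂ) / 2) := by fun_prop
  exact ((h7.tendsto (_, _)).comp ((h1 (q j)).prodMk_nhds (h2 (q j)))).congr fun n => (hn n).symm

/-- A regular conditional distribution of `ξ` given `V`: it computes conditional expectations, and a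
random Gaussian measure which agrees with it is a Gaussian conditional distribution. -/
theorem exists_kernel_condDist_comap {β : Type*} {mβ : MeasurableSpace β} {V : Ω → β}
    (hV : Measurable V) (hξ : Measurable ξ) :
    ∃ κ : Kernel β C(X, ℝ), IsMarkovKernel κ ∧
      (∀ g : C(X, ℝ) → ℝ, Measurable g → Integrable (fun ω => g (ξ ω)) P →
        (P[fun ω => g (ξ ω) | mβ.comap V] =ᵐ[P] fun ω => ∫ f, g f ∂(κ (V ω))) ∧
          ∀ᵐ ω ∂P, Integrable g (κ (V ω))) ∧
      ∀ ν : Ω → GaussianMeasures X, Measurable ν → (∀ᵐ ω ∂P, (ν ω).1 = κ (V ω)) →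
        IsCondDist P ξ (mβ.comap V) ν := by
  refine ⟨condDistrib ξ V P, inferInstance, fun g hg hgξ => ⟨?_, ?_⟩, fun ν hν h =>
    isCondDist_of_ae_eq_condDistrib hV hξ hν h⟩
  · exact condExp_ae_eq_integral_condDistrib hV hξ.aemeasurable hg.stronglyMeasurable hgξ
  · have h1 : Integrable (fun p : β × C(X, ℝ) => g p.2) (P.map fun ω => (V ω, ξ ω)) :=
      (integrable_map_measure (hg.comp measurable_snd).aestronglyMeasurable
        (hV.prodMk hξ).aemeasurable).2 hgξ
    exact h1.condDistrib_ae hV.aemeasurable hξ.aemeasurable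

/-- The case `V = id`, for a sub-σ-algebra `m'`. -/
theorem exists_kernel_condDist {Ω : Type w} {m' : MeasurableSpace Ω} [mΩ : MeasurableSpace Ω]
    {P : Measure Ω} [IsProbabilityMeasure P] {ξ : Ω → C(X, ℝ)} (hm : m' ≤ mΩ)
    (hξ : Measurable ξ) :
    ∃ κ : @Kernel Ω C(X, ℝ) m' _, @IsMarkovKernel Ω C(X, ℝ) m' _ κ ∧
      (∀ g : C(X, ℝ) → ℝ, Measurable g → Integrable (fun ω => g (ξ ω)) P →
        (P[fun ω => g (ξ ω) | m'] =ᵐ[P] fun ω => ∫ f, g f ∂(κ ω)) ∧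
          ∀ᵐ ω ∂P, Integrable g (κ ω)) ∧
      ∀ ν : Ω → GaussianMeasures X, Measurable ν → (∀ᵐ ω ∂P, (ν ω).1 = κ ω) →
        IsCondDist P ξ m' ν := by
  have h := exists_kernel_condDist_comap (P := P) (mβ := m') (V := id) (measurable_id'' hm) hξ
  simpa only [MeasurableSpace.comap_id, id] using h

/-- Along a filtration, Gaussian conditional distributions converge almost surely to a Gaussian
conditional distribution given the limit σ-algebra. -/
theorem exists_gaussianTendsto (hξ : Measurable ξ) (hG : IsGaussian (P.map ξ))
    (h : ∀ n, IsCondDist P ξ (ℱ n) (νs n)) :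
    ∃ νlim : Ω → GaussianMeasures X, Measurable[⨆ n, ℱ n] νlim ∧
      IsCondDist P ξ (⨆ n, ℱ n) νlim ∧
      ∀ᵐ ω ∂P, GaussianTendsto (fun n => νs n ω) (νlim ω) := by
  have hle : (⨆ n, ℱ n : MeasurableSpace Ω) ≤ mΩ := iSup_le ℱ.le
  obtain ⟨κ, hκp, hκ, hκν⟩ := exists_kernel_condDist (m' := ⨆ n, ℱ n) (P := P) hle hξ
  have h2 : Integrable (fun f : C(X, ℝ) => ‖f‖ ^ 2) (P.map ξ) :=
    (IsGaussian.memLp_two_id (μ := P.map ξ)).integrable_norm_pow (by norm_num)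
  have hκp' : ∀ ω, IsProbabilityMeasure (κ ω) := hκp.isProbabilityMeasure
  have hmem : ∀ᵐ ω ∂P, MemLp id 2 (κ ω) := by
    filter_upwards [(hκ (fun f => ‖f‖ ^ 2) (by fun_prop) (h2.comp_measurable hξ)).2] with ω hω
    exact (memLp_two_iff_integrable_sq_norm measurable_id.aestronglyMeasurable).2 hω
  have hlim : ∀ g : C(X, ℝ) → ℝ, Continuous g → (∃ C, ∀ f, ‖g f‖ ≤ C * (1 + ‖f‖ ^ 2)) →
      ∀ᵐ ω ∂P, Tendsto (fun n => ∫ f, g f ∂(νs n ω).1) atTop (𝓝 (∫ f, g f ∂(κ ω))) := by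
    rintro g hg ⟨C, hC⟩
    have hgi : Integrable g (P.map ξ) :=
      have := hG
      integrable_of_quadratic_bound IsGaussian.memLp_two_id hg hC
    exact ae_tendsto_integral hξ h hg.measurable hgi
      (hκ g hg.measurable (hgi.comp_measurable hξ)).1
  have hgauss := ae_isGaussian_of_tendsto hlim hmem
  -- on the null set where `κ` is not Gaussian, the prior is an arbitrary Gaussian value
  classical
  let νlim : Ω → GaussianMeasures X := fun ω =>
    if hω : IsGaussian (κ ω) then ⟨κ ω, hω⟩ else ⟨P.map ξ, hG⟩
  have hνlim : ∀ᵐ ω ∂P, (νlim ω).1 = κ ω := by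
    filter_upwards [hgauss] with ω hω
    simp [νlim, hω]
  have hνm : Measurable[⨆ n, ℱ n] νlim := by
    refine Measurable.subtype_mk (f := fun ω => (νlim ω).1) ?_
    have : (fun ω => (νlim ω).1) = fun ω => if IsGaussian (κ ω) then κ ω else P.map ξ := by
      funext ω
      by_cases hω : IsGaussian (κ ω) <;> simp [νlim, hω]
    rw [this]
    exact Measurable.ite (measurableSet_isGaussian κ) κ.measurable measurable_const
  refine ⟨νlim, hνm, hκν νlim (hνm.mono hle le_rfl) hνlim, ?_⟩
  filter_upwards [hνlim, ae_tendsto_integral_continuousMap hlim hmem continuous_id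
      (fun f => (norm_le_one_add_sq ‖f‖)),
    ae_tendsto_integral_continuousMap hlim hmem continuous_tensorSq
      (fun f => (norm_tensorSq_le f).trans (by linarith))] with ω h1 h3 h4
  refine gaussianTendsto_of_tendsto_integral ?_ ?_
  · rw [h1]; exact h3
  · rw [h1]; exact h4

end Limit

/-! ### Regularity of the knowledge-gradient loss -/

section MaxOfMean

variable {X : Type u} [MetricSpace X] [CompactSpace X] [Nonempty X]

theorem measurable_maxValue_meanMap :
    Measurable fun ν : GaussianMeasures X => maxValue (meanMap ν) :=
  continuous_maxValue.measurable.comp measurable_meanMap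

theorem measurable_knowledgeGradientFunctional :
    Measurable (knowledgeGradientFunctional : GaussianMeasures X → ℝ) := by
  have h : (knowledgeGradientFunctional : GaussianMeasures X → ℝ) =
      fun ν => ∫ f, maxValue f ∂ν.1 - maxValue (meanMap ν) :=
    funext knowledgeGradientFunctional_eq
  rw [h]
  exact (measurable_integral_gaussian continuous_maxValue.measurable).sub
    measurable_maxValue_meanMap

theorem abs_maxValue_meanMap_le (ν : GaussianMeasures X) :
    |maxValue (meanMap ν)| ≤ ∫ f, ‖f‖ ∂ν.1 :=
  (abs_maxValue_le _).trans (norm_meanMap_le ν)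

/-- Uniform integrability is inherited by dominated families. -/
theorem uniformIntegrable_of_abs_le {ι Ω : Type*} [MeasurableSpace Ω] {P : Measure Ω}
    {f g : ι → Ω → ℝ} (hg : UniformIntegrable g 1 P) (hf : ∀ i, AEStronglyMeasurable (f i) P)
    (h : ∀ i, ∀ᵐ ω ∂P, |f i ω| ≤ g i ω) : UniformIntegrable f 1 P := by
  obtain ⟨-, h2, C, hC⟩ := hg
  have h' : ∀ i, ∀ᵐ ω ∂P, ‖f i ω‖ ≤ ‖g i ω‖ := fun i => by
    filter_upwards [h i] with ω hω
    exact hω.trans (le_abs_self _)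
  refine ⟨hf, fun ε hε => ?_, C, fun i => (eLpNorm_mono_ae (h' i)).trans (hC i)⟩
  obtain ⟨δ, hδ, h3⟩ := h2 hε
  refine ⟨δ, hδ, fun i s hs hs' => (eLpNorm_mono_ae ?_).trans (h3 i s hs hs')⟩
  filter_upwards [h' i] with ω hω
  by_cases hωs : ω ∈ s <;> simp [hωs] at hω ⊢
  exact hω

section CondDist

variable {Ω : Type w} {m₁ m₂ : MeasurableSpace Ω} [mΩ : MeasurableSpace Ω]
  {P : Measure Ω} [IsProbabilityMeasure P] {ξ : Ω → C(X, ℝ)} {ν ν₁ ν₂ : Ω → GaussianMeasures X}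

theorem integrable_maxValue_meanMap (hm : m₁ ≤ mΩ) (hξ : Measurable ξ)
    (hi : Integrable (fun ω => ‖ξ ω‖) P) (h : IsCondDist P ξ m₁ ν) :
    Integrable (fun ω => maxValue (meanMap (ν ω))) P := by
  refine (integrable_condExp (m := m₁) (f := fun ω => ‖ξ ω‖)).mono'
    (measurable_maxValue_meanMap.comp h.1).aestronglyMeasurable ?_
  filter_upwards [h.condExp_ae_eq hm hξ (g := fun f => ‖f‖) (by fun_prop) hi] with ω hω
  rw [hω]
  exact abs_maxValue_meanMap_le _

/-- Jensen's inequality: the maximum of the conditional mean increases on average with the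
information. -/
theorem maxValue_meanMap_le_condExp (h₁₂ : m₁ ≤ m₂) (hm : m₂ ≤ mΩ) (hξ : Measurable ξ)
    (hi : Integrable (fun ω => ‖ξ ω‖) P) (h₁ : IsCondDist P ξ m₁ ν₁)
    (h₂ : IsCondDist P ξ m₂ ν₂) :
    (fun ω => maxValue (meanMap (ν₁ ω))) ≤ᵐ[P] P[fun ω => maxValue (meanMap (ν₂ ω)) | m₁] := by
  have hx : ∀ x : X, (fun ω => meanMap (ν₁ ω) x) ≤ᵐ[P]
      P[fun ω => maxValue (meanMap (ν₂ ω)) | m₁] := by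
    intro x
    have hix : Integrable (fun ω => ξ ω x) P := hi.mono'
      ((measurable_eval x).comp hξ).aestronglyMeasurable
      (Eventually.of_forall fun ω => (ξ ω).norm_coe_le_norm x)
    have e₁ := h₁.condExp_ae_eq (h₁₂.trans hm) hξ (measurable_eval x) hix
    have e₂ := h₂.condExp_ae_eq hm hξ (measurable_eval x) hix
    have e₃ := condExp_condExp_of_le (μ := P) (f := fun ω => ξ ω x) h₁₂ hm
    have e₄ : P[P[fun ω => ξ ω x | m₂] | m₁] ≤ᵐ[P]
        P[fun ω => maxValue (meanMap (ν₂ ω)) | m₁] := by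
      refine condExp_mono integrable_condExp (integrable_maxValue_meanMap hm hξ hi h₂) ?_
      filter_upwards [e₂] with ω hω
      rw [hω]
      exact (meanMap_apply (ν₂ ω) x).symm.trans_le (le_maxValue _ x)
    filter_upwards [e₁, e₃, e₄] with ω h1 h3 h4
    rw [h3, h1] at h4
    exact (meanMap_apply (ν₁ ω) x).trans_le h4
  -- a common null set for all points, by continuity of the conditional mean
  filter_upwards [ae_all_iff.2 fun n => hx (TopologicalSpace.denseSeq X n)] with ω hω
  refine maxValue_le fun x => ?_
  have hc : IsClosed {x : X | meanMap (ν₁ ω) x ≤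
      (P[fun ω => maxValue (meanMap (ν₂ ω)) | m₁]) ω} :=
    isClosed_le (meanMap (ν₁ ω)).continuous continuous_const
  have := (TopologicalSpace.denseRange_denseSeq X).closure_eq.symm.subset.trans
    (closure_minimal (Set.range_subset_iff.2 hω) hc)
  exact this (Set.mem_univ x)

end CondDist

theorem integrable_norm_of_isGaussian_map {Ω : Type w} [MeasurableSpace Ω] {P : Measure Ω}
    {ξ : Ω → C(X, ℝ)} (hξ : Measurable ξ) (hG : IsGaussian (P.map ξ)) :
    Integrable (fun ω => ‖ξ ω‖) P :=
  (integrable_id_gaussian ⟨P.map ξ, hG⟩).norm.comp_measurable hξ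

/-- The family is dominated by the conditional expectations of `‖ξ‖`, which is integrable by
Fernique's theorem. -/
theorem isPUniformlyIntegrable_neg_maxValue_meanMap :
    IsPUniformlyIntegrable.{u, w} fun ν : GaussianMeasures X => -maxValue (meanMap ν) := by
  intro Ω mΩ P _ ξ hξ hG
  have hi := integrable_norm_of_isGaussian_map hξ hG.isGaussian_map
  choose m hm hν using fun ν : gaussianCondDists P ξ => ν.2
  refine uniformIntegrable_of_abs_le (hi.uniformIntegrable_condExp hm)
    (fun ν => (measurable_maxValue_meanMap.comp (hν ν).1).neg.aestronglyMeasurable) fun ν => ?_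
  filter_upwards [(hν ν).condExp_ae_eq (hm ν) hξ (g := fun f => ‖f‖) (by fun_prop) hi] with ω hω
  rw [hω, abs_neg]
  exact abs_maxValue_meanMap_le _

theorem isPContinuous_neg_maxValue_meanMap :
    IsPContinuous.{u, w} fun ν : GaussianMeasures X => -maxValue (meanMap ν) := by
  intro Ω mΩ P _ ξ _ _ νs ν _ _ h
  filter_upwards [h] with ω hω
  exact ((continuous_maxValue.tendsto _).comp hω.meanMap).neg

theorem isRegularDecomposition_knowledgeGradient :
    IsRegularDecomposition.{u, w} (knowledgeGradientFunctional : GaussianMeasures X → ℝ) maxValue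
      fun ν => -maxValue (meanMap ν) where
  eq_add ν := by rw [knowledgeGradientFunctional_eq, sub_eq_add_neg]
  measurable_left := continuous_maxValue.measurable
  integrable_left := integrable_maxValue
  measurable_right := measurable_maxValue_meanMap.neg
  uniformlyIntegrable := isPUniformlyIntegrable_neg_maxValue_meanMap
  continuous := isPContinuous_neg_maxValue_meanMap

theorem isRegularLoss_knowledgeGradientLoss [MeasurableSpace X] [BorelSpace X] (τ : C(X, ℝ≥0)) :
    IsRegularLoss.{u, u, w} τ (knowledgeGradientLoss : C(X, ℝ) → X → ℝ) where
  nonneg f d := sub_nonneg.2 (le_maxValue f d)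
  separable := inferInstance
  measurable d := continuous_maxValue.measurable.sub (measurable_eval d)
  integrable := integrable_knowledgeGradientLoss
  continuous ν := by
    have h : expectedLoss (knowledgeGradientLoss : C(X, ℝ) → X → ℝ) ν =
        fun d => ∫ f, maxValue f ∂ν.1 - meanMap ν d :=
      funext (expectedLoss_knowledgeGradientLoss ν)
    rw [h]
    exact continuous_const.sub (meanMap ν).continuous
  decomposition := ⟨maxValue, _, isRegularDecomposition_knowledgeGradient⟩
  zeros := Set.ext fun ν => knowledgeGradientFunctional_eq_zero_iff τ ν

/-! ### The supermartingale property -/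

section Supermartingale

variable [MeasurableSpace X] [BorelSpace X] (τ : C(X, ℝ≥0)) {Ω : Type w}
  [mΩ : MeasurableSpace Ω] {P : Measure Ω} {ξ : Ω → C(X, ℝ)} {U : ℕ → Ω → ℝ} {D : ℕ → Ω → X}

theorem integrable_norm_of_isGPModel (hM : IsGPModel P ξ U) : Integrable (fun ω => ‖ξ ω‖) P :=
  integrable_norm_of_isGaussian_map (measurable_of_eval hM.measurable_eval) hM.prior.2

variable {τ} in
theorem integrable_maxValue_meanMap_posterior [IsProbabilityMeasure P] (hM : IsGPModel P ξ U)
    (hD : IsSequentialDesign τ ξ U D) (n : ℕ) :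
    Integrable (fun ω => maxValue (meanMap (posterior τ hM D n ω))) P :=
  integrable_maxValue_meanMap (info_le hM hD n) (measurable_of_eval hM.measurable_eval)
    (integrable_norm_of_isGPModel hM) (isCondDist_posterior hM hD n)

theorem hasSupermartingaleProperty_neg_maxValue_meanMap :
    HasSupermartingaleProperty.{u, w} τ fun ν : GaussianMeasures X => -maxValue (meanMap ν) := by
  intro Ω mΩ P ξ U hM D hD
  have := hM.isGaussianProcess.isProbabilityMeasure
  have hsub : Submartingale (fun n ω => maxValue (meanMap (posterior τ hM D n ω)))
      (designFiltration hM hD) P :=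
    submartingale_nat
      (fun n =>
        (measurable_maxValue_meanMap.comp (measurable_info_posterior hM n)).stronglyMeasurable)
      (integrable_maxValue_meanMap_posterior hM hD)
      fun n => maxValue_meanMap_le_condExp ((designFiltration hM hD).mono n.le_succ)
        (info_le hM hD (n + 1)) (measurable_of_eval hM.measurable_eval)
        (integrable_norm_of_isGPModel hM) (isCondDist_posterior hM hD n)
        (isCondDist_posterior hM hD (n + 1))
  exact hsub.neg

/-- The functional is the sum of a martingale, the conditional expectations of `max ξ`, and of
minus the submartingale of the maxima of the posterior means. -/
theorem hasSupermartingaleProperty_knowledgeGradientFunctional :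
    HasSupermartingaleProperty.{u, w} τ
      (knowledgeGradientFunctional : GaussianMeasures X → ℝ) := by
  intro Ω mΩ P ξ U hM D hD
  have := hM.isGaussianProcess.isProbabilityMeasure
  have hξ : Measurable ξ := measurable_of_eval hM.measurable_eval
  have hmart : Martingale (fun n ω => ∫ f, maxValue f ∂(posterior τ hM D n ω).1)
      (designFiltration hM hD) P := by
    have hi : Integrable (fun ω => maxValue (ξ ω)) P :=
      (integrable_maxValue hM.prior).comp_measurable hξ
    have he := fun n => (isCondDist_posterior hM hD n).condExp_ae_eq (info_le hM hD n) hξ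
      continuous_maxValue.measurable hi
    refine ⟨fun n => ((measurable_integral_gaussian continuous_maxValue.measurable).comp
      (measurable_info_posterior hM n)).stronglyMeasurable, fun i j hij => ?_⟩
    exact (condExp_congr_ae (he j)).symm.trans ((condExp_condExp_of_le
      ((designFiltration hM hD).mono hij) ((designFiltration hM hD).le j)).trans (he i))
  have h := hmart.supermartingale.add
    (hasSupermartingaleProperty_neg_maxValue_meanMap τ Ω P ξ U hM D hD)
  have heq : (fun n ω => knowledgeGradientFunctional (posterior τ hM D n ω)) =
      (fun n ω => ∫ f, maxValue f ∂(posterior τ hM D n ω).1) +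
        fun n ω => -maxValue (meanMap (posterior τ hM D n ω)) := by
    funext n ω
    exact (knowledgeGradientFunctional_eq _).trans (sub_eq_add_neg _ _)
  rw [heq]
  exact h

end Supermartingale

end MaxOfMean

/-! ### Existence of quasi-SUR designs -/

section Selection

variable {X : Type u} [MetricSpace X] [CompactSpace X] [Nonempty X] [MeasurableSpace X]
  [BorelSpace X] (τ : C(X, ℝ≥0))

theorem measurable_samplingCriterion {H : GaussianMeasures X → ℝ} (hH : Measurable H) (x : X) :
    Measurable (samplingCriterion τ H x) := by
  have hz : Measurable fun q : GaussianMeasures X × (C(X, ℝ) × ℝ) => q.2.1 x + q.2.2 * τ x :=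
    ((measurable_eval x).comp measurable_snd.fst).add (measurable_snd.snd.mul_const _)
  have hf : Measurable fun q : GaussianMeasures X × (C(X, ℝ) × ℝ) =>
      ENNReal.ofReal (H (cond τ x (q.2.1 x + q.2.2 * τ x) q.1)) :=
    (hH.comp ((measurable_cond τ).comp
      (measurable_const.prodMk (hz.prodMk measurable_fst)))).ennreal_ofReal
  have h := hf.lintegral_kernel_prod_right' (κ := noisyKernel X)
  simp_rw [noisyKernel_apply] at h
  exact h

/-- Upper semicontinuity in the design point. The criterion may fail to be continuous: at a
noiseless point where the predictive variance vanishes, the gain is `0` but need not be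
small nearby. -/
theorem upperSemicontinuous_samplingCriterion (ν : GaussianMeasures X) :
    UpperSemicontinuous fun x => samplingCriterion τ knowledgeGradientFunctional x ν := by
  intro x c hc
  change samplingCriterion τ knowledgeGradientFunctional x ν < c at hc
  rcases eq_or_ne c ∞ with rfl | hct
  · refine Eventually.of_forall fun y => ?_
    change samplingCriterion τ knowledgeGradientFunctional y ν < ∞
    rw [(samplingCriterion_eq τ y ν).1]
    exact ENNReal.ofReal_lt_top
  · rw [(samplingCriterion_eq τ x ν).1,
      ENNReal.ofReal_lt_iff_lt_toReal (samplingCriterion_eq τ x ν).2 hct] at hc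
    filter_upwards [lowerSemicontinuous_gain τ ν x (knowledgeGradientFunctional ν - c.toReal)
      (by linarith)] with y hy
    rw [(samplingCriterion_eq τ y ν).1,
      ENNReal.ofReal_lt_iff_lt_toReal (samplingCriterion_eq τ y ν).2 hct]
    linarith

/-- The infimum of the criterion can be computed along a dense sequence. -/
theorem iInf_denseSeq_samplingCriterion (ν : GaussianMeasures X) :
    ⨅ i, samplingCriterion τ knowledgeGradientFunctional (TopologicalSpace.denseSeq X i) ν ≤
      ⨅ y, samplingCriterion τ knowledgeGradientFunctional y ν := by
  refine le_iInf fun y => le_of_forall_gt fun c hc => ?_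
  obtain ⟨i, hi⟩ := (TopologicalSpace.denseRange_denseSeq X).exists_mem_open
    ((upperSemicontinuous_samplingCriterion τ ν).isOpen_preimage c) ⟨y, hc⟩
  exact (iInf_le _ i).trans_lt hi

/-- A measurable choice of near-minimizers of the sampling criterion. Upper semicontinuity of the
criterion allows the choice to be made among the points of a dense sequence. -/
theorem exists_measurable_nearMinimizer {ε : ℝ} (hε : 0 < ε) :
    ∃ s : GaussianMeasures X → X, Measurable s ∧
      ∀ ν, IsNearMinimizer τ knowledgeGradientFunctional ν ε (s ν) := by
  classical
  let J : ℕ → GaussianMeasures X → ℝ≥0∞ := fun i =>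
    samplingCriterion τ knowledgeGradientFunctional (TopologicalSpace.denseSeq X i)
  have hJ : ∀ i, Measurable (J i) := fun i =>
    measurable_samplingCriterion τ measurable_knowledgeGradientFunctional _
  have hJt : ∀ i ν, J i ν ≠ ∞ := fun i ν => by
    change samplingCriterion τ knowledgeGradientFunctional _ ν ≠ ∞
    rw [(samplingCriterion_eq τ _ ν).1]
    exact ENNReal.ofReal_ne_top
  have hex : ∀ ν, ∃ i, J i ν < (⨅ j, J j ν) + ENNReal.ofReal ε := fun ν => by
    refine iInf_lt_iff.1 (ENNReal.lt_add_right ?_ (ENNReal.ofReal_pos.2 hε).ne')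
    exact ne_top_of_le_ne_top (hJt 0 ν) (iInf_le _ 0)
  refine ⟨fun ν => TopologicalSpace.denseSeq X (Nat.find (hex ν)), ?_, fun ν => ?_⟩
  · refine (measurable_from_nat (f := TopologicalSpace.denseSeq X)).comp
      (measurable_find hex fun i => ?_)
    exact measurableSet_lt (hJ i) ((Measurable.iInf hJ).add measurable_const)
  · exact (Nat.find_spec (hex ν)).le.trans
      (add_le_add_left (iInf_denseSeq_samplingCriterion τ ν) _)

variable {Ω : Type w} [mΩ : MeasurableSpace Ω] {P : Measure Ω} {ξ : Ω → C(X, ℝ)} {U : ℕ → Ω → ℝ}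

/-- The posterior distributions along the design which selects its `n`-th point as the function
`s n` of the current posterior. -/
noncomputable def feedbackPosterior (hM : IsGPModel P ξ U) (s : ℕ → GaussianMeasures X → X) :
    ℕ → Ω → GaussianMeasures X
  | 0, _ => hM.prior
  | n + 1, ω =>
    cond τ (s n (feedbackPosterior hM s n ω))
      (ξ ω (s n (feedbackPosterior hM s n ω)) + τ (s n (feedbackPosterior hM s n ω)) * U n ω)
      (feedbackPosterior hM s n ω)

/-- The recursion for the posteriors agrees with the one which defines the design. -/
theorem posterior_feedback (hM : IsGPModel P ξ U) (s : ℕ → GaussianMeasures X → X) (n : ℕ) :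
    posterior τ hM (fun n ω => s n (feedbackPosterior τ hM s n ω)) n =
      feedbackPosterior τ hM s n := by
  induction n with
  | zero => rfl
  | succ n ih =>
    funext ω
    simp only [posterior, feedbackPosterior, ih, observation]

theorem exists_isEpsQuasiSUR (hM : IsGPModel P ξ U) {ε : ℕ → ℝ} (hε : ∀ n, 0 < ε n) :
    ∃ D : ℕ → Ω → X, IsEpsQuasiSUR τ knowledgeGradientFunctional hM ε D ∧
      ∀ n ω, IsNearMinimizer τ knowledgeGradientFunctional (posterior τ hM D n ω) (ε n)
        (D n ω) := by
  choose s hs hs' using fun n => exists_measurable_nearMinimizer τ (hε n)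
  let D : ℕ → Ω → X := fun n ω => s n (feedbackPosterior τ hM s n ω)
  have hpost : ∀ n, D n = s n ∘ posterior τ hM D n := fun n =>
    congrArg (s n ∘ ·) (posterior_feedback τ hM s n).symm
  have hmin : ∀ n ω, IsNearMinimizer τ knowledgeGradientFunctional (posterior τ hM D n ω) (ε n)
      (D n ω) := fun n ω => by
    rw [hpost n]
    exact hs' n _
  have hD : IsSequentialDesign τ ξ U D := fun n => by
    have h := (hs n).comp (measurable_info_posterior (τ := τ) (D := D) hM n)
    rwa [← hpost n] at h
  exact ⟨D, ⟨hD, 0, fun n _ => Eventually.of_forall (hmin n)⟩, hmin⟩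

end Selection

/-- Non-negative functions whose integrals have bounded partial sums tend to zero almost
everywhere. -/
theorem ae_tendsto_zero_of_sum_integral_le {Ω : Type*} [MeasurableSpace Ω] {P : Measure Ω}
    {f : ℕ → Ω → ℝ} (hf : ∀ n, Integrable (f n) P) (h0 : ∀ n ω, 0 ≤ f n ω) {C : ℝ}
    (hC : ∀ N, ∑ n ∈ Finset.range N, ∫ ω, f n ω ∂P ≤ C) :
    ∀ᵐ ω ∂P, Tendsto (fun n => f n ω) atTop (𝓝 0) := by
  have hm : ∀ n, AEMeasurable (fun ω => ENNReal.ofReal (f n ω)) P := fun n =>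
    (hf n).aestronglyMeasurable.aemeasurable.ennreal_ofReal
  have hfin : ∫⁻ ω, ∑' n, ENNReal.ofReal (f n ω) ∂P ≠ ∞ := by
    rw [lintegral_tsum hm]
    refine ne_top_of_le_ne_top (ENNReal.ofReal_ne_top (r := C)) ?_
    rw [ENNReal.tsum_eq_iSup_nat]
    refine iSup_le fun N => ?_
    simp_rw [← fun n => ofReal_integral_eq_lintegral_ofReal (hf n) (Eventually.of_forall (h0 n))]
    rw [← ENNReal.ofReal_sum_of_nonneg fun n _ => integral_nonneg (h0 n)]
    exact ENNReal.ofReal_le_ofReal (hC N)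
  filter_upwards [ae_lt_top' (AEMeasurable.tsum hm) hfin] with ω hω
  have h := ENNReal.tendsto_atTop_zero_of_tsum_ne_top hω.ne
  have h' := (ENNReal.tendsto_toReal ENNReal.zero_ne_top).comp h
  simpa only [Function.comp_def, ENNReal.toReal_ofReal (h0 _ _), ENNReal.toReal_zero] using h'

/-! ### Convergence of quasi-SUR designs -/

section Convergence

variable {X : Type u} [MetricSpace X] [CompactSpace X] [Nonempty X] [MeasurableSpace X]
  [BorelSpace X] {τ : C(X, ℝ≥0)} {Ω : Type w} [mΩ : MeasurableSpace Ω] {P : Measure Ω}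
  {ξ : Ω → C(X, ℝ)} {U : ℕ → Ω → ℝ} {D : ℕ → Ω → X}

/-- The tower property, for a disintegration of the law of `(V, W)`. -/
theorem integral_compProd_comp {β S : Type*} [MeasurableSpace β] [MeasurableSpace S]
    [IsProbabilityMeasure P] {V : Ω → β} {W : Ω → S} {κ : Kernel β S} [IsSFiniteKernel κ]
    (hV : Measurable V) (hW : Measurable W)
    (hp : P.map (fun ω => (V ω, W ω)) = P.map V ⊗ₘ κ) {F : β × S → ℝ} (hF : Measurable F)
    (hi : Integrable (fun ω => F (V ω, W ω)) P) :
    Integrable (fun ω => ∫ p, F (V ω, p) ∂(κ (V ω))) P ∧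
      ∫ ω, ∫ p, F (V ω, p) ∂(κ (V ω)) ∂P = ∫ ω, F (V ω, W ω) ∂P := by
  have hVW : Measurable fun ω => (V ω, W ω) := hV.prodMk hW
  have : IsProbabilityMeasure (P.map V) := Measure.isProbabilityMeasure_map hV.aemeasurable
  have hiF := (integrable_map_measure (μ := P) hF.aestronglyMeasurable hVW.aemeasurable).2 hi
  have heF := integral_map (μ := P) hVW.aemeasurable hF.aestronglyMeasurable
  rw [hp] at hiF heF
  have hiG := integrable_integral_compProd hiF
  rw [Measure.integral_compProd hiF, integral_map hV.aemeasurable hiG.aestronglyMeasurable] at heF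
  exact ⟨hiG.comp_measurable hV, heF⟩

/-- The expected gain of an observation at the point `d ∘ V`, when `ν ∘ V` is the conditional
distribution of `ξ` given `V`. -/
theorem integral_gain_comp [IsProbabilityMeasure P] {β : Type*} {mβ : MeasurableSpace β}
    {V : Ω → β} {u : Ω → ℝ} {d : β → X} {ν : β → GaussianMeasures X} (hV : Measurable V)
    (hξ : Measurable ξ) (hu : Measurable u) (hd : Measurable d) (hν : Measurable ν)
    (hp : P.map (fun ω => (V ω, (ξ ω, u ω))) = P.map V ⊗ₘ (noisyKernel X).comap ν hν)
    (hi₀ : Integrable (fun ω => maxValue (meanMap (ν (V ω)))) P)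
    (hi₁ : Integrable (fun ω => maxValue (meanMap
      (cond τ (d (V ω)) (noisyObs τ (d (V ω)) (ξ ω, u ω)) (ν (V ω))))) P) :
    Integrable (fun ω => gain τ (d (V ω)) (ν (V ω))) P ∧
      ∫ ω, gain τ (d (V ω)) (ν (V ω)) ∂P =
        ∫ ω, maxValue (meanMap
          (cond τ (d (V ω)) (noisyObs τ (d (V ω)) (ξ ω, u ω)) (ν (V ω)))) ∂P -
        ∫ ω, maxValue (meanMap (ν (V ω))) ∂P := by
  have hz : Measurable fun q : β × (C(X, ℝ) × ℝ) => noisyObs τ (d q.1) q.2 :=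
    measurable_noisyObs τ (hd.comp measurable_fst) measurable_snd
  have hc : Measurable fun q : β × (C(X, ℝ) × ℝ) =>
      cond τ (d q.1) (noisyObs τ (d q.1) q.2) (ν q.1) :=
    measurable_cond_apply (d := fun q : β × (C(X, ℝ) × ℝ) => d q.1) (ν := fun q => ν q.1)
      (hd.comp measurable_fst) hz (hν.comp measurable_fst)
  have hF : Measurable fun q : β × (C(X, ℝ) × ℝ) =>
      maxValue (meanMap (cond τ (d q.1) (noisyObs τ (d q.1) q.2) (ν q.1))) :=
    measurable_maxValue_meanMap.comp hc
  obtain ⟨hiG, heG⟩ := integral_compProd_comp (W := fun ω => (ξ ω, u ω)) hV (hξ.prodMk hu) hp hF hi₁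
  simp only [Kernel.comap_apply, noisyKernel_apply, integral_maxValue_meanMap_cond] at hiG heG
  have hgain : Integrable (fun ω => gain τ (d (V ω)) (ν (V ω))) P :=
    (integrable_add_iff_integrable_right hi₀).1 hiG
  refine ⟨hgain, ?_⟩
  rw [integral_add hi₀ hgain] at heG
  exact eq_sub_of_add_eq' heG

/-- The expected increase of the maximum of the posterior mean at step `n` is the expected gain. -/
theorem integral_gain_posterior [IsProbabilityMeasure P] (hM : IsGPModel P ξ U)
    (hD : IsSequentialDesign τ ξ U D) (n : ℕ) :
    Integrable (fun ω => gain τ (D n ω) (posterior τ hM D n ω)) P ∧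
      ∫ ω, gain τ (D n ω) (posterior τ hM D n ω) ∂P =
        ∫ ω, maxValue (meanMap (posterior τ hM D (n + 1) ω)) ∂P -
        ∫ ω, maxValue (meanMap (posterior τ hM D n ω)) ∂P :=
  integral_gain_comp (mβ := info τ ξ U D n) (V := id) (measurable_id'' (info_le hM hD n))
    (measurable_of_eval hM.measurable_eval) (hM.measurable_noise n) (hD n)
    (measurable_info_posterior hM n)
    (map_info_eq_compProd hM hD n (isCondDist_posterior hM hD n))
    (integrable_maxValue_meanMap_posterior hM hD n)
    (integrable_maxValue_meanMap_posterior hM hD (n + 1))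

/-- For an arbitrary sequential design, the gains at the design points vanish asymptotically: their
expectations sum to the expected increase of the maximum of the posterior mean, which is bounded. -/
theorem ae_tendsto_gain_posterior [IsProbabilityMeasure P] (hM : IsGPModel P ξ U)
    (hD : IsSequentialDesign τ ξ U D) :
    ∀ᵐ ω ∂P, Tendsto (fun n => gain τ (D n ω) (posterior τ hM D n ω)) atTop (𝓝 0) := by
  refine ae_tendsto_zero_of_sum_integral_le (fun n => (integral_gain_posterior hM hD n).1)
    (fun n ω => gain_nonneg τ _ _) (C := ∫ ω, maxValue (ξ ω) ∂P -
      ∫ ω, maxValue (meanMap (posterior τ hM D 0 ω)) ∂P) fun N => ?_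
  simp_rw [(integral_gain_posterior hM hD _).2]
  rw [Finset.sum_range_sub fun n => ∫ ω, maxValue (meanMap (posterior τ hM D n ω)) ∂P]
  refine sub_le_sub_right ?_ _
  have hξ : Measurable ξ := measurable_of_eval hM.measurable_eval
  have hi : Integrable (fun ω => maxValue (ξ ω)) P :=
    (integrable_maxValue hM.prior).comp_measurable hξ
  rw [← integral_condExp (info_le hM hD N) (f := fun ω => maxValue (ξ ω))]
  refine integral_mono_ae (integrable_maxValue_meanMap_posterior hM hD N) integrable_condExp ?_
  filter_upwards [(isCondDist_posterior hM hD N).condExp_ae_eq (info_le hM hD N) hξ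
    continuous_maxValue.measurable hi] with ω hω
  rw [hω]
  exact maxValue_meanMap_le _

/-- A near-minimizer of the criterion is a near-maximizer of the gain. -/
theorem IsNearMinimizer.gain_le {ν : GaussianMeasures X} {ε : ℝ} (hε : 0 ≤ ε) {x : X}
    (h : IsNearMinimizer τ knowledgeGradientFunctional ν ε x) (y : X) :
    gain τ y ν ≤ gain τ x ν + ε := by
  have h1 := h.trans (add_le_add_left (iInf_le _ y) _)
  obtain ⟨e1, -⟩ := samplingCriterion_eq τ x ν
  obtain ⟨e2, p2⟩ := samplingCriterion_eq τ y ν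
  rw [e1, e2, ← ENNReal.ofReal_add p2 hε, ENNReal.ofReal_le_ofReal_iff (by linarith)] at h1
  linarith

/-- Under a quasi-SUR design the maximal gain vanishes asymptotically, and therefore also at the
limit of the posteriors. -/
theorem ae_maxGain_of_isQuasiSUR [IsProbabilityMeasure P] (hM : IsGPModel P ξ U)
    (hQ : IsQuasiSUR τ knowledgeGradientFunctional hM D) {νlim : Ω → GaussianMeasures X}
    (hlim : ∀ᵐ ω ∂P, GaussianTendsto (fun n => posterior τ hM D n ω) (νlim ω)) :
    ∀ᵐ ω ∂P, maxGain τ knowledgeGradientFunctional (νlim ω) = 0 ∧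
      Tendsto (fun n => maxGain τ knowledgeGradientFunctional (posterior τ hM D n ω)) atTop
        (𝓝 0) := by
  obtain ⟨ε, hε, hε0, hD, n₀, hn₀⟩ := hQ
  have hall := ae_all_iff.2 fun n => ae_all_iff.2 (hn₀ n)
  filter_upwards [hall, hlim, ae_tendsto_gain_posterior hM hD] with ω h1 h2 h3
  have hc : Tendsto (fun n => gain τ (D n ω) (posterior τ hM D n ω) + ε n) atTop (𝓝 0) := by
    simpa using h3.add hε0
  have hle : ∀ x, ∀ᶠ n in atTop, gain τ x (posterior τ hM D n ω) ≤
      gain τ (D n ω) (posterior τ hM D n ω) + ε n := fun x => by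
    filter_upwards [eventually_ge_atTop n₀] with n hn
    exact (h1 n hn).gain_le (hε n).le x
  refine ⟨(maxGain_eq_zero_iff τ _).2 fun x => h2.gain_le τ x hc (hle x), ?_⟩
  refine tendsto_of_tendsto_of_tendsto_of_le_of_le' tendsto_const_nhds
    ((continuous_coe_real_ereal.tendsto 0).comp hc)
    (Eventually.of_forall fun n => maxGain_nonneg τ _) ?_
  filter_upwards [eventually_ge_atTop n₀] with n hn
  rw [maxGain_eq]
  exact iSup_le fun x => EReal.coe_le_coe_iff.2 ((h1 n hn).gain_le (hε n).le x)

/-- For an arbitrary sequential design, the posteriors converge, and so do the values of `H`. -/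
theorem exists_limit_posterior [IsProbabilityMeasure P] (hM : IsGPModel P ξ U)
    (hD : IsSequentialDesign τ ξ U D) :
    ∃ νlim : Ω → GaussianMeasures X,
      Measurable[⨆ n, info τ ξ U D n] νlim ∧
      IsCondDist P ξ (⨆ n, info τ ξ U D n) νlim ∧
      (∀ᵐ ω ∂P, GaussianTendsto (fun n => posterior τ hM D n ω) (νlim ω)) ∧
      ∀ᵐ ω ∂P, Tendsto (fun n => knowledgeGradientFunctional (posterior τ hM D n ω)) atTop
        (𝓝 (knowledgeGradientFunctional (νlim ω))) := by
  have hξ : Measurable ξ := measurable_of_eval hM.measurable_eval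
  obtain ⟨νlim, h1, h2, h3⟩ := exists_gaussianTendsto (ℱ := designFiltration hM hD) hξ
    hM.prior.2 (isCondDist_posterior hM hD)
  refine ⟨νlim, h1, h2, h3, ?_⟩
  have hi := integrable_maxValue hM.prior
  have h4 := ae_tendsto_integral (ℱ := designFiltration hM hD) hξ (isCondDist_posterior hM hD)
    continuous_maxValue.measurable hi (h2.condExp_ae_eq (iSup_le (info_le hM hD)) hξ
      continuous_maxValue.measurable (hi.comp_measurable hξ))
  filter_upwards [h3, h4] with ω h3 h4
  simp_rw [knowledgeGradientFunctional_eq]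
  exact h4.sub ((continuous_maxValue.tendsto _).comp h3.meanMap)

end Convergence

end SUR

theorem mainTheorem9 {X : Type u} [MetricSpace X] [CompactSpace X] [Nonempty X]
    [MeasurableSpace X] [BorelSpace X] (τ : C(X, ℝ≥0)) :
    -- the loss is regular
    SUR.IsRegularLoss.{u, u, w} τ (SUR.knowledgeGradientLoss : C(X, ℝ) → X → ℝ) ∧
    -- the associated functional
    (∀ ν : SUR.GaussianMeasures X, SUR.knowledgeGradientFunctional ν =
      ∫ f, (⨆ u : X, f u) ∂ν.1 - ⨆ u : X, SUR.mean ν u) ∧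
    -- measurability, supermartingale property, admissible decomposition
    (Measurable (SUR.knowledgeGradientFunctional : SUR.GaussianMeasures X → ℝ) ∧
      (∀ ν : SUR.GaussianMeasures X, 0 ≤ SUR.knowledgeGradientFunctional ν) ∧
      SUR.HasSupermartingaleProperty.{u, w} τ SUR.knowledgeGradientFunctional ∧
      ∃ L₀ H₁, SUR.IsRegularDecomposition.{u, w} SUR.knowledgeGradientFunctional L₀ H₁ ∧
        SUR.HasSupermartingaleProperty.{u, w} τ H₁) ∧
    ∀ (Ω : Type w) [MeasurableSpace Ω] (P : Measure Ω) [IsProbabilityMeasure P]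
      (ξ : Ω → C(X, ℝ)) (U : ℕ → Ω → ℝ) (hM : SUR.IsGPModel P ξ U),
      -- existence of quasi-SUR designs, with near-minimization at every step and everywhere
      (∀ ε : ℕ → ℝ, (∀ n, 0 < ε n) → ∃ D : ℕ → Ω → X,
        SUR.IsEpsQuasiSUR τ SUR.knowledgeGradientFunctional hM ε D ∧
        ∀ n ω, SUR.IsNearMinimizer τ SUR.knowledgeGradientFunctional
          (SUR.posterior τ hM D n ω) (ε n) (D n ω)) ∧
      ∀ D : ℕ → Ω → X, SUR.IsSequentialDesign τ ξ U D →
        -- the posterior is the conditional distribution given the first `n` observations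
        (∀ n, Measurable[SUR.info τ ξ U D n] (SUR.posterior τ hM D n) ∧
          SUR.IsCondDist P ξ (SUR.info τ ξ U D n) (SUR.posterior τ hM D n)) ∧
        -- limit of the posteriors
        (∃ νlim : Ω → SUR.GaussianMeasures X,
          Measurable[⨆ n, SUR.info τ ξ U D n] νlim ∧
          SUR.IsCondDist P ξ (⨆ n, SUR.info τ ξ U D n) νlim ∧
          (∀ᵐ ω ∂P, SUR.GaussianTendsto (fun n => SUR.posterior τ hM D n ω) (νlim ω)) ∧
          (∀ᵐ ω ∂P,
            Tendsto (fun n => SUR.knowledgeGradientFunctional (SUR.posterior τ hM D n ω)) atTop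
              (𝓝 (SUR.knowledgeGradientFunctional (νlim ω)))) ∧
          (SUR.IsQuasiSUR τ SUR.knowledgeGradientFunctional hM D → ∀ᵐ ω ∂P,
            SUR.maxGain τ SUR.knowledgeGradientFunctional (νlim ω) = 0 ∧
            Tendsto (fun n => SUR.maxGain τ SUR.knowledgeGradientFunctional
              (SUR.posterior τ hM D n ω)) atTop (𝓝 0))) ∧
        -- almost sure convergence of the residual uncertainty for quasi-SUR designs
        (SUR.IsQuasiSUR τ SUR.knowledgeGradientFunctional hM D →
          ∀ᵐ ω ∂P, Tendsto
            (fun n => SUR.knowledgeGradientFunctional (SUR.posterior τ hM D n ω)) atTop (𝓝 0)) := by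
  refine ⟨SUR.isRegularLoss_knowledgeGradientLoss τ, fun ν => ?_,
    ⟨SUR.measurable_knowledgeGradientFunctional, SUR.knowledgeGradientFunctional_nonneg,
      SUR.hasSupermartingaleProperty_knowledgeGradientFunctional τ,
      SUR.maxValue, _, SUR.isRegularDecomposition_knowledgeGradient,
      SUR.hasSupermartingaleProperty_neg_maxValue_meanMap τ⟩, ?_⟩
  · rw [SUR.knowledgeGradientFunctional_eq, SUR.maxValue, ← funext (SUR.meanMap_apply ν)]
    rfl
  intro Ω _ P _ ξ U hM
  refine ⟨fun ε hε => SUR.exists_isEpsQuasiSUR τ hM hε, fun D hD => ?_⟩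
  obtain ⟨νlim, h1, h2, h3, h4⟩ := SUR.exists_limit_posterior hM hD
  refine ⟨fun n => ⟨SUR.measurable_info_posterior hM n, SUR.isCondDist_posterior hM hD n⟩,
    ⟨νlim, h1, h2, h3, h4, fun hQ => SUR.ae_maxGain_of_isQuasiSUR hM hQ h3⟩, fun hQ => ?_⟩
  filter_upwards [h4, SUR.ae_maxGain_of_isQuasiSUR hM hQ h3] with ω h4 h5
  rwa [(SUR.knowledgeGradientFunctional_eq_zero_iff τ _).2 h5.1] at h4
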